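/- Let $0<\alpha<1$ and $\delta>0$. Let $\underline E=(E_1>E_2>\dots)$ be the decreasing enumeration of the points of a Poisson point process on $\mathbb R$ with intensity measure $\alpha e^{-\alpha y}\,dy$ (the energy landscape). For $E,E_0\in\mathbb R$ put $N_E=|\{i: E_i\ge E\}|$, $\tau_0=e^{E_0}$ and $x_i=\tau_0e^{-E_i}$. Given $\underline E$, let $Y_E$ be the continuous-time random walk on $\{1,\dots,N_E\}$ with uniform initial distribution which, after arriving at a site $i$, waits an exponential time of mean $\frac{N_E}{N_E-1}x_i^{-1}$ and then jumps to a uniformly chosen site different from $i$; let $\mathbb P_E$ be its law (it depends also on $E_0$; only thresholds $E$ with $N_E\ge 2$ matter below), and let $x_E(t)=x_k$ if $Y_E(t)=k$. Define $$\Pi_E(t,t_w)=\mathbb P_E\bigl(Y_E(s)=Y_E(t_w)\ \ \forall s\in[t_w,t_w+t]\bigr),$$ $$\Pi^{(1)}_E(t,t_w)=\mathbb P_E\bigl(x_E(u)\ge\delta\ \ \forall u\in(t_w,t_w+t]\ \text{such that}\ x_E(u)\ne x_E(u^-)\bigr).$$ Then, for almost all $\underline E$, $$\lim_{t_w\uparrow\infty}\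 \sup_{t>0}\ \limsup_{E_0\downarrow-\infty}\ \limsup_{E\downarrow-\infty}\bigl|\Pi^{(1)}_E(t,t_w)-\Pi_E(t,t_w)\bigr|=0 .$$ In particular, for almost all $\underline E$, $$\lim_{t_w\uparrow\infty}\ \lim_{E_0\downarrow-\infty}\ \lim_{E\downarrow-\infty}\Pi^{(1)}_E(\theta t_w,t_w)=\frac{\sin(\pi\alpha)}{\pi}\int_{\frac{\theta}{1+\theta}}^1u^{-\alpha}(1-u)^{\alpha-1}\,du\qquad\forall\,\theta>0,$$ where the inner limits exist for all $t_w>0$ and $E_0\in\mathbb R$. -/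

import Mathlib

open MeasureTheory ProbabilityTheory Filter Topology

namespace TrapModel

/-- The random measure `Ξ` is a Poisson point process with intensity measure `ν` under `P`:
the mass of every measurable set of finite intensity is Poisson distributed with that intensity as
its mean, and the masses of pairwise disjoint measurable sets are independent. -/
structure IsPoissonPointProcess {Ω S : Type*} [MeasurableSpace Ω] [MeasurableSpace S]
    (Ξ : Ω → Measure S) (ν : Measure S) (P : Measure Ω) : Prop where
  measurable : Measurable Ξ
  law : ∀ B : Set S, MeasurableSet B → ν B ≠ ⊤ →
    P.map (fun ω => Ξ ω B) = (poissonMeasure (ν B).toNNReal).map (fun k : ℕ => (k : ENNReal))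
  indep : ∀ (n : ℕ) (B : Fin n → Set S), (∀ k, MeasurableSet (B k)) →
    Pairwise (fun k l => Disjoint (B k) (B l)) → iIndepFun (fun k ω => Ξ ω (B k)) P

/-- The measure `α e^{-α y} dy` on the real line. -/
noncomputable def landscapeIntensity (α : ℝ) : Measure ℝ :=
  volume.withDensity fun y => ENNReal.ofReal (α * Real.exp (-(α * y)))

/-- `E 0 ω > E 1 ω > E 2 ω > ⋯` is the decreasing enumeration of the points of a Poisson point
process on the real line with intensity measure `α e^{-α y} dy`. -/
structure IsEnergyLandscape {Ω : Type*} [MeasurableSpace Ω]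
    (α : ℝ) (E : ℕ → Ω → ℝ) (P : Measure Ω) : Prop where
  measurable : ∀ i, Measurable (E i)
  decreasing : ∀ᵐ ω ∂P, StrictAnti fun i => E i ω
  poisson : IsPoissonPointProcess (fun ω => Measure.sum fun i => Measure.dirac (E i ω))
    (landscapeIntensity α) P

/-! ### The random walk with jump parameters `x` on the complete graph with `N` vertices -/

/-- The law of the site reached by a jump from `i`: uniform on the sites different from `i`.
(If there is no other site, the convention is that the walk stays at `i`.) -/
noncomputable def jumpLaw (N : ℕ) (i : Fin N) : Measure (Fin N) :=
  if 2 ≤ N then uniformOn {j | j ≠ i} else Measure.dirac i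

instance instIsProbabilityMeasureJumpLaw (N : ℕ) (i : Fin N) : IsProbabilityMeasure (jumpLaw N i) := by
  unfold jumpLaw
  split_ifs with h
  · refine isProbabilityMeasure_uniformOn (Set.toFinite _) ?_
    have : Nontrivial (Fin N) := Fin.nontrivial_iff_two_le.mpr h
    exact exists_ne i
  · infer_instance

instance instIsProbabilityMeasureExp : IsProbabilityMeasure (expMeasure 1) := isProbabilityMeasure_expMeasure one_pos

/-- The randomness of one step of the walk: a standard exponential variable, which drives the
waiting time, and independently of it, for every site `i`, a site drawn from `jumpLaw N i`, to
which the walk jumps if it is at `i`. -/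
noncomputable def stepLaw (N : ℕ) : Measure (ℝ × (Fin N → Fin N)) :=
  (expMeasure 1).prod (Measure.pi (jumpLaw N))

instance instIsProbabilityMeasureStepLaw (N : ℕ) : IsProbabilityMeasure (stepLaw N) := by
  unfold stepLaw
  infer_instance

/-- The sample space of the walk: an initial site and the randomness of the successive steps. -/
abbrev Sample (N : ℕ) : Type := Fin N × (ℕ → ℝ × (Fin N → Fin N))

/-- The initial site is uniform, the steps are independent of it and i.i.d. -/
noncomputable def walkLaw (N : ℕ) : Measure (Sample N) :=
  (uniformOn Set.univ).prod (Measure.infinitePi fun _ : ℕ => stepLaw N)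

/-- The `n`-th visited site. -/
def site {N : ℕ} (p : Sample N) : ℕ → Fin N
  | 0 => p.1
  | n + 1 => (p.2 n).2 (site p n)

/-- The waiting time at the `n`-th visited site `i`: exponential with mean `N / (N - 1) * x_i⁻¹`. -/
noncomputable def waitingTime {N : ℕ} (x : Fin N → ℝ) (p : Sample N) (n : ℕ) : ℝ :=
  (N : ℝ) / ((N : ℝ) - 1) * (x (site p n))⁻¹ * (p.2 n).1

/-- The time of the `n`-th jump (with `jumpTime x p 0 = 0`). -/
noncomputable def jumpTime {N : ℕ} (x : Fin N → ℝ) (p : Sample N) (n : ℕ) : ℝ :=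
  ∑ k ∈ Finset.range n, waitingTime x p k

/-- The position `Y(t)` of the walk at time `t`: the `n`-th visited site if `t` lies between the
`n`-th jump (included) and the `(n+1)`-st jump (excluded). -/
noncomputable def walk {N : ℕ} (x : Fin N → ℝ) (p : Sample N) (t : ℝ) : Fin N :=
  site p (sInf {n : ℕ | t < jumpTime x p (n + 1)})

/-- The probability that the walk does not move during `[tw, tw + t]`. -/
noncomputable def stayProb {N : ℕ} (x : Fin N → ℝ) (t tw : ℝ) : ℝ :=
  (walkLaw N).real {p | ∀ s ∈ Set.Icc tw (tw + t), walk x p s = walk x p tw}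

/-- The probability that `x(u) ≥ δ` at all times `u ∈ (tw, tw + t]` with `x(u) ≠ x(u⁻)`, where
`x(u) = x_k` if `Y(u) = k`. -/
noncomputable def shallowJumpProb {N : ℕ} (x : Fin N → ℝ) (δ t tw : ℝ) : ℝ :=
  (walkLaw N).real {p | ∀ u ∈ Set.Ioc tw (tw + t),
    x (walk x p u) ≠ Function.leftLim (fun s => x (walk x p s)) u → δ ≤ x (walk x p u)}

/-! ### The trap model on an energy landscape

Here `e` is a (decreasing) energy landscape, `E` is the energy threshold and `E₀` is the
logarithm of the time unit `τ₀ = exp E₀`. -/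

/-- `N_E`, the number of points of the landscape that are not below the threshold `E`. -/
noncomputable def numSites (e : ℕ → ℝ) (E : ℝ) : ℕ := {i : ℕ | E ≤ e i}.ncard

/-- `x_i = τ₀ exp (-E_i)` for the sites `i` of the landscape above the threshold `E`. -/
noncomputable def rates (e : ℕ → ℝ) (E E₀ : ℝ) (i : Fin (numSites e E)) : ℝ :=
  Real.exp E₀ * Real.exp (-(e i))

/-- The correlation function `Π_E(t, tw)`. -/
noncomputable def corr (e : ℕ → ℝ) (E E₀ t tw : ℝ) : ℝ :=
  stayProb (rates e E E₀) t tw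

/-- The correlation function `Π⁽¹⁾_E(t, tw)`, with parameter `δ`. -/
noncomputable def corrOne (e : ℕ → ℝ) (δ E E₀ t tw : ℝ) : ℝ :=
  shallowJumpProb (rates e E E₀) δ t tw

/-- The ageing function. -/
noncomputable def ageing (α θ : ℝ) : ℝ :=
  Real.sin (Real.pi * α) / Real.pi *
    ∫ u in (θ / (1 + θ))..1, u ^ (-α) * (1 - u) ^ (α - 1)

end TrapModel

/-!
The correlation functions are averages over the initial site of functions that solve
`∂ₛ y = gen x y`, where `gen x` is the generator of the walk that leaves `i` at rate `x i` for a
uniformly chosen site, possibly `i` itself; the waiting times of mean `N / ((N - 1) x i)` are exactly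
those of this walk after its void jumps are removed. `gen x` is symmetric for the weights `1 / x i`
and is a rank one perturbation of a diagonal operator, with two consequences.

* The Laplace transform in the waiting time of the average of a solution is explicit
  (`IsFlow.laplace_mean`), and only involves the Stieltjes transform `∑ i, 1 / (w + x i)`.
* The average is Lipschitz in the waiting time, with a constant which, for the correlation functions,
  depends neither on the rates nor on the number of sites (`IsFlow.mean_gen_sq_le`,
  `abs_mean_windowProb_sub_le`). So all limits can be taken inside Laplace transforms: bounded
  functions converge if their Laplace transforms do and if they are equicontinuous
  (`exists_tendsto_of_laplace`, `tendsto_of_laplace`).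

If, with `S = {i | δ ≤ x i}`, the walk jumps in `(tw, tw + t]`, but only to sites of `S`, then it is
in `S` at time `tw + t`. The difference of the two correlation functions is therefore at most the
probability to be in `S` at time `tw + t`, which is controlled by the ratio of the Stieltjes transforms
at `δ` and at `1 / (tw + t)` (`mean_occProb_le`).

Almost surely, the number of points of the landscape above `-log a` is asymptotic to `a ^ α`
(`IsEnergyLandscape.ae_isRegular`, by Chebyshev's inequality and the Borel-Cantelli lemma). Hence the
Stieltjes transform at `w`, suitably normalized, tends to a multiple of `w ^ (α - 1)` as `E₀ → -∞`, and
the bound above tends to `errorBound α δ (tw + t)`, of order `((tw + t) δ) ^ ((α - 1) / 2)`; this gives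
the first assertion. In the same limit the Laplace transform of `Π` tends to that of the ageing
function, which is a convolution of powers (`laplace_ageing`). For `Π⁽¹⁾` the limit need not be
identified, but it has to exist. Its Laplace transform in the waiting time is a sum
over the probabilities to make, from a given site, only jumps to `S` up to time `t`; a second Laplace
transform, in `t`, makes this sum explicit and shows that it converges
(`IsRegular.exists_tendsto_tsum_survProb`).
-/

/-! ### A continuity theorem for Laplace transforms -/

namespace TrapModel

lemma integrableOn_exp_neg_mul {c : ℝ} (hc : 0 < c) :
    IntegrableOn (fun s : ℝ => Real.exp (-(c * s))) (Set.Ioi 0) := by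
  simpa [neg_mul] using exp_neg_integrableOn_Ioi 0 hc

lemma integral_exp_neg_mul {c : ℝ} (hc : 0 < c) :
    ∫ s in Set.Ioi (0 : ℝ), Real.exp (-(c * s)) = c⁻¹ := by
  have := integral_exp_mul_Ioi (a := -c) (by linarith) 0
  simpa [neg_mul, neg_div, div_neg] using this

/-- The Laplace transform of a bounded function converges. -/
lemma integrableOn_exp_mul_of_bounded {D : ℝ → ℝ} {C c : ℝ} (hc : 0 < c)
    (hD : ∀ s, 0 < s → |D s| ≤ C)
    (hm : AEStronglyMeasurable D (volume.restrict (Set.Ioi 0))) :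
    IntegrableOn (fun s : ℝ => Real.exp (-(c * s)) * D s) (Set.Ioi 0) := by
  refine Integrable.mul_bdd (c := C) (integrableOn_exp_neg_mul hc) hm ?_
  filter_upwards [ae_restrict_mem measurableSet_Ioi] with s hs
  exact hD s hs

/-- A continuity theorem for Laplace transforms: if the Laplace transforms of uniformly bounded
functions tend to zero along an arithmetic progression, then so do the functions, at every point
at which they are asymptotically equicontinuous from the right. The proof substitutes
`w = exp (-s)`, and approximates a bump function of `w` by polynomials. -/
lemma tendsto_zero_of_laplace {ι : Type*} {l : Filter ι} {D : ι → ℝ → ℝ} {C c : ℝ} (hc : 0 < c)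
    (hD : ∀ a s, 0 < s → |D a s| ≤ C)
    (hm : ∀ a, AEStronglyMeasurable (D a) (volume.restrict (Set.Ioi 0)))
    (hL : ∀ m : ℕ, Tendsto
      (fun a => ∫ s in Set.Ioi (0 : ℝ), Real.exp (-((c + m) * s)) * D a s) l (𝓝 0))
    {s : ℝ} (hs : 0 < s)
    (heq : ∀ η > 0, ∃ ε > 0, ∀ᶠ a in l, ∀ v ∈ Set.Icc s (s + ε), |D a v - D a s| ≤ η) :
    Tendsto (fun a => D a s) l (𝓝 0) := by
  rcases l.eq_or_neBot with rfl | hne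
  · exact tendsto_bot
  have hC : 0 ≤ C := by
    obtain ⟨a⟩ : Nonempty ι := hne.nonempty
    exact (abs_nonneg _).trans (hD a 1 one_pos)
  rw [Metric.tendsto_nhds]
  intro η' hη'
  set η := η' / 4 with hη
  have hηpos : 0 < η := by positivity
  obtain ⟨ε, hε, hev⟩ := heq η hηpos
  set w₁ := Real.exp (-(s + ε)) with hw₁
  set w₂ := Real.exp (-s) with hw₂
  have hw₁₂ : w₁ < w₂ := Real.exp_lt_exp.2 (by linarith)
  set φ : ℝ → ℝ := fun w => max 0 ((w - w₁) * (w₂ - w)) with hφ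
  have hφc : Continuous φ := by fun_prop
  have hφ0 : ∀ w, 0 ≤ φ w := fun w => le_max_left _ _
  set k : ℝ → ℝ := fun v => Real.exp (-(c * v)) * φ (Real.exp (-v)) with hk
  have hkc : Continuous k := by fun_prop
  have hk0 : ∀ v, 0 ≤ k v := fun v => mul_nonneg (Real.exp_nonneg _) (hφ0 _)
  have hksupp : ∀ v, v ∉ Set.Icc s (s + ε) → k v = 0 := by
    intro v hv
    have : φ (Real.exp (-v)) = 0 := by
      apply max_eq_left
      rcases lt_or_ge v s with h | h
      · have h1 : w₂ < Real.exp (-v) := Real.exp_lt_exp.2 (by linarith)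
        nlinarith
      · have h2 : s + ε < v := by
          by_contra h'
          exact hv ⟨h, not_lt.1 h'⟩
        have h1 : Real.exp (-v) < w₁ := Real.exp_lt_exp.2 (by linarith)
        nlinarith
    simp [hk, this]
  have hφb : ∀ w ∈ Set.Icc (0 : ℝ) 1, |φ w| ≤ 1 := by
    intro w hw
    rw [abs_of_nonneg (hφ0 w)]
    have h1 : 0 < w₁ := Real.exp_pos _
    have h2 : w₂ < 1 := Real.exp_lt_one_iff.2 (by linarith)
    refine max_le zero_le_one ?_
    rcases le_or_gt w w₁ with h | h
    · rcases le_or_gt w w₂ with h' | h' <;> nlinarith [hw.1, hw.2]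
    · rcases le_or_gt w w₂ with h' | h' <;> nlinarith [hw.1, hw.2]
  have hexp : ∀ v, 0 < v → Real.exp (-v) ∈ Set.Icc (0 : ℝ) 1 := fun v hv =>
    ⟨Real.exp_nonneg _, Real.exp_le_one_iff.2 (by linarith)⟩
  have hkint : IntegrableOn k (Set.Ioi 0) :=
    integrableOn_exp_mul_of_bounded (C := 1) hc (fun v hv => hφb _ (hexp v hv))
      (by fun_prop)
  set I := ∫ v in Set.Ioi (0 : ℝ), k v with hI
  have hIpos : 0 < I := by
    rw [hI, setIntegral_pos_iff_support_of_nonneg_ae (Eventually.of_forall hk0) hkint]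
    have hsub : Set.Ioo s (s + ε) ⊆ Function.support k ∩ Set.Ioi 0 := by
      intro v hv
      refine ⟨?_, hs.trans hv.1⟩
      have h1 : w₁ < Real.exp (-v) := Real.exp_lt_exp.2 (by linarith [hv.2])
      have h2 : Real.exp (-v) < w₂ := Real.exp_lt_exp.2 (by linarith [hv.1])
      have : 0 < k v := by
        refine mul_pos (Real.exp_pos _) (lt_max_of_lt_right ?_)
        exact mul_pos (by linarith) (by linarith)
      exact this.ne'
    refine lt_of_lt_of_le ?_ (measure_mono hsub)
    simp [hε]
  obtain ⟨p, hp⟩ := exists_polynomial_near_of_continuousOn 0 1 φ hφc.continuousOn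
    (η * I * c / (C + 1)) (by positivity)
  have hDk : ∀ a, IntegrableOn (fun v => k v * D a v) (Set.Ioi 0) := by
    intro a
    refine Integrable.mul_bdd (c := C) hkint (hm a) ?_
    filter_upwards [ae_restrict_mem measurableSet_Ioi] with s hs
    exact hD a s hs
  -- The integral against the polynomial approximation is a combination of Laplace transforms.
  have hpoly : ∀ a, ∫ v in Set.Ioi (0 : ℝ), Real.exp (-(c * v)) * p.eval (Real.exp (-v)) * D a v
      = ∑ m ∈ Finset.range (p.natDegree + 1),
        p.coeff m * ∫ v in Set.Ioi (0 : ℝ), Real.exp (-((c + m) * v)) * D a v := by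
    intro a
    simp_rw [← integral_const_mul]
    rw [← integral_finsetSum]
    · refine integral_congr_ae (Eventually.of_forall fun v => ?_)
      simp only [Polynomial.eval_eq_sum_range, Finset.mul_sum, Finset.sum_mul]
      refine Finset.sum_congr rfl fun m _ => ?_
      rw [← Real.exp_nat_mul]
      have : Real.exp (-((c + m) * v)) = Real.exp (-(c * v)) * Real.exp (m * -v) := by
        rw [← Real.exp_add]; ring_nf
      rw [this]; ring
    · intro m _
      exact (integrableOn_exp_mul_of_bounded (by positivity) (hD a) (hm a)).const_mul _
  have hpolyint : ∀ a, IntegrableOn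
      (fun v => Real.exp (-(c * v)) * p.eval (Real.exp (-v)) * D a v) (Set.Ioi 0) := by
    intro a
    have : ∀ v, Real.exp (-(c * v)) * p.eval (Real.exp (-v)) * D a v
      = ∑ m ∈ Finset.range (p.natDegree + 1),
        p.coeff m * (Real.exp (-((c + m) * v)) * D a v) := by
      intro v
      simp only [Polynomial.eval_eq_sum_range, Finset.mul_sum, Finset.sum_mul]
      refine Finset.sum_congr rfl fun m _ => ?_
      rw [← Real.exp_nat_mul]
      have : Real.exp (-((c + m) * v)) = Real.exp (-(c * v)) * Real.exp (m * -v) := by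
        rw [← Real.exp_add]; ring_nf
      rw [this]; ring
    simp_rw [this]
    exact integrable_finsetSum _ fun m _ =>
      (integrableOn_exp_mul_of_bounded (by positivity) (hD a) (hm a)).const_mul _
  have hlim : Tendsto (fun a =>
      ∫ v in Set.Ioi (0 : ℝ), Real.exp (-(c * v)) * p.eval (Real.exp (-v)) * D a v) l (𝓝 0) := by
    simp_rw [hpoly]
    have := tendsto_finsetSum (Finset.range (p.natDegree + 1))
      (fun m _ => (hL m).const_mul (p.coeff m))
    simpa using this
  have hlim' := (Metric.tendsto_nhds.1 hlim) (η * I) (by positivity)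
  filter_upwards [hlim', hev] with a ha hva
  rw [Real.dist_eq, sub_zero] at ha ⊢
  have h1 : |∫ v in Set.Ioi (0 : ℝ), k v * D a v| ≤ 2 * (η * I) := by
    have hdiff : |(∫ v in Set.Ioi (0 : ℝ), k v * D a v) -
        ∫ v in Set.Ioi (0 : ℝ), Real.exp (-(c * v)) * p.eval (Real.exp (-v)) * D a v|
        ≤ η * I := by
      rw [← integral_sub (hDk a) (hpolyint a), ← Real.norm_eq_abs]
      have hb : ∀ v ∈ Set.Ioi (0 : ℝ), ‖k v * D a v -
          Real.exp (-(c * v)) * p.eval (Real.exp (-v)) * D a v‖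
          ≤ Real.exp (-(c * v)) * ((η * I * c / (C + 1)) * C) := by
        intro v hv
        have h2 : k v * D a v - Real.exp (-(c * v)) * p.eval (Real.exp (-v)) * D a v
          = Real.exp (-(c * v)) * ((φ (Real.exp (-v)) - p.eval (Real.exp (-v))) * D a v) := by
          simp only [hk]; ring
        rw [h2, Real.norm_eq_abs, abs_mul, abs_mul, abs_of_nonneg (Real.exp_nonneg _)]
        gcongr
        · rw [abs_sub_comm]
          exact (hp _ (hexp v hv)).le
        · exact hD a v hv
      refine (norm_integral_le_of_norm_le
        ((integrableOn_exp_neg_mul hc).mul_const _)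
        ((ae_restrict_iff' measurableSet_Ioi).2 (Eventually.of_forall hb))).trans ?_
      rw [integral_mul_const, integral_exp_neg_mul hc]
      have : c⁻¹ * (η * I * c / (C + 1) * C) = η * I * (C / (C + 1)) := by
        field_simp
      rw [this]
      refine mul_le_of_le_one_right (by positivity) ?_
      rw [div_le_one (by positivity)]
      linarith
    have := abs_le.1 hdiff
    have := abs_lt.1 ha
    rw [abs_le]
    constructor <;> linarith
  have h2 : |(∫ v in Set.Ioi (0 : ℝ), k v * D a v) - I * D a s| ≤ η * I := by
    rw [hI, ← integral_mul_const, ← integral_sub (hDk a) (hkint.mul_const _), ← Real.norm_eq_abs]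
    refine (norm_integral_le_of_norm_le (hkint.mul_const η)
      (Eventually.of_forall fun v => ?_)).trans_eq ?_
    · rw [← mul_sub, Real.norm_eq_abs, abs_mul, abs_of_nonneg (hk0 v)]
      by_cases hv : v ∈ Set.Icc s (s + ε)
      · exact mul_le_mul_of_nonneg_left (hva v hv) (hk0 v)
      · simp [hksupp v hv]
    · rw [integral_mul_const, mul_comm]
  have h3 : |I * D a s| ≤ 3 * (η * I) := by
    have := abs_le.1 h1
    have := abs_le.1 h2
    rw [abs_le]
    constructor <;> linarith
  rw [abs_mul, abs_of_pos hIpos] at h3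
  have h4 : |D a s| ≤ 3 * η := by
    by_contra h
    push Not at h
    nlinarith
  linarith

/-- Functions whose Laplace transforms converge along an arithmetic progression converge at the
points where they are asymptotically equicontinuous from the right. -/
lemma exists_tendsto_of_laplace {ι : Type*} {l : Filter ι} [l.NeBot] {F : ι → ℝ → ℝ} {C c : ℝ}
    (hc : 0 < c) (hF : ∀ a s, 0 < s → |F a s| ≤ C)
    (hm : ∀ a, AEStronglyMeasurable (F a) (volume.restrict (Set.Ioi 0)))
    (hL : ∀ m : ℕ, ∃ x, Tendsto
      (fun a => ∫ s in Set.Ioi (0 : ℝ), Real.exp (-((c + m) * s)) * F a s) l (𝓝 x))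
    {s : ℝ} (hs : 0 < s)
    (heq : ∀ η > 0, ∃ ε > 0, ∀ᶠ a in l, ∀ v ∈ Set.Icc s (s + ε), |F a v - F a s| ≤ η) :
    ∃ x, Tendsto (fun a => F a s) l (𝓝 x) := by
  have key : Tendsto (fun q : ι × ι => (fun v => F q.1 v - F q.2 v) s) (l ×ˢ l) (𝓝 0) := by
    refine tendsto_zero_of_laplace (C := C + C) (D := fun (q : ι × ι) v => F q.1 v - F q.2 v) hc
      (fun q v hv => (abs_sub _ _).trans (add_le_add (hF _ _ hv) (hF _ _ hv)))
      (fun q => (hm _).sub (hm _)) (fun m => ?_) hs ?_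
    · obtain ⟨x, hx⟩ := hL m
      have h := (hx.comp tendsto_fst).sub (hx.comp (tendsto_snd (f := l) (g := l)))
      rw [sub_self] at h
      refine h.congr fun q => ?_
      simp only [Function.comp, mul_sub]
      rw [integral_sub]
      · exact integrableOn_exp_mul_of_bounded (by positivity) (hF _) (hm _)
      · exact integrableOn_exp_mul_of_bounded (by positivity) (hF _) (hm _)
    · intro η hη
      obtain ⟨ε, hε, h⟩ := heq (η / 2) (by positivity)
      refine ⟨ε, hε, ?_⟩
      filter_upwards [h.prod_mk h] with q hq v hv
      have h1 := abs_le.1 (hq.1 v hv)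
      have h2 := abs_le.1 (hq.2 v hv)
      rw [abs_le]
      constructor <;> linarith
  rw [← cauchy_map_iff_exists_tendsto, cauchy_map_iff]
  refine ⟨inferInstance, ?_⟩
  rw [tendsto_uniformity_iff_dist_tendsto_zero]
  simpa [Real.dist_eq] using key.abs

/-- Functions converge at a point if their Laplace transforms converge to the Laplace transform of
the limit, and if equicontinuity from the right holds at this point. -/
lemma tendsto_of_laplace {ι : Type*} {l : Filter ι} {F : ι → ℝ → ℝ} {G : ℝ → ℝ} {C c : ℝ}
    (hc : 0 < c) (hF : ∀ a s, 0 < s → |F a s| ≤ C) (hG : ∀ s, 0 < s → |G s| ≤ C)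
    (hm : ∀ a, AEStronglyMeasurable (F a) (volume.restrict (Set.Ioi 0)))
    (hmG : AEStronglyMeasurable G (volume.restrict (Set.Ioi 0)))
    (hL : ∀ m : ℕ, Tendsto
      (fun a => ∫ s in Set.Ioi (0 : ℝ), Real.exp (-((c + m) * s)) * F a s) l
      (𝓝 (∫ s in Set.Ioi (0 : ℝ), Real.exp (-((c + m) * s)) * G s)))
    {s : ℝ} (hs : 0 < s)
    (heq : ∀ η > 0, ∃ ε > 0, ∀ᶠ a in l, ∀ v ∈ Set.Icc s (s + ε), |F a v - F a s| ≤ η)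
    (hGc : ContinuousWithinAt G (Set.Ici s) s) :
    Tendsto (fun a => F a s) l (𝓝 (G s)) := by
  rw [← tendsto_sub_nhds_zero_iff]
  refine tendsto_zero_of_laplace (C := C + C) (D := fun a v => F a v - G v) hc
      (fun q v hv => (abs_sub _ _).trans (add_le_add (hF _ _ hv) (hG _ hv)))
      (fun q => (hm _).sub hmG) (fun m => ?_) hs ?_
  · have h := (hL m).sub_const (∫ s in Set.Ioi (0 : ℝ), Real.exp (-((c + m) * s)) * G s)
    rw [sub_self] at h
    refine h.congr fun q => ?_
    simp only [mul_sub]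
    rw [integral_sub]
    · exact integrableOn_exp_mul_of_bounded (by positivity) (hF _) (hm _)
    · exact integrableOn_exp_mul_of_bounded (by positivity) hG hmG
  · intro η hη
    obtain ⟨ε, hε, h⟩ := heq (η / 2) (by positivity)
    obtain ⟨ε', hε', h'⟩ := Metric.continuousWithinAt_iff.1 hGc (η / 2) (by positivity)
    refine ⟨min ε (ε' / 2), by positivity, ?_⟩
    filter_upwards [h] with q hq v hv
    have h1 := abs_le.1 (hq v ⟨hv.1, hv.2.trans (by gcongr; exact min_le_left _ _)⟩)
    have h2 := @h' v hv.1 (by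
      rw [Real.dist_eq, abs_of_nonneg (by linarith [hv.1])]
      have := min_le_right ε (ε' / 2)
      linarith [hv.2])
    rw [Real.dist_eq] at h2
    have h2 := abs_lt.1 h2
    rw [abs_le]
    constructor <;> linarith

end TrapModel

/-! ### The semigroup of the walk -/

namespace TrapModel

/-- The Laplace transform of a bounded solution of `y' = g`. -/
lemma mul_laplace_eq_add_laplace_deriv {y g : ℝ → ℝ} {C C' w : ℝ} (hw : 0 < w)
    (hc : ContinuousOn y (Set.Ici 0)) (hd : ∀ s, 0 < s → HasDerivAt y (g s) s)
    (hy : ∀ s, 0 < s → |y s| ≤ C) (hg : ∀ s, 0 < s → |g s| ≤ C')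
    (hm : AEStronglyMeasurable g (volume.restrict (Set.Ioi 0))) :
    w * ∫ s in Set.Ioi (0 : ℝ), Real.exp (-(w * s)) * y s
      = y 0 + ∫ s in Set.Ioi (0 : ℝ), Real.exp (-(w * s)) * g s := by
  have hyint : IntegrableOn (fun s => Real.exp (-(w * s)) * y s) (Set.Ioi 0) :=
    integrableOn_exp_mul_of_bounded hw hy
      ((hc.mono Set.Ioi_subset_Ici_self).aestronglyMeasurable measurableSet_Ioi)
  have hgint : IntegrableOn (fun s => Real.exp (-(w * s)) * g s) (Set.Ioi 0) :=
    integrableOn_exp_mul_of_bounded hw hg hm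
  have hE : Tendsto (fun s : ℝ => Real.exp (-(w * s))) atTop (𝓝 0) :=
    Real.tendsto_exp_neg_atTop_nhds_zero.comp (tendsto_id.const_mul_atTop hw)
  have hlim : Tendsto (fun s => Real.exp (-(w * s)) * y s) atTop (𝓝 0) := by
    refine squeeze_zero_norm' (a := fun s => Real.exp (-(w * s)) * C) ?_ (by simpa using hE.mul_const C)
    filter_upwards [eventually_gt_atTop 0] with s hs
    rw [Real.norm_eq_abs, abs_mul, abs_of_nonneg (Real.exp_nonneg _)]
    exact mul_le_mul_of_nonneg_left (hy s hs) (Real.exp_nonneg _)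
  have hcont : ContinuousWithinAt (fun s => Real.exp (-(w * s)) * y s) (Set.Ici 0) 0 := by
    refine ContinuousWithinAt.mul ?_ (hc 0 Set.self_mem_Ici)
    exact Continuous.continuousWithinAt (by fun_prop)
  have key := integral_Ioi_of_hasDerivAt_of_tendsto (a := 0)
    (f := fun s => Real.exp (-(w * s)) * y s)
    (f' := fun s => Real.exp (-(w * s)) * g s - w * (Real.exp (-(w * s)) * y s))
    hcont (fun s hs => by
      have h1 : HasDerivAt (fun s : ℝ => Real.exp (-(w * s))) (Real.exp (-(w * s)) * -(w * 1)) s :=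
        ((hasDerivAt_id s).const_mul w).neg.exp
      convert! h1.mul (hd s hs) using 1
      ring) (hgint.sub (hyint.const_mul w)) hlim
  rw [integral_sub hgint (hyint.const_mul w), integral_const_mul] at key
  simp at key
  linarith

section Flow

variable {ι : Type*} [Fintype ι]

/-- The average of a function on a finite set. -/
noncomputable def mean (f : ι → ℝ) : ℝ := (∑ i, f i) / Fintype.card ι

/-- The generator of the walk that leaves `i` at rate `x i` for a uniformly chosen site (which may
be `i` itself). -/
noncomputable def gen (x f : ι → ℝ) (i : ι) : ℝ := x i * (mean f - f i)

/-- The scalar product with weights `1 / x i`, for which `gen x` is symmetric. -/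
noncomputable def wip (x f g : ι → ℝ) : ℝ := ∑ i, f i * g i / x i

/-- The Dirichlet form of `gen x` for the scalar product `wip x`, which does not depend on `x`. -/
noncomputable def energy (f : ι → ℝ) : ℝ := ∑ i, (f i - mean f) ^ 2

/-- The Stieltjes transform `∑ 1 / (w + x i)`. -/
noncomputable def stieltjes (x : ι → ℝ) (w : ℝ) : ℝ := ∑ i, (w + x i)⁻¹

/-- The solutions of `y' = gen x y` on `[0, ∞)`. -/
structure IsFlow (x : ι → ℝ) (y : ℝ → ι → ℝ) : Prop where
  continuousOn : ∀ i, ContinuousOn (fun s => y s i) (Set.Ici 0)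
  hasDerivAt : ∀ s, 0 < s → ∀ i, HasDerivAt (fun s => y s i) (gen x (y s) i) s

lemma card_mul_mean (f : ι → ℝ) : (Fintype.card ι : ℝ) * mean f = ∑ i, f i := by
  rcases isEmpty_or_nonempty ι with h | h
  · simp [mean]
  · unfold mean; field_simp

lemma wip_comm (x f g : ι → ℝ) : wip x f g = wip x g f := by
  simp only [wip, mul_comm]

lemma wip_gen_left {x : ι → ℝ} (hx : ∀ i, 0 < x i) (f g : ι → ℝ) :
    wip x (gen x f) g = Fintype.card ι * mean f * mean g - ∑ i, f i * g i := by
  have : ∀ i, gen x f i * g i / x i = mean f * g i - f i * g i := fun i => by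
    have := (hx i).ne'
    unfold gen; field_simp
  simp only [wip, this, Finset.sum_sub_distrib, ← Finset.mul_sum, ← card_mul_mean g]
  ring

lemma wip_gen_comm {x : ι → ℝ} (hx : ∀ i, 0 < x i) (f g : ι → ℝ) :
    wip x (gen x f) g = wip x f (gen x g) := by
  rw [wip_comm x f, wip_gen_left hx, wip_gen_left hx]
  simp only [mul_comm (f _)]
  ring

lemma energy_eq (f : ι → ℝ) :
    energy f = ∑ i, f i * f i - Fintype.card ι * mean f * mean f := by
  have : ∀ i, (f i - mean f) ^ 2 = f i * f i - 2 * mean f * f i + mean f * mean f := fun i => by ring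
  simp only [energy, this, Finset.sum_add_distrib, Finset.sum_sub_distrib, ← Finset.mul_sum,
    ← card_mul_mean f, Finset.sum_const, Finset.card_univ, nsmul_eq_mul]
  ring

lemma wip_gen_self {x : ι → ℝ} (hx : ∀ i, 0 < x i) (f : ι → ℝ) :
    wip x (gen x f) f = - energy f := by
  rw [wip_gen_left hx, energy_eq]; ring

lemma energy_nonneg (f : ι → ℝ) : 0 ≤ energy f := Finset.sum_nonneg fun _ _ => sq_nonneg _

lemma wip_self_nonneg {x : ι → ℝ} (hx : ∀ i, 0 < x i) (f : ι → ℝ) : 0 ≤ wip x f f :=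
  Finset.sum_nonneg fun i _ => div_nonneg (mul_self_nonneg _) (hx i).le

lemma wip_sq_le {x : ι → ℝ} (hx : ∀ i, 0 < x i) (f g : ι → ℝ) :
    wip x f g ^ 2 ≤ wip x f f * wip x g g :=
  Finset.sum_sq_le_sum_mul_sum_of_sq_le_mul _
    (fun i _ => div_nonneg (mul_self_nonneg _) (hx i).le)
    (fun i _ => div_nonneg (mul_self_nonneg _) (hx i).le)
    (fun i _ => le_of_eq (by ring))

lemma wip_rates_left {x : ι → ℝ} (hx : ∀ i, 0 < x i) (f : ι → ℝ) :
    wip x x f = ∑ i, f i :=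
  Finset.sum_congr rfl fun i _ => mul_div_cancel_left₀ _ (hx i).ne'

lemma stieltjes_pos [Nonempty ι] {x : ι → ℝ} (hx : ∀ i, 0 < x i) {w : ℝ} (hw : 0 < w) :
    0 < stieltjes x w :=
  Finset.sum_pos (fun i _ => inv_pos.2 (add_pos hw (hx i))) Finset.univ_nonempty

namespace IsFlow

variable {x : ι → ℝ} {y z : ℝ → ι → ℝ}

lemma mean_hasDerivAt (hy : IsFlow x y) {s : ℝ} (hs : 0 < s) :
    HasDerivAt (fun s => mean (y s)) (mean (gen x (y s))) s := by
  unfold mean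
  exact (HasDerivAt.fun_sum fun i _ => hy.hasDerivAt s hs i).div_const _

lemma mean_continuousOn (hy : IsFlow x y) : ContinuousOn (fun s => mean (y s)) (Set.Ici 0) := by
  unfold mean
  exact (continuousOn_finsetSum _ fun i _ => hy.continuousOn i).div_const _

lemma gen (hy : IsFlow x y) : IsFlow x (fun s => gen x (y s)) where
  continuousOn i := by
    unfold TrapModel.gen
    exact continuousOn_const.mul (hy.mean_continuousOn.sub (hy.continuousOn i))
  hasDerivAt s hs i := ((hy.mean_hasDerivAt hs).sub (hy.hasDerivAt s hs i)).const_mul (x i)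

lemma sub_const (hy : IsFlow x y) [Nonempty ι] (c : ℝ) : IsFlow x (fun s i => y s i - c) where
  continuousOn i := (hy.continuousOn i).sub continuousOn_const
  hasDerivAt s hs i := by
    convert! (hy.hasDerivAt s hs i).sub_const c using 1
    have : mean (fun i => y s i - c) = mean (y s) - c := by
      simp only [mean, Finset.sum_sub_distrib, Finset.sum_const, Finset.card_univ, nsmul_eq_mul]
      field_simp
    simp [TrapModel.gen, this]

lemma wip_hasDerivAt (hy : IsFlow x y) (hz : IsFlow x z) {s : ℝ} (hs : 0 < s) :
    HasDerivAt (fun s => wip x (y s) (z s))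
      (wip x (TrapModel.gen x (y s)) (z s) + wip x (y s) (TrapModel.gen x (z s))) s := by
  unfold wip
  rw [← Finset.sum_add_distrib]
  refine HasDerivAt.fun_sum fun i _ => ?_
  convert! ((hy.hasDerivAt s hs i).mul (hz.hasDerivAt s hs i)).div_const (x i) using 1
  ring

lemma wip_continuousOn (hy : IsFlow x y) (hz : IsFlow x z) :
    ContinuousOn (fun s => wip x (y s) (z s)) (Set.Ici 0) := by
  unfold wip
  exact continuousOn_finsetSum _ fun i _ =>
    ((hy.continuousOn i).mul (hz.continuousOn i)).div_const _

lemma wip_self_hasDerivAt (hx : ∀ i, 0 < x i) (hy : IsFlow x y) {s : ℝ} (hs : 0 < s) :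
    HasDerivAt (fun s => wip x (y s) (y s)) (-2 * energy (y s)) s := by
  convert! hy.wip_hasDerivAt hy hs using 1
  rw [← wip_gen_comm hx, wip_gen_self hx]
  ring

lemma energy_eq_wip (hx : ∀ i, 0 < x i) : (fun s => energy (y s)) =
    fun s => -wip x (TrapModel.gen x (y s)) (y s) := by
  funext s
  rw [wip_gen_self hx, neg_neg]

lemma energy_hasDerivAt (hx : ∀ i, 0 < x i) (hy : IsFlow x y) {s : ℝ} (hs : 0 < s) :
    HasDerivAt (fun s => energy (y s))
      (-2 * wip x (TrapModel.gen x (y s)) (TrapModel.gen x (y s))) s := by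
  rw [energy_eq_wip hx]
  convert! (hy.gen.wip_hasDerivAt hy hs).neg using 1
  rw [wip_gen_comm hx (TrapModel.gen x (y s))]
  ring

lemma energy_continuousOn (hx : ∀ i, 0 < x i) (hy : IsFlow x y) :
    ContinuousOn (fun s => energy (y s)) (Set.Ici 0) := by
  rw [energy_eq_wip hx]
  exact (hy.gen.wip_continuousOn hy).neg

lemma wip_self_antitoneOn (hx : ∀ i, 0 < x i) (hy : IsFlow x y) :
    AntitoneOn (fun s => wip x (y s) (y s)) (Set.Ici 0) := by
  refine antitoneOn_of_deriv_nonpos (convex_Ici 0) (hy.wip_continuousOn hy) ?_ ?_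
  · rw [interior_Ici]
    exact fun s hs => (hy.wip_self_hasDerivAt hx hs).differentiableAt.differentiableWithinAt
  · rw [interior_Ici]
    intro s hs
    rw [(hy.wip_self_hasDerivAt hx hs).deriv]
    linarith [energy_nonneg (y s)]

/-- The smoothing estimate `‖gen x (y s)‖ ≤ ‖y 0‖ / (√2 s)`: the function
`‖y‖² + 2 s E(y) + 2 s² ‖gen x y‖²` is nonincreasing. -/
lemma wip_gen_le (hx : ∀ i, 0 < x i) (hy : IsFlow x y) {s : ℝ} (hs : 0 < s) :
    2 * s ^ 2 * wip x (TrapModel.gen x (y s)) (TrapModel.gen x (y s)) ≤ wip x (y 0) (y 0) := by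
  set φ : ℝ → ℝ := fun s => wip x (y s) (y s) + 2 * s * energy (y s)
    + 2 * s ^ 2 * wip x (TrapModel.gen x (y s)) (TrapModel.gen x (y s)) with hφ
  have hder : ∀ s, 0 < s → HasDerivAt φ
      (-(4 * s ^ 2) * energy (TrapModel.gen x (y s))) s := by
    intro s hs
    have h1 := hy.wip_self_hasDerivAt hx hs
    have h2 := ((hasDerivAt_id s).const_mul 2).mul (hy.energy_hasDerivAt hx hs)
    have h3 := ((hasDerivAt_pow 2 s).const_mul 2).mul (hy.gen.wip_self_hasDerivAt hx hs)
    convert! (h1.add h2).add h3 using 1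
    simp only [id]
    push_cast
    ring
  have hanti : AntitoneOn φ (Set.Ici 0) := by
    refine antitoneOn_of_deriv_nonpos (convex_Ici 0) ?_ ?_ ?_
    · refine ((hy.wip_continuousOn hy).add (ContinuousOn.mul (by fun_prop)
        (hy.energy_continuousOn hx))).add (ContinuousOn.mul (by fun_prop)
        (hy.gen.wip_continuousOn hy.gen))
    · rw [interior_Ici]
      exact fun s hs => (hder s hs).differentiableAt.differentiableWithinAt
    · rw [interior_Ici]
      intro s hs
      rw [(hder s hs).deriv]
      nlinarith [energy_nonneg (TrapModel.gen x (y s)), sq_nonneg s]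
  have h := hanti (Set.self_mem_Ici) (Set.mem_Ici.2 hs.le) hs.le
  simp only [hφ] at h
  have h1 := wip_self_nonneg hx (y s)
  have h2 := mul_nonneg hs.le (energy_nonneg (y s))
  linarith

/-- Self-adjointness of the semigroup generated by `gen x`. -/
lemma wip_duality (hx : ∀ i, 0 < x i) (hy : IsFlow x y) (hz : IsFlow x z) {s r : ℝ}
    (hr : 0 ≤ r) (hrs : r ≤ s) : wip x (z r) (y (s - r)) = wip x (z 0) (y s) := by
  set ψ : ℝ → ℝ := fun r => wip x (z r) (y (s - r)) with hψ
  have hder : ∀ r ∈ Set.Ioo 0 s, HasDerivAt ψ 0 r := by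
    intro r hr
    have h : HasDerivAt ψ (∑ i, (TrapModel.gen x (z r) i * y (s - r) i
        + z r i * -(TrapModel.gen x (y (s - r)) i)) / x i) r := by
      refine HasDerivAt.fun_sum fun i _ => HasDerivAt.div_const (HasDerivAt.mul
        (hz.hasDerivAt r hr.1 i) ?_) _
      exact HasDerivAt.comp_const_sub s r (hy.hasDerivAt (s - r) (by linarith [hr.2]) i)
    convert! h using 1
    have h0 := wip_gen_comm hx (z r) (y (s - r))
    simp only [wip] at h0
    simp only [add_div]
    rw [Finset.sum_add_distrib, h0, ← Finset.sum_add_distrib, eq_comm]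
    exact Finset.sum_eq_zero fun i _ => by ring
  have hcont : ContinuousOn ψ (Set.Icc 0 s) := by
    refine continuousOn_finsetSum _ fun i _ => ContinuousOn.div_const (ContinuousOn.mul
      ((hz.continuousOn i).mono Set.Icc_subset_Ici_self) ?_) _
    refine (hy.continuousOn i).comp (by fun_prop) fun r hr => ?_
    simpa using hr.2
  have hψ0 : wip x (z 0) (y s) = ψ 0 := by simp [hψ]
  rw [hψ0]
  rcases hr.eq_or_lt with rfl | hr
  · rfl
  by_contra hne
  obtain ⟨c, hc, hc'⟩ := exists_hasDerivAt_eq_slope ψ (fun _ => 0) hr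
    (hcont.mono (Set.Icc_subset_Icc_right hrs))
    (fun v hv => hder v ⟨hv.1, hv.2.trans_le hrs⟩)
  rw [eq_comm, div_eq_zero_iff] at hc'
  rcases hc' with h | h
  · exact hne (by linarith)
  · linarith

lemma exists_bound (hx : ∀ i, 0 < x i) (hy : IsFlow x y) :
    ∃ C, ∀ i s, 0 < s → |y s i| ≤ C := by
  refine ⟨∑ i, √(x i * wip x (y 0) (y 0)), fun i s hs => ?_⟩
  refine le_trans ?_ (Finset.single_le_sum (f := fun i => √(x i * wip x (y 0) (y 0)))
    (fun i _ => Real.sqrt_nonneg _) (Finset.mem_univ i))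
  refine Real.abs_le_sqrt ?_
  have h1 := hy.wip_self_antitoneOn hx Set.self_mem_Ici (Set.mem_Ici.2 hs.le) hs.le
  have h2 : y s i * y s i / x i ≤ wip x (y s) (y s) :=
    Finset.single_le_sum (f := fun i => y s i * y s i / x i)
      (fun i _ => div_nonneg (mul_self_nonneg _) (hx i).le) (Finset.mem_univ i)
  have h3 := h2.trans h1
  rw [div_le_iff₀ (hx i)] at h3
  nlinarith

lemma mean_bound {f : ι → ℝ} [Nonempty ι] {C : ℝ} (hf : ∀ i, |f i| ≤ C) : |mean f| ≤ C := by
  unfold mean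
  rw [abs_div, div_le_iff₀ (by simp [Fintype.card_pos])]
  refine (Finset.abs_sum_le_sum_abs _ _).trans ((Finset.sum_le_sum fun i _ => hf i).trans ?_)
  simp [mul_comm]

/-- The Laplace transform of the average of a solution. -/
lemma laplace_mean [Nonempty ι] (hx : ∀ i, 0 < x i) (hy : IsFlow x y) {w : ℝ} (hw : 0 < w) :
    ∫ s in Set.Ioi (0 : ℝ), Real.exp (-(w * s)) * mean (y s)
      = (∑ i, y 0 i / (w + x i)) / (w * stieltjes x w) := by
  obtain ⟨C, hC⟩ := hy.exists_bound hx
  obtain ⟨C', hC'⟩ := hy.gen.exists_bound hx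
  have hint : ∀ i, IntegrableOn (fun s => Real.exp (-(w * s)) * y s i) (Set.Ioi 0) := fun i =>
    integrableOn_exp_mul_of_bounded hw (hC i)
      (((hy.continuousOn i).mono Set.Ioi_subset_Ici_self).aestronglyMeasurable measurableSet_Ioi)
  set Y : ι → ℝ := fun i => ∫ s in Set.Ioi (0 : ℝ), Real.exp (-(w * s)) * y s i with hY
  have hmean : ∫ s in Set.Ioi (0 : ℝ), Real.exp (-(w * s)) * mean (y s) = mean Y := by
    simp only [mean, hY]
    rw [← integral_finsetSum _ fun i _ => hint i, ← integral_div]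
    simp only [Finset.mul_sum, mul_div_assoc, Finset.sum_div]
  have hmint : IntegrableOn (fun s => Real.exp (-(w * s)) * mean (y s)) (Set.Ioi 0) :=
    integrableOn_exp_mul_of_bounded hw (fun s hs => mean_bound fun i => hC i s hs)
      ((hy.mean_continuousOn.mono Set.Ioi_subset_Ici_self).aestronglyMeasurable measurableSet_Ioi)
  have hres : ∀ i, Y i = mean Y * (x i / (w + x i)) + y 0 i / (w + x i) := by
    intro i
    have hpos : 0 < w + x i := add_pos hw (hx i)
    have h := mul_laplace_eq_add_laplace_deriv hw (hy.continuousOn i)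
      (fun s hs => hy.hasDerivAt s hs i) (hC i) (hC' i)
      (((hy.gen.continuousOn i).mono Set.Ioi_subset_Ici_self).aestronglyMeasurable
        measurableSet_Ioi)
    have h2 : ∫ s in Set.Ioi (0 : ℝ), Real.exp (-(w * s)) * TrapModel.gen x (y s) i
        = x i * (mean Y - Y i) := by
      rw [← hmean, ← integral_sub hmint (hint i), ← integral_const_mul]
      refine integral_congr_ae (Eventually.of_forall fun s => ?_)
      simp only [TrapModel.gen]
      ring
    rw [h2] at h
    field_simp
    linarith
  have hsum : (Fintype.card ι : ℝ) * mean Y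
      = mean Y * (Fintype.card ι - w * stieltjes x w) + ∑ i, y 0 i / (w + x i) := by
    have h3 : ∑ i, x i / (w + x i) = Fintype.card ι - w * stieltjes x w := by
      have : ∀ i, x i / (w + x i) = 1 - w * (w + x i)⁻¹ := fun i => by
        have hpos : 0 < w + x i := add_pos hw (hx i)
        field_simp; ring
      simp only [this, Finset.sum_sub_distrib, stieltjes, Finset.mul_sum, Finset.sum_const,
        Finset.card_univ, nsmul_eq_mul, mul_one]
    rw [card_mul_mean, ← h3, Finset.mul_sum, ← Finset.sum_add_distrib]
    exact Finset.sum_congr rfl fun i _ => hres i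
  rw [hmean, eq_div_iff (mul_pos hw (stieltjes_pos hx hw)).ne']
  linarith

end IsFlow

lemma exists_isFlow (x f : ι → ℝ) : ∃ y, IsFlow x y ∧ y 0 = f := by
  let L : (ι → ℝ) →ₗ[ℝ] (ι → ℝ) :=
    { toFun := gen x
      map_add' := fun f g => by
        funext i
        simp only [gen, mean, Pi.add_apply, Finset.sum_add_distrib]
        ring
      map_smul' := fun c f => by
        funext i
        simp only [gen, mean, Pi.smul_apply, smul_eq_mul, ← Finset.mul_sum, RingHom.id_apply]
        ring }
  let A : (ι → ℝ) →L[ℝ] (ι → ℝ) := LinearMap.toContinuousLinearMap L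
  have hA : ∀ f, A f = gen x f := fun f => rfl
  have hder : ∀ s : ℝ, HasDerivAt (fun s : ℝ => NormedSpace.exp (s • A) f)
      (gen x (NormedSpace.exp (s • A) f)) s := by
    intro s
    have h := hasDerivAt_exp_smul_const' (𝕂 := ℝ) A s
    have h2 := h.clm_apply (hasDerivAt_const s f)
    convert! h2 using 1
    simp [hA]
  refine ⟨fun s => NormedSpace.exp (s • A) f, ⟨fun i => ?_, fun s _ i => ?_⟩, ?_⟩
  · exact Continuous.continuousOn
      (continuous_pi_iff.1 (continuous_iff_continuousAt.2 fun s => (hder s).continuousAt) i)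
  · exact hasDerivAt_pi.1 (hder s) i
  · simp

namespace IsFlow

variable {x : ι → ℝ} {y : ℝ → ι → ℝ}

/-- The derivative of the average of a solution is bounded in terms of the Stieltjes transform. By
self-adjointness it is the scalar product of `gen x (y (s / 2))` with the solution `X (s / 2)` that
starts from `x`; the square of the norm of the latter is the average of `X s`, which is
nonincreasing in `s`, hence bounded by its Laplace transform at `1 / s`. -/
lemma mean_gen_sq_le [Nonempty ι] (hx : ∀ i, 0 < x i) (hy : IsFlow x y) {s v : ℝ} (hs : 0 < s)
    (hv : s ≤ v) :
    mean (TrapModel.gen x (y v)) ^ 2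
      ≤ 2 / s ^ 2 * (Real.exp 1 / stieltjes x (1 / s)) * wip x (y 0) (y 0) := by
  obtain ⟨X, hX, hX0⟩ := exists_isFlow x x
  have hNpos : (0 : ℝ) < Fintype.card ι := by simp [Fintype.card_pos]
  have hsum : ∀ r, 0 ≤ r → (Fintype.card ι : ℝ) * mean (X r) = wip x (X (r / 2)) (X (r / 2)) := by
    intro r hr
    have := wip_duality hx hX hX (s := r) (r := r / 2) (by linarith) (by linarith)
    rw [hX0, wip_rates_left hx, show r - r / 2 = r / 2 by ring] at this
    rw [this, card_mul_mean]
  have hnn : ∀ r, 0 ≤ r → 0 ≤ mean (X r) := fun r hr => by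
    have h1 := hsum r hr
    have h2 := wip_self_nonneg hx (X (r / 2))
    by_contra h
    push Not at h
    nlinarith
  have hanti : ∀ r r', 0 ≤ r → r ≤ r' → mean (X r') ≤ mean (X r) := by
    intro r r' hr hrr
    have h1 := hX.wip_self_antitoneOn hx (Set.mem_Ici.2 (by linarith : 0 ≤ r / 2))
      (Set.mem_Ici.2 (by linarith : 0 ≤ r' / 2)) (by linarith)
    simp only at h1
    rw [← hsum r hr, ← hsum r' (hr.trans hrr)] at h1
    exact le_of_mul_le_mul_left h1 hNpos
  -- `mean (X s) ≤ card ι * e / stieltjes x (1 / s)`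
  have hZ := stieltjes_pos hx (w := 1 / s) (by positivity)
  have hu : mean (X s) ≤ Fintype.card ι * (Real.exp 1 / stieltjes x (1 / s)) := by
    have hlap := hX.laplace_mean hx (w := 1 / s) (by positivity)
    obtain ⟨C, hC⟩ := hX.exists_bound hx
    have hint : IntegrableOn (fun r => Real.exp (-(1 / s * r)) * mean (X r)) (Set.Ioi 0) :=
      integrableOn_exp_mul_of_bounded (by positivity)
        (fun r hr => mean_bound fun i => hC i r hr)
        ((hX.mean_continuousOn.mono Set.Ioi_subset_Ici_self).aestronglyMeasurable
          measurableSet_Ioi)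
    have hlow : s * (Real.exp (-1) * mean (X s)) ≤
        ∫ r in Set.Ioi (0 : ℝ), Real.exp (-(1 / s * r)) * mean (X r) := by
      calc s * (Real.exp (-1) * mean (X s))
          = ∫ _ in Set.Ioc 0 s, Real.exp (-1) * mean (X s) := by simp [hs.le]
        _ ≤ ∫ r in Set.Ioc 0 s, Real.exp (-(1 / s * r)) * mean (X r) := by
            refine setIntegral_mono_on (integrable_const _) (hint.mono_set Set.Ioc_subset_Ioi_self)
              measurableSet_Ioc fun r hr => ?_
            refine mul_le_mul ?_ (hanti r s hr.1.le hr.2) (hnn s hs.le) (Real.exp_nonneg _)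
            refine Real.exp_le_exp.2 (neg_le_neg ?_)
            rw [one_div, inv_mul_le_iff₀ hs]
            linarith [hr.2]
        _ ≤ _ := by
            refine setIntegral_mono_set hint ?_
              (Eventually.of_forall Set.Ioc_subset_Ioi_self)
            filter_upwards [ae_restrict_mem measurableSet_Ioi] with r hr
            exact mul_nonneg (Real.exp_nonneg _) (hnn r (le_of_lt hr))
    have hup : ∑ i, X 0 i / (1 / s + x i) ≤ Fintype.card ι := by
      rw [hX0]
      calc ∑ i, x i / (1 / s + x i) ≤ ∑ _i : ι, (1 : ℝ) := by
            refine Finset.sum_le_sum fun i _ => ?_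
            rw [div_le_one (add_pos (by positivity) (hx i))]
            linarith [show 0 < 1 / s by positivity]
        _ = _ := by simp
    rw [hlap] at hlow
    have h2 : s * (Real.exp (-1) * mean (X s))
        ≤ Fintype.card ι / (1 / s * stieltjes x (1 / s)) :=
      hlow.trans (by gcongr)
    rw [Real.exp_neg] at h2
    have h3 : (Fintype.card ι : ℝ) / (1 / s * stieltjes x (1 / s))
      = s * (Fintype.card ι / stieltjes x (1 / s)) := by field_simp
    rw [h3] at h2
    have h4 := le_of_mul_le_mul_left h2 hs
    rw [inv_mul_le_iff₀ (Real.exp_pos 1)] at h4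
    refine h4.trans_eq (by ring)
  have hv0 : 0 < v := hs.trans_le hv
  have h1 : (Fintype.card ι : ℝ) * mean (TrapModel.gen x (y v))
      = wip x (X (v / 2)) (TrapModel.gen x (y (v / 2))) := by
    have := wip_duality hx hy.gen hX (s := v) (r := v / 2) (by linarith) (by linarith)
    rw [hX0, wip_rates_left hx, show v - v / 2 = v / 2 by ring] at this
    rw [this, card_mul_mean]
  have h2 := wip_sq_le hx (X (v / 2)) (TrapModel.gen x (y (v / 2)))
  rw [← h1, ← hsum v hv0.le] at h2
  have h3 := hy.wip_gen_le hx (s := v / 2) (by positivity)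
  set W := wip x (y 0) (y 0)
  set G := wip x (TrapModel.gen x (y (v / 2))) (TrapModel.gen x (y (v / 2)))
  have hG0 : 0 ≤ G := wip_self_nonneg hx _
  have hG : G ≤ 2 / s ^ 2 * W := by
    rw [div_mul_eq_mul_div, le_div_iff₀ (by positivity)]
    have : s ^ 2 ≤ v ^ 2 := by gcongr
    nlinarith
  have hmv := (hanti s v hs.le hv).trans hu
  have h4 : (Fintype.card ι : ℝ) ^ 2 * mean (TrapModel.gen x (y v)) ^ 2 ≤
      Fintype.card ι ^ 2 * (2 / s ^ 2 * (Real.exp 1 / stieltjes x (1 / s)) * W) := by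
    calc (Fintype.card ι : ℝ) ^ 2 * mean (TrapModel.gen x (y v)) ^ 2
        ≤ Fintype.card ι * mean (X v) * G := by rw [← mul_pow]; exact h2
      _ ≤ Fintype.card ι * (Fintype.card ι * (Real.exp 1 / stieltjes x (1 / s)))
          * (2 / s ^ 2 * W) := by gcongr
      _ = _ := by ring
  exact le_of_mul_le_mul_left h4 (by positivity)

/-- The averages of the solutions are Lipschitz continuous on `[s, ∞)`. -/
lemma abs_mean_sub_le [Nonempty ι] (hx : ∀ i, 0 < x i) (hy : IsFlow x y) {s v : ℝ} (hs : 0 < s)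
    (hv : s ≤ v) :
    |mean (y v) - mean (y s)|
      ≤ √(2 / s ^ 2 * (Real.exp 1 / stieltjes x (1 / s)) * wip x (y 0) (y 0)) * (v - s) := by
  have h := Convex.norm_image_sub_le_of_norm_hasDerivWithin_le (f := fun s => mean (y s))
    (f' := fun s => mean (TrapModel.gen x (y s))) (s := Set.Ici s) (x := s) (y := v)
    (C := √(2 / s ^ 2 * (Real.exp 1 / stieltjes x (1 / s)) * wip x (y 0) (y 0)))
    (fun r hr => (hy.mean_hasDerivAt (hs.trans_le hr)).hasDerivWithinAt)
    (fun r hr => by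
      rw [Real.norm_eq_abs]
      exact Real.abs_le_sqrt (hy.mean_gen_sq_le hx hs hr)) (convex_Ici s) Set.self_mem_Ici hv
  rwa [Real.norm_eq_abs, Real.norm_eq_abs, abs_of_nonneg (sub_nonneg.2 hv)] at h

end IsFlow

end Flow

end TrapModel

/-! ### Paths of the walk -/

namespace TrapModel

variable {N : ℕ}

/-- The randomness of the successive steps of the walk. -/
abbrev Steps (N : ℕ) : Type := ℕ → ℝ × (Fin N → Fin N)

/-- The law of the steps of the walk. -/
noncomputable def stepsLaw (N : ℕ) : Measure (Steps N) :=
  Measure.infinitePi fun _ : ℕ => stepLaw N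

instance instIsProbabilityMeasureStepsLaw (N : ℕ) : IsProbabilityMeasure (stepsLaw N) := by
  unfold stepsLaw
  infer_instance

/-- The generic steps: the exponential variables are positive and exceed `1` infinitely often, so that
the jump times tend to infinity, and the jumps lead to a different site. -/
structure IsGeneric (z : Steps N) : Prop where
  pos : ∀ n, 0 < (z n).1
  frequently : ∃ᶠ n in atTop, 1 ≤ (z n).1
  ne : ∀ n i, (z n).2 i ≠ i

/-- The steps `q, z 0, z 1, …`. -/
def consStep (q : ℝ × (Fin N → Fin N)) (z : Steps N) : Steps N
  | 0 => q
  | n + 1 => z n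

/-- The mean waiting time at the site `i`. -/
noncomputable def scale (x : Fin N → ℝ) (i : Fin N) : ℝ := (N : ℝ) / ((N : ℝ) - 1) * (x i)⁻¹

/-- All jumps in the time window `(a, b]` lead to sites in `S`. -/
def window (x : Fin N → ℝ) (S : Set (Fin N)) (a b : ℝ) : Set (Sample N) :=
  {p | ∀ n, a < jumpTime x p (n + 1) → jumpTime x p (n + 1) ≤ b → site p (n + 1) ∈ S}

/-- At time `s`, the walk is at a site in `S`. -/
def occupied (x : Fin N → ℝ) (S : Set (Fin N)) (s : ℝ) : Set (Sample N) :=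
  {p | ∃ n, jumpTime x p n ≤ s ∧ s < jumpTime x p (n + 1) ∧ site p n ∈ S}

section Paths

variable {x : Fin N → ℝ} {p : Sample N}

lemma scale_pos (hN : 2 ≤ N) (hx : ∀ i, 0 < x i) (i : Fin N) : 0 < scale x i := by
  have : (2 : ℝ) ≤ N := by exact_mod_cast hN
  exact mul_pos (div_pos (by linarith) (by linarith)) (inv_pos.2 (hx i))

lemma waitingTime_eq (p : Sample N) (n : ℕ) :
    waitingTime x p n = scale x (site p n) * (p.2 n).1 := rfl

lemma jumpTime_zero : jumpTime x p 0 = 0 := by simp [jumpTime]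

lemma jumpTime_succ (n : ℕ) : jumpTime x p (n + 1) = jumpTime x p n + waitingTime x p n := by
  simp [jumpTime, Finset.sum_range_succ]

lemma site_consStep (i : Fin N) (q : ℝ × (Fin N → Fin N)) (z : Steps N) (n : ℕ) :
    site ((i, consStep q z) : Sample N) (n + 1) = site ((q.2 i, z) : Sample N) n := by
  induction n with
  | zero => rfl
  | succ n ih =>
    rw [site, ih]
    rfl

lemma jumpTime_consStep (i : Fin N) (q : ℝ × (Fin N → Fin N)) (z : Steps N) (n : ℕ) :
    jumpTime x ((i, consStep q z) : Sample N) (n + 1)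
      = scale x i * q.1 + jumpTime x ((q.2 i, z) : Sample N) n := by
  rw [jumpTime, Finset.sum_range_succ', add_comm, jumpTime]
  congr 1
  refine Finset.sum_congr rfl fun k _ => ?_
  rw [waitingTime_eq, waitingTime_eq, site_consStep]
  rfl

lemma waitingTime_pos (hN : 2 ≤ N) (hx : ∀ i, 0 < x i) (hp : IsGeneric p.2) (n : ℕ) :
    0 < waitingTime x p n :=
  mul_pos (scale_pos hN hx _) (hp.pos n)

lemma jumpTime_strictMono (hN : 2 ≤ N) (hx : ∀ i, 0 < x i) (hp : IsGeneric p.2) :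
    StrictMono (jumpTime x p) :=
  strictMono_nat_of_lt_succ fun n => by
    rw [jumpTime_succ]
    linarith [waitingTime_pos hN hx hp n]

lemma jumpTime_nonneg (hN : 2 ≤ N) (hx : ∀ i, 0 < x i) (hp : IsGeneric p.2) (n : ℕ) :
    0 ≤ jumpTime x p n := by
  rw [← jumpTime_zero (x := x) (p := p)]
  exact (jumpTime_strictMono hN hx hp).monotone (Nat.zero_le n)

lemma jumpTime_succ_pos (hN : 2 ≤ N) (hx : ∀ i, 0 < x i) (hp : IsGeneric p.2) (n : ℕ) :
    0 < jumpTime x p (n + 1) := by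
  rw [jumpTime_succ]
  linarith [jumpTime_nonneg hN hx hp n, waitingTime_pos hN hx hp n]

lemma exists_lt_jumpTime (hN : 2 ≤ N) (hx : ∀ i, 0 < x i) (hp : IsGeneric p.2) (s : ℝ) :
    ∃ n, s < jumpTime x p n := by
  have : Nonempty (Fin N) := ⟨p.1⟩
  obtain ⟨i₀, hi₀⟩ := Finite.exists_min (scale x)
  have hc := scale_pos hN hx i₀
  have key : ∀ k : ℕ, ∃ n, k * scale x i₀ ≤ jumpTime x p n := by
    intro k
    induction k with
    | zero => exact ⟨0, by simp [jumpTime_zero]⟩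
    | succ k ih =>
      obtain ⟨n, hn⟩ := ih
      obtain ⟨m, hm, hm1⟩ := Filter.frequently_atTop.1 hp.frequently n
      refine ⟨m + 1, ?_⟩
      rw [jumpTime_succ, waitingTime_eq]
      have h1 := (jumpTime_strictMono hN hx hp).monotone hm
      have h2 : scale x i₀ * 1 ≤ scale x (site p m) * (p.2 m).1 :=
        mul_le_mul (hi₀ _) hm1 zero_le_one (scale_pos hN hx _).le
      push_cast
      linarith
  obtain ⟨k, hk⟩ := exists_nat_gt (s / scale x i₀)
  obtain ⟨n, hn⟩ := key k
  exact ⟨n, ((div_lt_iff₀ hc).1 hk).trans_le hn⟩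

lemma exists_jumpTime_le_lt (hN : 2 ≤ N) (hx : ∀ i, 0 < x i) (hp : IsGeneric p.2) {s : ℝ}
    (hs : 0 ≤ s) : ∃ n, jumpTime x p n ≤ s ∧ s < jumpTime x p (n + 1) := by
  classical
  have h := exists_lt_jumpTime hN hx hp s
  have h0 : Nat.find h ≠ 0 := fun h0 => by
    have := Nat.find_spec h
    rw [h0, jumpTime_zero] at this
    linarith
  obtain ⟨n, hn⟩ := Nat.exists_eq_succ_of_ne_zero h0
  refine ⟨n, not_lt.1 (Nat.find_min h (by omega)), ?_⟩
  have := Nat.find_spec h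
  rwa [hn] at this

lemma exists_jumpTime_lt_le (hN : 2 ≤ N) (hx : ∀ i, 0 < x i) (hp : IsGeneric p.2) {s : ℝ}
    (hs : 0 < s) : ∃ n, jumpTime x p n < s ∧ s ≤ jumpTime x p (n + 1) := by
  obtain ⟨n, h1, h2⟩ := exists_jumpTime_le_lt hN hx hp hs.le
  rcases h1.eq_or_lt with h | h
  · cases n with
    | zero => rw [jumpTime_zero] at h; exact absurd h hs.ne
    | succ n => exact ⟨n, by rw [← h]; exact jumpTime_strictMono hN hx hp (Nat.lt_succ_self n), h.ge⟩
  · exact ⟨n, h, h2.le⟩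

lemma walk_eq_site (hN : 2 ≤ N) (hx : ∀ i, 0 < x i) (hp : IsGeneric p.2) {s : ℝ} {n : ℕ}
    (h1 : jumpTime x p n ≤ s) (h2 : s < jumpTime x p (n + 1)) : walk x p s = site p n := by
  unfold walk
  congr 1
  refine le_antisymm (Nat.sInf_le h2) (le_csInf ⟨n, h2⟩ fun k hk => ?_)
  have : jumpTime x p n < jumpTime x p (k + 1) := h1.trans_lt hk
  exact Nat.lt_succ_iff.1 ((jumpTime_strictMono hN hx hp).lt_iff_lt.1 this)

lemma site_succ_ne (hp : IsGeneric p.2) (n : ℕ) : site p (n + 1) ≠ site p n := hp.ne n _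

lemma leftLim_walk (hN : 2 ≤ N) (hx : ∀ i, 0 < x i) (hp : IsGeneric p.2) {s : ℝ} {n : ℕ}
    (h1 : jumpTime x p n < s) (h2 : s ≤ jumpTime x p (n + 1)) :
    Function.leftLim (fun u => x (walk x p u)) s = x (site p n) := by
  refine leftLim_eq_of_tendsto (tendsto_const_nhds.congr' ?_)
  filter_upwards [Ioo_mem_nhdsLT h1] with u hu
  rw [walk_eq_site hN hx hp hu.1.le (hu.2.trans_le h2)]

/-- As `x` is injective, the times `u` with `x(u) ≠ x(u⁻)` are exactly the jump times. -/
lemma shallow_iff_mem_window (hN : 2 ≤ N) (hx : ∀ i, 0 < x i) (hinj : Function.Injective x)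
    (hp : IsGeneric p.2) {δ t tw : ℝ} (htw : 0 ≤ tw) :
    (∀ u ∈ Set.Ioc tw (tw + t),
      x (walk x p u) ≠ Function.leftLim (fun s => x (walk x p s)) u → δ ≤ x (walk x p u))
      ↔ p ∈ window x {i | δ ≤ x i} tw (tw + t) := by
  have hmono := jumpTime_strictMono hN hx hp
  constructor
  · intro h n h1 h2
    have hw := walk_eq_site hN hx hp (n := n + 1) le_rfl (hmono (Nat.lt_succ_self _))
    have hl := leftLim_walk hN hx hp (n := n) (hmono (Nat.lt_succ_self _)) le_rfl
    have := h _ ⟨h1, h2⟩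
    rw [hw, hl] at this
    exact this (hinj.ne (site_succ_ne hp n))
  · intro h u hu hne
    obtain ⟨n, h1, h2⟩ := exists_jumpTime_lt_le hN hx hp (htw.trans_lt hu.1)
    rw [leftLim_walk hN hx hp h1 h2] at hne
    rcases h2.eq_or_lt with h3 | h3
    · subst h3
      rw [walk_eq_site hN hx hp (n := n + 1) le_rfl (hmono (Nat.lt_succ_self _))]
      exact h n hu.1 hu.2
    · rw [walk_eq_site hN hx hp h1.le h3] at hne
      exact absurd rfl hne

lemma stay_iff_mem_window (hN : 2 ≤ N) (hx : ∀ i, 0 < x i) (hp : IsGeneric p.2) {t tw : ℝ}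
    (htw : 0 ≤ tw) :
    (∀ s ∈ Set.Icc tw (tw + t), walk x p s = walk x p tw) ↔ p ∈ window x ∅ tw (tw + t) := by
  have hmono := jumpTime_strictMono hN hx hp
  obtain ⟨n, h1, h2⟩ := exists_jumpTime_le_lt hN hx hp htw
  constructor
  · intro h m h3 h4
    have h5 : jumpTime x p (n + 1) ≤ jumpTime x p (m + 1) :=
      hmono.monotone (hmono.lt_iff_lt.1 (h1.trans_lt h3))
    have h6 := h (jumpTime x p (n + 1)) ⟨h2.le, h5.trans h4⟩
    rw [walk_eq_site hN hx hp h1 h2,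
      walk_eq_site hN hx hp (n := n + 1) le_rfl (hmono (Nat.lt_succ_self _))] at h6
    exact (site_succ_ne hp n h6).elim
  · intro h s hs
    rw [walk_eq_site hN hx hp h1 h2]
    refine walk_eq_site hN hx hp (h1.trans hs.1) ?_
    by_contra hlt
    exact h n h2 ((not_lt.1 hlt).trans hs.2)

lemma mem_occupied_of_mem_window (hN : 2 ≤ N) (hx : ∀ i, 0 < x i) (hp : IsGeneric p.2)
    {S : Set (Fin N)} {t tw : ℝ} (htw : 0 ≤ tw) (ht : 0 ≤ t) (h : p ∈ window x S tw (tw + t))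
    (h' : p ∉ window x ∅ tw (tw + t)) : p ∈ occupied x S (tw + t) := by
  have hmono := jumpTime_strictMono hN hx hp
  obtain ⟨n, h1, h2⟩ := exists_jumpTime_le_lt hN hx hp (add_nonneg htw ht)
  refine ⟨n, h1, h2, ?_⟩
  simp only [window, Set.mem_ofPred_eq, Set.mem_empty_iff_false] at h'
  push Not at h'
  obtain ⟨m, h3, h4, -⟩ := h'
  have h5 : m + 1 < n + 1 := hmono.lt_iff_lt.1 (h4.trans_lt h2)
  obtain ⟨k, rfl⟩ : ∃ k, n = k + 1 := ⟨n - 1, by omega⟩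
  exact h k (h3.trans_le (hmono.monotone (by omega))) h1

lemma window_empty_subset (S : Set (Fin N)) (a b : ℝ) : window x ∅ a b ⊆ window x S a b :=
  fun _ hp n h1 h2 => (hp n h1 h2).elim

lemma mem_window_consStep {S : Set (Fin N)} {a b : ℝ}
    {i : Fin N} {q : ℝ × (Fin N → Fin N)} {z : Steps N} :
    ((i, consStep q z) : Sample N) ∈ window x S a b ↔
      ((a < scale x i * q.1 → scale x i * q.1 ≤ b → q.2 i ∈ S) ∧
        ((q.2 i, z) : Sample N) ∈ window x S (a - scale x i * q.1) (b - scale x i * q.1)) := by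
  simp only [window, Set.mem_ofPred_eq, jumpTime_consStep, site_consStep]
  constructor
  · intro h
    refine ⟨fun h1 h2 => ?_, fun n h1 h2 => h (n + 1) (by linarith) (by linarith)⟩
    have := h 0
    rw [jumpTime_zero, add_zero] at this
    exact this h1 h2
  · rintro ⟨h1, h2⟩ n h3 h4
    cases n with
    | zero =>
      rw [jumpTime_zero, add_zero] at h3 h4
      exact h1 h3 h4
    | succ n => exact h2 n (by linarith) (by linarith)

/-- As there are no jumps at nonpositive times, the left end of a window can be moved to `0`. -/
lemma mem_window_iff_of_nonpos (hN : 2 ≤ N) (hx : ∀ i, 0 < x i) (hp : IsGeneric p.2)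
    {S : Set (Fin N)} {a b : ℝ} (ha : a ≤ 0) : p ∈ window x S a b ↔ p ∈ window x S 0 b := by
  refine forall_congr' fun n => ?_
  have := jumpTime_succ_pos hN hx hp n
  simp [this, ha.trans_lt this]

lemma mem_window_of_nonpos (hN : 2 ≤ N) (hx : ∀ i, 0 < x i) (hp : IsGeneric p.2)
    {S : Set (Fin N)} {a b : ℝ} (hb : b ≤ 0) : p ∈ window x S a b := fun n _ h => by
  have := jumpTime_succ_pos hN hx hp n
  linarith

lemma mem_occupied_consStep (hN : 2 ≤ N) (hx : ∀ i, 0 < x i) {S : Set (Fin N)} {s : ℝ}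
    (hs : 0 ≤ s) {i : Fin N} {q : ℝ × (Fin N → Fin N)} {z : Steps N} (hz : IsGeneric z) :
    ((i, consStep q z) : Sample N) ∈ occupied x S s ↔
      if scale x i * q.1 ≤ s then ((q.2 i, z) : Sample N) ∈ occupied x S (s - scale x i * q.1)
      else i ∈ S := by
  simp only [occupied, Set.mem_ofPred_eq]
  have h1 : jumpTime x ((i, consStep q z) : Sample N) 1 = scale x i * q.1 := by
    have := jumpTime_consStep (x := x) i q z 0
    rwa [jumpTime_zero, add_zero] at this
  have hnn : ∀ n, 0 ≤ jumpTime x ((q.2 i, z) : Sample N) n := fun n =>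
    jumpTime_nonneg hN hx (p := ((q.2 i, z) : Sample N)) hz n
  split_ifs with h
  · constructor
    · rintro ⟨n, h2, h3, h4⟩
      cases n with
      | zero => rw [zero_add, h1] at h3; linarith
      | succ n =>
        rw [jumpTime_consStep] at h2 h3
        rw [site_consStep] at h4
        exact ⟨n, by linarith, by linarith, h4⟩
    · rintro ⟨n, h2, h3, h4⟩
      refine ⟨n + 1, ?_, ?_, ?_⟩
      · rw [jumpTime_consStep]; linarith
      · rw [jumpTime_consStep]; linarith
      · rwa [site_consStep]
  · constructor
    · rintro ⟨n, h2, h3, h4⟩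
      cases n with
      | zero => exact h4
      | succ n =>
        rw [jumpTime_consStep] at h2
        exact absurd (by linarith [hnn n]) h
    · intro h2
      exact ⟨0, by rwa [jumpTime_zero], by rw [zero_add, h1]; exact not_le.1 h, h2⟩

end Paths

section Measurability

variable (x : Fin N → ℝ)

lemma measurable_site (n : ℕ) : Measurable fun p : Sample N => site p n := by
  induction n with
  | zero => exact measurable_fst
  | succ n ih =>
    have h : Measurable fun q : (Fin N → Fin N) × Fin N => q.1 q.2 :=
      measurable_from_prod_countable_left fun i => measurable_pi_apply i
    have h2 : Measurable fun p : Sample N => ((p.2 n).2, site p n) :=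
      ((measurable_snd.comp ((measurable_pi_apply n).comp measurable_snd))).prodMk ih
    exact h.comp h2

lemma measurable_jumpTime (n : ℕ) : Measurable fun p : Sample N => jumpTime x p n := by
  refine Finset.measurable_fun_sum _ fun k _ => ?_
  have h1 : Measurable fun p : Sample N => scale x (site p k) :=
    (measurable_of_finite (scale x)).comp (measurable_site k)
  exact h1.mul (measurable_fst.comp ((measurable_pi_apply k).comp measurable_snd))

lemma measurableSet_window (S : Set (Fin N)) {α : Type*} [MeasurableSpace α] {a b : α → ℝ}
    {p : α → Sample N} (ha : Measurable a) (hb : Measurable b) (hp : Measurable p) :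
    MeasurableSet {r | p r ∈ window x S (a r) (b r)} := by
  simp only [window, Set.mem_ofPred_eq]
  refine measurableSet_setOfPred.2 (Measurable.forall fun n => measurableSet_setOfPred.1 ?_)
  have hJ := (measurable_jumpTime x (n + 1)).comp hp
  exact (measurableSet_lt ha hJ).imp ((measurableSet_le hJ hb).imp
    (((measurable_site (n + 1)).comp hp) (Set.toFinite S).measurableSet))

lemma measurableSet_occupied (S : Set (Fin N)) {α : Type*} [MeasurableSpace α] {a : α → ℝ}
    {p : α → Sample N} (ha : Measurable a) (hp : Measurable p) :
    MeasurableSet {r | p r ∈ occupied x S (a r)} := by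
  simp only [occupied, Set.mem_ofPred_eq]
  refine measurableSet_setOfPred.2 (Measurable.exists fun n => measurableSet_setOfPred.1 ?_)
  have hJ := (measurable_jumpTime x (n + 1)).comp hp
  have hJ' := (measurable_jumpTime x n).comp hp
  exact (measurableSet_le hJ' ha).inter ((measurableSet_lt ha hJ).inter
    (((measurable_site n).comp hp) (Set.toFinite S).measurableSet))

end Measurability

end TrapModel

/-! ### The law of the steps -/

namespace TrapModel

variable {N : ℕ}

section StepLaw

lemma expMeasure_one_eq : expMeasure 1 =
    (volume.restrict (Set.Ioi 0)).withDensity fun v : ℝ => ENNReal.ofReal (Real.exp (-v)) := by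
  rw [← withDensity_indicator measurableSet_Ioi]
  refine withDensity_congr_ae ?_
  filter_upwards [compl_mem_ae_iff.2 (measure_singleton (0 : ℝ))] with v hv
  rcases lt_trichotomy v 0 with h | h | h
  · rw [Set.indicator_of_notMem (by simpa using h.le)]
    exact exponentialPDF_of_neg h
  · exact absurd h hv
  · rw [Set.indicator_of_mem (by simpa using h)]
    exact (exponentialPDF_of_nonneg (r := 1) h.le).trans (by simp)

lemma ae_expMeasure_one_pos : ∀ᵐ v ∂(expMeasure 1), 0 < v := by
  rw [expMeasure_one_eq]
  exact (withDensity_absolutelyContinuous _ _).ae_le (ae_restrict_mem measurableSet_Ioi)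

lemma expMeasure_one_Ici_ne_zero : expMeasure 1 (Set.Ici 1) ≠ 0 := by
  rw [expMeasure_one_eq, withDensity_apply _ measurableSet_Ici,
    Measure.restrict_restrict measurableSet_Ici,
    Set.inter_eq_left.2 (Set.Ici_subset_Ioi.2 one_pos)]
  intro h
  rw [lintegral_eq_zero_iff (by fun_prop)] at h
  have h2 : (volume.restrict (Set.Ici (1 : ℝ))) Set.univ = 0 := by
    refine measure_mono_null (fun v _ => ?_) h
    simp [Real.exp_pos]
  simp at h2

lemma measurable_consStep :
    Measurable fun r : (ℝ × (Fin N → Fin N)) × Steps N => consStep r.1 r.2 := by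
  refine measurable_pi_iff.2 fun n => ?_
  cases n with
  | zero => exact measurable_fst
  | succ n => exact (measurable_pi_apply n).comp measurable_snd

/-- The sequence of steps is invariant in law under insertion of an independent first step. -/
lemma map_consStep :
    ((stepLaw N).prod (stepsLaw N)).map (fun r => consStep r.1 r.2) = stepsLaw N := by
  classical
  refine Measure.eq_infinitePi _ fun s t ht => ?_
  obtain ⟨m, hm⟩ : ∃ m, s ⊆ Finset.range (m + 1) :=
    ⟨s.sup id, fun n hn => Finset.mem_range.2 (Nat.lt_succ_of_le (Finset.le_sup (f := id) hn))⟩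
  set t' : ℕ → Set (ℝ × (Fin N → Fin N)) := fun n => if n ∈ s then t n else Set.univ with ht'
  have ht'm : ∀ n, MeasurableSet (t' n) := fun n => by
    simp only [ht']
    split_ifs
    exacts [ht n, .univ]
  rw [Measure.map_apply measurable_consStep (MeasurableSet.pi s.countable_toSet fun i _ => ht i)]
  have hpre : (fun r : (ℝ × (Fin N → Fin N)) × Steps N => consStep r.1 r.2) ⁻¹' Set.pi s t
      = t' 0 ×ˢ Set.pi (Finset.range m) fun n => t' (n + 1) := by
    ext r
    simp only [Set.mem_preimage, Set.mem_pi, Set.mem_prod, Finset.mem_coe, ht']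
    constructor
    · intro h
      refine ⟨?_, fun n _ => ?_⟩
      · split_ifs with h0
        exacts [h 0 h0, trivial]
      · split_ifs with h0
        exacts [h (n + 1) h0, trivial]
    · rintro ⟨h1, h2⟩ n hn
      cases n with
      | zero => simpa [hn, consStep] using h1
      | succ n =>
        have := h2 n (by simpa using hm hn)
        simpa [hn, consStep] using this
  rw [hpre, Measure.prod_prod]
  have h1 : stepsLaw N (Set.pi (Finset.range m) fun n => t' (n + 1))
      = ∏ n ∈ Finset.range m, stepLaw N (t' (n + 1)) :=
    Measure.infinitePi_pi _ fun n _ => ht'm _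
  rw [h1, mul_comm, ← Finset.prod_range_succ' (fun n => stepLaw N (t' n)),
    ← Finset.prod_subset hm (f := fun n => stepLaw N (t' n))]
  · exact Finset.prod_congr rfl fun n hn => by simp [ht', hn]
  · intro n _ hn
    simp [ht', hn]

lemma jumpLaw_self (hN : 2 ≤ N) (i : Fin N) : jumpLaw N i {i} = 0 := by
  classical
  rw [jumpLaw, if_pos hN, uniformOn_eq_zero_iff (Set.toFinite _)]
  ext j
  simp

/-- The probability that the walk jumps from `i` to `j`. -/
noncomputable def jumpProb (N : ℕ) (i j : Fin N) : ℝ := (jumpLaw N i).real {j}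

lemma jumpProb_eq (hN : 2 ≤ N) (i j : Fin N) :
    jumpProb N i j = if j = i then 0 else ((N : ℝ) - 1)⁻¹ := by
  classical
  unfold jumpProb
  split_ifs with h
  · subst h
    rw [measureReal_def, jumpLaw_self hN]; rfl
  · rw [measureReal_def, jumpLaw, if_pos hN]
    have h1 : {j : Fin N | j ≠ i} = ((Finset.univ.erase i : Finset (Fin N)) : Set (Fin N)) := by
      ext; simp
    have h2 : ({j} : Set (Fin N)) = (({j} : Finset (Fin N)) : Set (Fin N)) := by simp
    rw [h1, h2, uniformOn_apply_finset, Finset.inter_singleton_of_mem (by simp [h]),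
      Finset.card_erase_of_mem (Finset.mem_univ i), Finset.card_univ, Fintype.card_fin,
      ENNReal.toReal_div, ENNReal.toReal_natCast, ENNReal.toReal_natCast,
      Nat.cast_sub (by omega : 1 ≤ N)]
    simp

lemma jumpProb_nonneg (i j : Fin N) : 0 ≤ jumpProb N i j := measureReal_nonneg

lemma sum_jumpProb (i : Fin N) : ∑ j, jumpProb N i j = 1 := by
  unfold jumpProb
  rw [sum_measureReal_singleton]
  simp

lemma ae_isGeneric (hN : 2 ≤ N) : ∀ᵐ z ∂(stepsLaw N), IsGeneric z := by
  have heval : ∀ n, MeasurePreserving (Function.eval n) (stepsLaw N) (stepLaw N) :=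
    fun n => measurePreserving_eval_infinitePi (fun _ : ℕ => stepLaw N) n
  have h1 : ∀ᵐ z ∂(stepsLaw N), ∀ n, 0 < (z n).1 := by
    refine ae_all_iff.2 fun n => ?_
    refine (heval n).quasiMeasurePreserving.ae (p := fun q => 0 < q.1) ?_
    exact Measure.quasiMeasurePreserving_fst.ae ae_expMeasure_one_pos
  have h2 : ∀ᵐ z ∂(stepsLaw N), ∀ n i, (z n).2 i ≠ i := by
    refine ae_all_iff.2 fun n => ae_all_iff.2 fun i => ?_
    refine (heval n).quasiMeasurePreserving.ae (p := fun q => q.2 i ≠ i) ?_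
    refine Measure.quasiMeasurePreserving_snd.ae (p := fun σ : Fin N → Fin N => σ i ≠ i) ?_
    refine (measurePreserving_eval (jumpLaw N) i).quasiMeasurePreserving.ae (p := fun j => j ≠ i) ?_
    exact compl_mem_ae_iff.2 (jumpLaw_self hN i)
  have h3 : ∀ᵐ z ∂(stepsLaw N), ∃ᶠ n in atTop, 1 ≤ (z n).1 := by
    set A : ℕ → Set (Steps N) := fun n => {z | (z n).1 ∈ Set.Ici (1 : ℝ)} with hA
    have hfm : ∀ n, Measurable fun z : Steps N => (z n).1 := fun n =>
      measurable_fst.comp (measurable_pi_apply n)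
    have hAm : ∀ n, MeasurableSet (A n) := fun n => hfm n measurableSet_Ici
    have hind : iIndepFun (fun n (z : Steps N) => (z n).1) (stepsLaw N) :=
      iIndepFun_infinitePi (P := fun _ : ℕ => stepLaw N) (X := fun _ q => q.1)
        fun _ => measurable_fst
    have hindep : iIndepSet A (stepsLaw N) :=
      (iIndepSet_iff_meas_biInter hAm).2 fun s =>
        hind.measure_inter_preimage_eq_mul s fun n _ => measurableSet_Ici
    have hmeas : ∀ n, stepsLaw N (A n) = expMeasure 1 (Set.Ici 1) := by
      intro n
      have e1 : stepsLaw N (A n) = stepLaw N (Prod.fst ⁻¹' Set.Ici 1) :=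
        (heval n).measure_preimage (measurable_fst measurableSet_Ici).nullMeasurableSet
      rw [e1, stepLaw]
      exact measurePreserving_fst.measure_preimage measurableSet_Ici.nullMeasurableSet
    have hlim := measure_limsup_eq_one hAm hindep (by
      simp_rw [hmeas]
      exact ENNReal.tsum_const_eq_top_of_ne_zero expMeasure_one_Ici_ne_zero)
    have : ∀ᵐ z ∂(stepsLaw N), z ∈ limsup A atTop :=
      (prob_compl_eq_zero_iff (MeasurableSet.measurableSet_limsup hAm)).2 hlim
    filter_upwards [this] with z hz
    rw [mem_limsup_iff_frequently_mem] at hz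
    exact hz
  filter_upwards [h1, h2, h3] with z h1 h2 h3
  exact ⟨h1, h3, h2⟩

/-- The probability of an event for the walk that starts at `i`. -/
noncomputable def startProb (B : Set (Sample N)) (i : Fin N) : ℝ :=
  (stepsLaw N).real {z | ((i, z) : Sample N) ∈ B}

lemma startProb_nonneg (B : Set (Sample N)) (i : Fin N) : 0 ≤ startProb B i := measureReal_nonneg

lemma startProb_le_one (B : Set (Sample N)) (i : Fin N) : startProb B i ≤ 1 := measureReal_le_one

lemma abs_startProb_le_one (B : Set (Sample N)) (i : Fin N) : |startProb B i| ≤ 1 := by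
  rw [abs_of_nonneg (startProb_nonneg B i)]
  exact startProb_le_one B i

lemma startProb_congr (hN : 2 ≤ N) {B B' : Set (Sample N)} {i : Fin N}
    (h : ∀ z, IsGeneric z → (((i, z) : Sample N) ∈ B ↔ ((i, z) : Sample N) ∈ B')) :
    startProb B i = startProb B' i := by
  refine measureReal_congr ?_
  filter_upwards [ae_isGeneric hN] with z hz
  exact propext (h z hz)

lemma measurable_startProb {B : ℝ → Set (Sample N)}
    (hB : MeasurableSet {r : ℝ × Sample N | r.2 ∈ B r.1}) (i : Fin N) :
    Measurable fun s => startProb (B s) i := by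
  have : MeasurableSet {r : ℝ × Steps N | ((i, r.2) : Sample N) ∈ B r.1} :=
    hB.preimage (measurable_fst.prodMk (measurable_const.prodMk measurable_snd))
  exact (measurable_measure_prodMk_left (ν := stepsLaw N) this).ennreal_toReal

lemma walkLaw_real_eq_mean [NeZero N] {B : Set (Sample N)} (hB : MeasurableSet B) :
    (walkLaw N).real B = mean (startProb B) := by
  have h1 : walkLaw N B = ∑ i, (Fintype.card (Fin N) : ENNReal)⁻¹
      * stepsLaw N {z | ((i, z) : Sample N) ∈ B} := by
    have : IsProbabilityMeasure (uniformOn (Set.univ : Set (Fin N))) :=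
      isProbabilityMeasure_uniformOn (Set.toFinite _) Set.univ_nonempty
    have h0 : walkLaw N B = ∫⁻ i, stepsLaw N {z | ((i, z) : Sample N) ∈ B} ∂(uniformOn Set.univ) :=
      Measure.prod_apply hB
    rw [h0, lintegral_fintype]
    refine Finset.sum_congr rfl fun i _ => ?_
    rw [uniformOn_univ, Measure.count_singleton, mul_comm, one_div]
  rw [measureReal_def, h1, ENNReal.toReal_sum fun i _ =>
    ENNReal.mul_ne_top (by simp [NeZero.ne]) (measure_ne_top _ _)]
  simp only [ENNReal.toReal_mul, ← Finset.mul_sum, mean]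
  rw [ENNReal.toReal_inv, ENNReal.toReal_natCast, div_eq_inv_mul]
  rfl

lemma walkLaw_real_congr (hN : 2 ≤ N) {B B' : Set (Sample N)}
    (h : ∀ p : Sample N, IsGeneric p.2 → (p ∈ B ↔ p ∈ B')) :
    (walkLaw N).real B = (walkLaw N).real B' := by
  have : NeZero N := ⟨by omega⟩
  have : IsProbabilityMeasure (uniformOn (Set.univ : Set (Fin N))) :=
    isProbabilityMeasure_uniformOn (Set.toFinite _) Set.univ_nonempty
  refine measureReal_congr ?_
  have h1 : ∀ᵐ p ∂(walkLaw N), IsGeneric p.2 :=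
    Measure.quasiMeasurePreserving_snd.ae (p := fun z => IsGeneric z) (ae_isGeneric hN)
  filter_upwards [h1] with p hp
  exact propext (h p hp)

/-- First-step decomposition of the probability of an event. -/
lemma startProb_eq_integral (hN : 2 ≤ N) {B : Set (Sample N)} (hBm : MeasurableSet B) (i : Fin N)
    (b : ℝ → Fin N → Set (Sample N))
    (hb : ∀ j, MeasurableSet {r : ℝ × Sample N | r.2 ∈ b r.1 j})
    (hB : ∀ v, 0 < v → ∀ σ z, IsGeneric z →
      (((i, consStep (v, σ) z) : Sample N) ∈ B ↔ ((σ i, z) : Sample N) ∈ b v (σ i))) :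
    startProb B i = ∫ v in Set.Ioi (0 : ℝ), Real.exp (-v) *
      ∑ j, jumpProb N i j * startProb (b v j) j := by
  have hBi : MeasurableSet {z : Steps N | ((i, z) : Sample N) ∈ B} := measurable_prodMk_left hBm
  have h1 : stepsLaw N {z | ((i, z) : Sample N) ∈ B}
      = ∫⁻ v in Set.Ioi (0 : ℝ), ENNReal.ofReal (Real.exp (-v)) *
        ∑ j, jumpLaw N i {j} * stepsLaw N {z | ((j, z) : Sample N) ∈ b v j} := by
    have hpre := measurable_consStep (N := N) hBi
    have hbm : ∀ j, Measurable fun v => stepsLaw N {z | ((j, z) : Sample N) ∈ b v j} := by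
      intro j
      have : MeasurableSet {r : ℝ × Steps N | ((j, r.2) : Sample N) ∈ b r.1 j} :=
        (hb j).preimage (measurable_fst.prodMk (measurable_const.prodMk measurable_snd))
      exact measurable_measure_prodMk_left (ν := stepsLaw N) this
    conv_lhs => rw [← map_consStep]
    rw [Measure.map_apply measurable_consStep hBi, Measure.prod_apply hpre, stepLaw,
      lintegral_prod _ (measurable_measure_prodMk_left hpre).aemeasurable, expMeasure_one_eq,
      lintegral_withDensity_eq_lintegral_mul_non_measurable _ (by fun_prop)
        (Eventually.of_forall fun _ => ENNReal.ofReal_lt_top)]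
    refine lintegral_congr_ae ?_
    filter_upwards [ae_restrict_mem measurableSet_Ioi] with v hv
    simp only [Pi.mul_apply]
    congr 1
    have h2 : ∀ σ : Fin N → Fin N, stepsLaw N (Prod.mk (v, σ) ⁻¹'
        ((fun r : (ℝ × (Fin N → Fin N)) × Steps N => consStep r.1 r.2) ⁻¹'
          {z | ((i, z) : Sample N) ∈ B}))
        = (fun j => stepsLaw N {z | ((j, z) : Sample N) ∈ b v j}) (Function.eval i σ) := by
      intro σ
      refine measure_congr ?_
      filter_upwards [ae_isGeneric hN] with z hz
      exact propext (hB v hv σ z hz)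
    simp_rw [h2]
    refine ((measurePreserving_eval (jumpLaw N) i).lintegral_comp
      (f := fun j => stepsLaw N {z | ((j, z) : Sample N) ∈ b v j})
      (measurable_of_finite _)).trans ?_
    rw [lintegral_fintype]
    exact Finset.sum_congr rfl fun j _ => mul_comm _ _
  have hm : ∀ j, Measurable fun v => startProb (b v j) j := fun j => measurable_startProb (hb j) j
  rw [startProb, measureReal_def, h1, integral_eq_lintegral_of_nonneg_ae]
  · congr 1
    refine lintegral_congr fun v => ?_
    rw [ENNReal.ofReal_mul (Real.exp_nonneg _), ENNReal.ofReal_sum_of_nonneg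
      fun j _ => mul_nonneg (jumpProb_nonneg i j) (startProb_nonneg _ _)]
    congr 1
    refine Finset.sum_congr rfl fun j _ => ?_
    rw [ENNReal.ofReal_mul (jumpProb_nonneg i j), jumpProb, startProb,
      ofReal_measureReal, ofReal_measureReal]
  · exact Eventually.of_forall fun v => mul_nonneg (Real.exp_nonneg _)
      (Finset.sum_nonneg fun j _ => mul_nonneg (jumpProb_nonneg i j) (startProb_nonneg _ _))
  · refine Measurable.aestronglyMeasurable ?_
    exact Measurable.mul (by fun_prop) (Finset.measurable_fun_sum _ fun j _ => (hm j).const_mul _)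

end StepLaw

end TrapModel

/-! ### Renewal equations -/

namespace TrapModel

/-- A function that satisfies the renewal equation of an exponential waiting time of rate `k`
solves a differential equation. -/
lemma renewal_eq {y G : ℝ → ℝ} {k f C : ℝ} (hk : 0 < k) (hGm : Measurable G)
    (hGb : ∀ s, |G s| ≤ C)
    (hy : ∀ s, 0 ≤ s → y s =
      (∫ v in Set.Ioc 0 (k * s), Real.exp (-v) * G (s - k⁻¹ * v)) + Real.exp (-(k * s)) * f) :
    y 0 = f ∧ ContinuousOn y (Set.Ici 0) ∧ (ContinuousOn G (Set.Ici 0) →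
      ∀ s, 0 < s → HasDerivAt y (k * (G s - y s)) s) := by
  set g : ℝ → ℝ := fun u => Real.exp (k * u) * G u with hg
  have hint : ∀ a b, IntervalIntegrable g volume a b := by
    intro a b
    rw [intervalIntegrable_iff]
    refine Integrable.mul_bdd (c := C) ?_ ?_ ?_
    · exact (Continuous.intervalIntegrable (by fun_prop) a b).def'
    · exact hGm.aestronglyMeasurable
    · exact Eventually.of_forall fun s => by simpa using hGb s
  have hform : ∀ s, 0 ≤ s → y s = Real.exp (-(k * s)) * (f + k * ∫ u in (0)..s, g u) := by
    intro s hs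
    have h1 := intervalIntegral.integral_comp_sub_mul (a := 0) (b := s)
      (fun v => Real.exp (-v) * G (s - k⁻¹ * v)) hk.ne' (k * s)
    rw [sub_self, mul_zero, sub_zero, intervalIntegral.integral_of_le (a := 0) (b := k * s)
      (by positivity), smul_eq_mul] at h1
    have h2 : ∫ u in (0)..s, Real.exp (-(k * s - k * u)) * G (s - k⁻¹ * (k * s - k * u))
        = Real.exp (-(k * s)) * ∫ u in (0)..s, g u := by
      rw [← intervalIntegral.integral_const_mul]
      congr 1
      funext u
      have e1 : s - k⁻¹ * (k * s - k * u) = u := by field_simp; ring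
      have e2 : Real.exp (-(k * s - k * u)) = Real.exp (-(k * s)) * Real.exp (k * u) := by
        rw [← Real.exp_add]; ring_nf
      rw [e1, e2, hg]; ring
    rw [h2] at h1
    have h3 : ∫ v in Set.Ioc 0 (k * s), Real.exp (-v) * G (s - k⁻¹ * v)
        = k * (Real.exp (-(k * s)) * ∫ u in (0)..s, g u) := by
      rw [h1]; field_simp
    rw [hy s hs, h3]; ring
  have hprim : Continuous fun s => ∫ u in (0)..s, g u :=
    intervalIntegral.continuous_primitive hint 0
  refine ⟨?_, ?_, fun hGc s hs => ?_⟩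
  · rw [hform 0 le_rfl]; simp
  · refine ContinuousOn.congr (Continuous.continuousOn ?_) fun s hs => hform s hs
    exact Continuous.mul (by fun_prop) (continuous_const.add (continuous_const.mul hprim))
  · have hgc : ContinuousAt g s :=
      ContinuousAt.mul (by fun_prop) (hGc.continuousAt (Ici_mem_nhds hs))
    have hd := intervalIntegral.integral_hasDerivAt_right (hint 0 s)
      ((by fun_prop : Measurable fun u => Real.exp (k * u)).mul
        hGm).stronglyMeasurable.stronglyMeasurableAtFilter hgc
    have he : HasDerivAt (fun s : ℝ => Real.exp (-(k * s))) (Real.exp (-(k * s)) * -(k * 1)) s :=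
      ((hasDerivAt_id s).const_mul k).neg.exp
    have h := he.mul ((hd.const_mul k).const_add f)
    have hev : y =ᶠ[𝓝 s] fun s => Real.exp (-(k * s)) * (f + k * ∫ u in (0)..s, g u) := by
      filter_upwards [Ioi_mem_nhds hs] with u hu
      exact hform u (le_of_lt hu)
    refine (h.congr_of_eventuallyEq hev).congr_deriv ?_
    rw [hform s hs.le, hg]
    have e : Real.exp (-(k * s)) * (k * (Real.exp (k * s) * G s)) = k * G s := by
      have : Real.exp (-(k * s)) * Real.exp (k * s) = 1 := by
        rw [← Real.exp_add]; simp
      calc _ = (Real.exp (-(k * s)) * Real.exp (k * s)) * (k * G s) := by ring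
        _ = _ := by rw [this, one_mul]
    simp only
    rw [e]
    ring

lemma integrableOn_exp_neg_mul_of_bounded {G : ℝ → ℝ} {C a : ℝ} (hGm : Measurable G)
    (hGb : ∀ s, |G s| ≤ C) : IntegrableOn (fun v => Real.exp (-v) * G v) (Set.Ioi a) :=
  have h : IntegrableOn (fun v : ℝ => Real.exp (-v)) (Set.Ioi a) volume := by
    simpa using exp_neg_integrableOn_Ioi a one_pos
  Integrable.mul_bdd (c := C) h hGm.aestronglyMeasurable (Eventually.of_forall fun s => hGb s)

lemma integral_exp_neg_mul_shift (G : ℝ → ℝ) (a : ℝ) :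
    ∫ v in Set.Ioi a, Real.exp (-v) * G (v - a)
      = Real.exp (-a) * ∫ v in Set.Ioi (0 : ℝ), Real.exp (-v) * G v := by
  have h := (measurePreserving_add_right volume a).setIntegral_preimage_emb
    (measurableEmbedding_addRight a) (fun v => Real.exp (-v) * G (v - a)) (Set.Ioi a)
  rw [← h, ← integral_const_mul]
  have : (fun v => v + a) ⁻¹' Set.Ioi a = Set.Ioi 0 := by ext v; simp
  rw [this]
  refine integral_congr_ae (Eventually.of_forall fun v => ?_)
  simp only [add_sub_cancel_right, neg_add, Real.exp_add]
  ring

lemma setIntegral_Ioi_eq_add {F : ℝ → ℝ} {a : ℝ} (ha : 0 ≤ a) (hF : IntegrableOn F (Set.Ioi 0)) :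
    ∫ v in Set.Ioi (0 : ℝ), F v = (∫ v in Set.Ioc 0 a, F v) + ∫ v in Set.Ioi a, F v := by
  rw [← Set.Ioc_union_Ioi_eq_Ioi ha]
  exact setIntegral_union (Set.Ioc_disjoint_Ioi le_rfl) measurableSet_Ioi
    (hF.mono_set Set.Ioc_subset_Ioi_self) (hF.mono_set (Set.Ioi_subset_Ioi ha))

variable {N : ℕ}

/-- The probability that all jumps of the walk from `i` up to time `t` lead to sites in `S`. -/
noncomputable def survProb (x : Fin N → ℝ) (S : Set (Fin N)) (t : ℝ) (i : Fin N) : ℝ :=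
  startProb (window x S 0 t) i

/-- The probability that all jumps of the walk from `i` in `(s, s + t]` lead to sites in `S`. -/
noncomputable def windowProb (x : Fin N → ℝ) (S : Set (Fin N)) (t s : ℝ) (i : Fin N) : ℝ :=
  startProb (window x S s (s + t)) i

/-- The probability that the walk from `i` is in `S` at time `s`. -/
noncomputable def occProb (x : Fin N → ℝ) (S : Set (Fin N)) (s : ℝ) (i : Fin N) : ℝ :=
  startProb (occupied x S s) i

lemma sum_jumpProb_mul_le {i : Fin N} {f : Fin N → ℝ} (hf : ∀ j, |f j| ≤ 1) :
    |∑ j, jumpProb N i j * f j| ≤ 1 := by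
  calc |∑ j, jumpProb N i j * f j| ≤ ∑ j, |jumpProb N i j * f j| := Finset.abs_sum_le_sum_abs _ _
    _ ≤ ∑ j, jumpProb N i j := Finset.sum_le_sum fun j _ => by
        rw [abs_mul, abs_of_nonneg (jumpProb_nonneg i j)]
        exact mul_le_of_le_one_right (jumpProb_nonneg i j) (hf j)
    _ = 1 := sum_jumpProb i

section Formulas

variable {x : Fin N → ℝ} (hN : 2 ≤ N) (hx : ∀ i, 0 < x i) (S : Set (Fin N))
include hN hx

lemma scale_inv_mul_le_iff {i : Fin N} {v s : ℝ} :
    scale x i * v ≤ s ↔ v ≤ (scale x i)⁻¹ * s := by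
  rw [le_inv_mul_iff₀ (scale_pos hN hx i)]

lemma survProb_of_neg {t : ℝ} (ht : t < 0) (i : Fin N) : survProb x S t i = 1 := by
  have : survProb x S t i = startProb Set.univ i :=
    startProb_congr hN fun z hz => by
      simpa using mem_window_of_nonpos (p := ((i, z) : Sample N)) hN hx hz ht.le
  rw [this]
  simp [startProb]

omit hN hx in
lemma measurable_survProb (i : Fin N) : Measurable fun t => survProb x S t i :=
  measurable_startProb (measurableSet_window x S measurable_const measurable_fst measurable_snd) i

omit hN hx in
lemma measurable_windowProb (t : ℝ) (i : Fin N) : Measurable fun s => windowProb x S t s i :=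
  measurable_startProb (B := fun s => window x S s (s + t))
    (measurableSet_window x S (a := Prod.fst) (b := fun r => r.1 + t) measurable_fst
      (measurable_fst.add_const t) measurable_snd) i

omit hN hx in
lemma measurable_occProb (i : Fin N) : Measurable fun s => occProb x S s i :=
  measurable_startProb (measurableSet_occupied x S measurable_fst measurable_snd) i

open Classical in
/-- The probability that the walk from `i` with first waiting time `v` (in units of its mean) jumps
only to sites in `S` up to time `t`. -/
noncomputable def survStep (x : Fin N → ℝ) (S : Set (Fin N)) (i : Fin N) (t v : ℝ) : ℝ :=
  if scale x i * v ≤ t then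
    ∑ j, jumpProb N i j * (if j ∈ S then survProb x S (t - scale x i * v) j else 0) else 1

omit hN hx in
lemma measurable_survStep (i : Fin N) (t : ℝ) : Measurable fun v => survStep x S i t v := by
  unfold survStep
  refine Measurable.ite (measurableSet_le (by fun_prop) (by fun_prop)) ?_ measurable_const
  refine Finset.measurable_fun_sum _ fun j _ => Measurable.const_mul ?_ _
  split_ifs
  · exact (measurable_survProb S j).comp (by fun_prop)
  · exact measurable_const

omit hN hx in
lemma abs_survStep_le (i : Fin N) (t v : ℝ) : |survStep x S i t v| ≤ 1 := by
  unfold survStep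
  split_ifs
  · refine sum_jumpProb_mul_le fun j => ?_
    split_ifs
    · exact abs_startProb_le_one _ _
    · simp
  · simp

omit hN hx in
lemma startProb_sep (B : Set (Sample N)) (i : Fin N) (P : Prop) [Decidable P] :
    startProb {p | P ∧ p ∈ B} i = if P then startProb B i else 0 := by
  split_ifs with h <;> simp [startProb, h]

lemma sum_jumpProb_survProb (i : Fin N) (t v : ℝ) :
    ∑ j, jumpProb N i j * startProb {p | (scale x i * v ≤ t → j ∈ S) ∧
      p ∈ window x S 0 (t - scale x i * v)} j = survStep x S i t v := by
  classical
  unfold survStep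
  simp_rw [startProb_sep]
  split_ifs with h
  · simp only [h, true_imp_iff]
    rfl
  · simp only [h, false_imp_iff, if_true]
    have : ∀ j, startProb (window x S 0 (t - scale x i * v)) j = 1 := fun j =>
      survProb_of_neg hN hx S (by linarith [not_le.1 h]) j
    simp [this, sum_jumpProb]

lemma survProb_eq_integral (t : ℝ) (i : Fin N) :
    survProb x S t i = ∫ v in Set.Ioi (0 : ℝ), Real.exp (-v) * survStep x S i t v := by
  unfold survProb
  rw [startProb_eq_integral hN (B := window x S 0 t)
    (measurableSet_window x S measurable_const measurable_const measurable_id) i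
    (fun v j => {p | (scale x i * v ≤ t → j ∈ S) ∧ p ∈ window x S 0 (t - scale x i * v)})]
  · simp_rw [sum_jumpProb_survProb hN hx]
  · intro j
    refine MeasurableSet.inter (s₁ := {r : ℝ × Sample N | scale x i * r.1 ≤ t → j ∈ S}) ?_ ?_
    · exact (measurableSet_le (by fun_prop) (by fun_prop)).imp (MeasurableSet.const _)
    · exact measurableSet_window x S (by fun_prop) (by fun_prop) measurable_snd
  · intro v hv σ z hz
    have hpos : 0 < scale x i * v := mul_pos (scale_pos hN hx i) hv
    rw [mem_window_consStep, mem_window_iff_of_nonpos hN hx (by exact hz) (by linarith)]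
    simp [hpos]

open Classical in
lemma survProb_renewal {t : ℝ} (ht : 0 ≤ t) (i : Fin N) :
    survProb x S t i = (∫ v in Set.Ioc 0 ((scale x i)⁻¹ * t), Real.exp (-v) *
      ∑ j, jumpProb N i j * (if j ∈ S then survProb x S (t - (scale x i)⁻¹⁻¹ * v) j else 0))
      + Real.exp (-((scale x i)⁻¹ * t)) * 1 := by
  have hc := scale_pos hN hx i
  rw [survProb_eq_integral hN hx, setIntegral_Ioi_eq_add (a := (scale x i)⁻¹ * t) (by positivity)
    (integrableOn_exp_neg_mul_of_bounded (measurable_survStep S i t) (abs_survStep_le S i t))]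
  congr 1
  · refine setIntegral_congr_fun measurableSet_Ioc fun v hv => ?_
    simp only [survStep, if_pos ((scale_inv_mul_le_iff hN hx).2 hv.2), inv_inv]
  · rw [mul_one, ← integral_exp_neg_Ioi]
    refine setIntegral_congr_fun measurableSet_Ioi fun v hv => ?_
    simp only [survStep, if_neg (mt (scale_inv_mul_le_iff hN hx).1 (not_le.2 hv)), mul_one]

lemma windowProb_renewal {s t : ℝ} (hs : 0 ≤ s) (i : Fin N) :
    windowProb x S t s i = (∫ v in Set.Ioc 0 ((scale x i)⁻¹ * s), Real.exp (-v) *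
      ∑ j, jumpProb N i j * windowProb x S t (s - (scale x i)⁻¹⁻¹ * v) j)
      + Real.exp (-((scale x i)⁻¹ * s)) * survProb x S t i := by
  classical
  have hc := scale_pos hN hx i
  set b : ℝ → Fin N → Set (Sample N) := fun v j => {p |
    (s < scale x i * v → scale x i * v ≤ s + t → j ∈ S) ∧
      p ∈ window x S (s - scale x i * v) (s + t - scale x i * v)} with hb
  have hbm : ∀ j, MeasurableSet {r : ℝ × Sample N | r.2 ∈ b r.1 j} := by
    intro j
    refine MeasurableSet.inter (s₁ := {r : ℝ × Sample N |
      s < scale x i * r.1 → scale x i * r.1 ≤ s + t → j ∈ S}) ?_ ?_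
    · exact (measurableSet_lt (by fun_prop) (by fun_prop)).imp
        ((measurableSet_le (by fun_prop) (by fun_prop)).imp (MeasurableSet.const _))
    · exact measurableSet_window x S (by fun_prop) (by fun_prop) measurable_snd
  have h1 : windowProb x S t s i = ∫ v in Set.Ioi (0 : ℝ), Real.exp (-v) *
      ∑ j, jumpProb N i j * startProb (b v j) j :=
    startProb_eq_integral hN
      (measurableSet_window x S measurable_const measurable_const measurable_id) i b hbm
      fun v hv σ z hz => mem_window_consStep
  rw [h1, setIntegral_Ioi_eq_add (a := (scale x i)⁻¹ * s) (by positivity)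
    (integrableOn_exp_neg_mul_of_bounded (Finset.measurable_fun_sum _ fun j _ =>
      (measurable_startProb (hbm j) j).const_mul _)
      fun v => sum_jumpProb_mul_le fun j => abs_startProb_le_one _ _)]
  congr 1
  · refine setIntegral_congr_fun measurableSet_Ioc fun v hv => ?_
    have hle := (scale_inv_mul_le_iff hN hx).2 hv.2
    simp only [inv_inv, windowProb, hb, not_lt.2 hle, false_imp_iff, true_and]
    congr! 6 with j
    rw [Set.ofPred_mem_eq]
    congr 1
    ring
  · rw [survProb_eq_integral hN hx, ← integral_exp_neg_mul_shift]
    refine setIntegral_congr_fun measurableSet_Ioi fun v hv => ?_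
    have hlt := not_le.1 (mt (scale_inv_mul_le_iff hN hx).1 (not_le.2 hv))
    rw [← sum_jumpProb_survProb hN hx]
    have e : scale x i * (v - (scale x i)⁻¹ * s) = scale x i * v - s := by field_simp
    congr 1
    refine Finset.sum_congr rfl fun j _ => ?_
    congr 1
    refine startProb_congr hN fun z hz => ?_
    simp only [hb, Set.mem_ofPred_eq, e, hlt, true_imp_iff]
    rw [mem_window_iff_of_nonpos hN hx (by exact hz) (by linarith), sub_le_iff_le_add, add_comm t s,
      show s + t - scale x i * v = t - (scale x i * v - s) by ring]

open Classical in
lemma occProb_renewal {s : ℝ} (hs : 0 ≤ s) (i : Fin N) :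
    occProb x S s i = (∫ v in Set.Ioc 0 ((scale x i)⁻¹ * s), Real.exp (-v) *
      ∑ j, jumpProb N i j * occProb x S (s - (scale x i)⁻¹⁻¹ * v) j)
      + Real.exp (-((scale x i)⁻¹ * s)) * (if i ∈ S then 1 else 0) := by
  have hc := scale_pos hN hx i
  set b : ℝ → Fin N → Set (Sample N) := fun v j => {p |
    if scale x i * v ≤ s then p ∈ occupied x S (s - scale x i * v) else i ∈ S} with hb
  have hbm : ∀ j, MeasurableSet {r : ℝ × Sample N | r.2 ∈ b r.1 j} := by
    intro j
    refine measurableSet_setOfPred.2 (Measurable.ite (measurableSet_le (by fun_prop) (by fun_prop))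
      (measurableSet_setOfPred.1 ?_) measurable_const)
    exact measurableSet_occupied x S (by fun_prop) measurable_snd
  have h1 : occProb x S s i = ∫ v in Set.Ioi (0 : ℝ), Real.exp (-v) *
      ∑ j, jumpProb N i j * startProb (b v j) j :=
    startProb_eq_integral hN
      (measurableSet_occupied x S measurable_const measurable_id) i b hbm
      fun v hv σ z hz => mem_occupied_consStep hN hx hs hz
  rw [h1, setIntegral_Ioi_eq_add (a := (scale x i)⁻¹ * s) (by positivity)
    (integrableOn_exp_neg_mul_of_bounded (Finset.measurable_fun_sum _ fun j _ =>
      (measurable_startProb (hbm j) j).const_mul _)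
      fun v => sum_jumpProb_mul_le fun j => abs_startProb_le_one _ _)]
  congr 1
  · refine setIntegral_congr_fun measurableSet_Ioc fun v hv => ?_
    have hle := (scale_inv_mul_le_iff hN hx).2 hv.2
    simp only [inv_inv, occProb, hb, if_pos hle, Set.ofPred_mem_eq]
  · rw [← integral_exp_neg_Ioi, ← integral_mul_const]
    refine setIntegral_congr_fun measurableSet_Ioi fun v hv => ?_
    have hlt := mt (scale_inv_mul_le_iff hN hx).1 (not_le.2 hv)
    simp only [hb, if_neg hlt]
    congr 1
    by_cases hi : i ∈ S
    · simp [hi, startProb, sum_jumpProb]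
    · simp [hi, startProb]

/-- The rates `1 / scale x i` compensate the void jumps of `gen x`: the jump rates between different
sites agree. -/
lemma gen_eq (y : Fin N → ℝ) (i : Fin N) :
    (scale x i)⁻¹ * (∑ j, jumpProb N i j * y j - y i) = gen x y i := by
  have hN' : (2 : ℝ) ≤ N := by exact_mod_cast hN
  have h1 : ∑ j, jumpProb N i j * y j = ((N : ℝ) - 1)⁻¹ * (∑ j, y j - y i) := by
    have : ∀ j, jumpProb N i j * y j
        = ((N : ℝ) - 1)⁻¹ * y j - if j = i then ((N : ℝ) - 1)⁻¹ * y j else 0 := by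
      intro j
      rw [jumpProb_eq hN]
      split_ifs <;> simp
    simp only [this, Finset.sum_sub_distrib, ← Finset.mul_sum, Finset.sum_ite_eq', Finset.mem_univ,
      if_true]
    ring
  rw [h1, gen, mean, scale, Fintype.card_fin]
  have h2 := (hx i).ne'
  have h3 : (N : ℝ) - 1 ≠ 0 := by linarith
  have h4 : (N : ℝ) ≠ 0 := by linarith
  field_simp
  ring

lemma windowProb_isFlow (t : ℝ) : IsFlow x (windowProb x S t) ∧
    windowProb x S t 0 = survProb x S t := by
  have h := fun i => renewal_eq (k := (scale x i)⁻¹) (f := survProb x S t i) (C := 1)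
    (y := fun s => windowProb x S t s i)
    (G := fun s => ∑ j, jumpProb N i j * windowProb x S t s j)
    (inv_pos.2 (scale_pos hN hx i))
    (Finset.measurable_fun_sum _ fun j _ => (measurable_windowProb S t j).const_mul _)
    (fun s => sum_jumpProb_mul_le fun j => abs_startProb_le_one _ _)
    (fun s hs => windowProb_renewal hN hx S hs i)
  refine ⟨⟨fun i => (h i).2.1, fun s hs i => ?_⟩, funext fun i => (h i).1⟩
  rw [← gen_eq hN hx]
  exact (h i).2.2 (continuousOn_finsetSum _ fun j _ => continuousOn_const.mul (h j).2.1) s hs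

open Classical in
lemma occProb_isFlow : IsFlow x (occProb x S) ∧
    occProb x S 0 = fun i => if i ∈ S then 1 else 0 := by
  have h := fun i => renewal_eq (k := (scale x i)⁻¹) (f := if i ∈ S then 1 else 0) (C := 1)
    (y := fun s => occProb x S s i)
    (G := fun s => ∑ j, jumpProb N i j * occProb x S s j)
    (inv_pos.2 (scale_pos hN hx i))
    (Finset.measurable_fun_sum _ fun j _ => (measurable_occProb S j).const_mul _)
    (fun s => sum_jumpProb_mul_le fun j => abs_startProb_le_one _ _)
    (fun s hs => occProb_renewal hN hx S hs i)
  refine ⟨⟨fun i => (h i).2.1, fun s hs i => ?_⟩, funext fun i => (h i).1⟩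
  rw [← gen_eq hN hx]
  exact (h i).2.2 (continuousOn_finsetSum _ fun j _ => continuousOn_const.mul (h j).2.1) s hs

open Classical in
lemma survProb_ode (i : Fin N) : survProb x S 0 i = 1 ∧
    ContinuousOn (fun t => survProb x S t i) (Set.Ici 0) ∧
    ∀ t, 0 < t → HasDerivAt (fun t => survProb x S t i)
      ((scale x i)⁻¹ * (∑ j, jumpProb N i j * (if j ∈ S then survProb x S t j else 0)
        - survProb x S t i)) t := by
  have h := fun i => renewal_eq (k := (scale x i)⁻¹) (f := 1) (C := 1)
    (y := fun s => survProb x S s i)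
    (G := fun s => ∑ j, jumpProb N i j * (if j ∈ S then survProb x S s j else 0))
    (inv_pos.2 (scale_pos hN hx i))
    (Finset.measurable_fun_sum _ fun j _ => by
      split_ifs
      exacts [(measurable_survProb S j).const_mul _, measurable_const])
    (fun s => sum_jumpProb_mul_le fun j => by
      split_ifs
      exacts [abs_startProb_le_one _ _, by simp])
    (fun s hs => survProb_renewal hN hx S hs i)
  refine ⟨(h i).1, (h i).2.1, (h i).2.2 (continuousOn_finsetSum _ fun j _ => ?_)⟩
  split_ifs
  exacts [continuousOn_const.mul (h j).2.1, continuousOn_const]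

end Formulas

end TrapModel

/-! ### Laplace transforms and uniform bounds for finitely many sites -/

namespace TrapModel

variable {N : ℕ} {x : Fin N → ℝ}

section Bounds

variable (hN : 2 ≤ N) (hx : ∀ i, 0 < x i) (S : Set (Fin N))
include hN hx

omit hN hx in
lemma scale_inv (i : Fin N) : (scale x i)⁻¹ = x i * (((N : ℝ) - 1) / N) := by
  rw [scale, mul_inv, inv_inv, inv_div, mul_comm]

lemma scale_inv_le (i : Fin N) : (scale x i)⁻¹ ≤ x i := by
  have hN' : (2 : ℝ) ≤ N := by exact_mod_cast hN
  rw [scale_inv]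
  refine mul_le_of_le_one_right (hx i).le ?_
  rw [div_le_one (by linarith)]
  linarith

lemma survProb_empty {t : ℝ} (ht : 0 ≤ t) (i : Fin N) :
    survProb x ∅ t i = Real.exp (-(x i * (((N : ℝ) - 1) / N) * t)) := by
  rw [survProb_renewal hN hx ∅ ht, ← scale_inv]
  simp

lemma abs_survProb_sub_le {s t : ℝ} (hs : 0 ≤ s) (hst : s ≤ t) (i : Fin N) :
    |survProb x S t i - survProb x S s i| ≤ x i * (t - s) := by
  classical
  have hode := survProb_ode hN hx S i
  have hbound : ∀ r, |(scale x i)⁻¹ * (∑ j, jumpProb N i j *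
      (if j ∈ S then survProb x S r j else 0) - survProb x S r i)| ≤ x i := by
    intro r
    have h0 : 0 ≤ ∑ j, jumpProb N i j * (if j ∈ S then survProb x S r j else 0) :=
      Finset.sum_nonneg fun j _ => mul_nonneg (jumpProb_nonneg i j) (by
        split_ifs
        exacts [startProb_nonneg _ _, le_rfl])
    have h1 : |∑ j, jumpProb N i j * (if j ∈ S then survProb x S r j else 0)| ≤ 1 :=
      sum_jumpProb_mul_le fun j => by
        split_ifs
        exacts [abs_startProb_le_one _ _, by simp]
    rw [abs_of_nonneg h0] at h1
    have h2 : 0 ≤ survProb x S r i := startProb_nonneg _ _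
    have h3 : survProb x S r i ≤ 1 := startProb_le_one _ _
    have hc := inv_pos.2 (scale_pos hN hx i)
    rw [abs_mul, abs_of_pos hc]
    have h4 : |(∑ j, jumpProb N i j * (if j ∈ S then survProb x S r j else 0))
        - survProb x S r i| ≤ 1 := by
      rw [abs_le]
      constructor <;> linarith
    exact (mul_le_of_le_one_right hc.le h4).trans (scale_inv_le hN hx i)
  rcases hst.eq_or_lt with rfl | hlt
  · simp
  obtain ⟨c, hc, hc'⟩ := exists_hasDerivAt_eq_slope (fun t => survProb x S t i) _ hlt
    (hode.2.1.mono fun r hr => hs.trans hr.1)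
    (fun r hr => hode.2.2 r (hs.trans_lt hr.1))
  have hpos : 0 < t - s := sub_pos.2 hlt
  have := hbound c
  rw [hc', abs_div, abs_of_pos hpos, div_le_iff₀ hpos] at this
  exact this

lemma one_sub_survProb_le {t : ℝ} (ht : 0 ≤ t) (i : Fin N) :
    1 - survProb x S t i ≤ x i * t := by
  have h := abs_survProb_sub_le hN hx S le_rfl ht i
  rw [(survProb_ode hN hx S i).1, sub_zero] at h
  linarith [(abs_le.1 h).1]

/-- The initial values `1 - survProb` have a norm that is bounded by a Stieltjes transform. -/
lemma wip_survProb_le {t w : ℝ} (ht : 0 ≤ t) (hw : 0 < w) :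
    wip x (fun i => survProb x S t i - 1) (fun i => survProb x S t i - 1)
      ≤ (1 + w * t) * stieltjes x w := by
  rw [wip, stieltjes, Finset.mul_sum]
  refine Finset.sum_le_sum fun i _ => ?_
  have h0 := one_sub_survProb_le hN hx S ht i
  have h1 : survProb x S t i ≤ 1 := startProb_le_one _ _
  have h2 : 0 ≤ survProb x S t i := startProb_nonneg _ _
  have hxi := hx i
  rw [← div_eq_mul_inv, div_le_div_iff₀ hxi (by positivity)]
  set u := 1 - survProb x S t i with hu
  have e : (survProb x S t i - 1) * (survProb x S t i - 1) = u * u := by rw [hu]; ring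
  rw [e]
  have hu0 : 0 ≤ u := by linarith
  have hu1 : u ≤ 1 := by linarith
  have h3 : u * u ≤ 1 * (x i * t) := mul_le_mul hu1 h0 hu0 zero_le_one
  have h4 : u * u ≤ 1 := by nlinarith
  nlinarith [mul_le_mul_of_nonneg_right h3 hw.le, mul_le_mul_of_nonneg_right h4 hxi.le]

omit hN hx in
lemma mean_sub_const [NeZero N] (f : Fin N → ℝ) (c : ℝ) :
    mean (fun i => f i - c) = mean f - c := by
  have : (N : ℝ) ≠ 0 := by exact_mod_cast NeZero.ne N
  simp only [mean, Finset.sum_sub_distrib, Finset.sum_const, Finset.card_univ, nsmul_eq_mul,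
    Fintype.card_fin]
  field_simp

/-- The Lipschitz constant of the correlation functions in the waiting time depends neither on the
rates nor on the number of sites. -/
lemma abs_mean_windowProb_sub_le {t s v : ℝ} (ht : 0 ≤ t) (hs : 0 < s) (hv : s ≤ v) :
    |mean (windowProb x S t v) - mean (windowProb x S t s)|
      ≤ √(2 / s ^ 2 * Real.exp 1 * (1 + t / s)) * (v - s) := by
  have : NeZero N := ⟨by omega⟩
  obtain ⟨hflow, h0⟩ := windowProb_isFlow hN hx S t
  have h := (hflow.sub_const 1).abs_mean_sub_le hx hs hv
  rw [mean_sub_const, mean_sub_const, h0, sub_sub_sub_cancel_right] at h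
  refine h.trans (mul_le_mul_of_nonneg_right (Real.sqrt_le_sqrt ?_) (sub_nonneg.2 hv))
  have hZ := stieltjes_pos hx (w := 1 / s) (by positivity)
  calc _ ≤ 2 / s ^ 2 * (Real.exp 1 / stieltjes x (1 / s)) *
        ((1 + 1 / s * t) * stieltjes x (1 / s)) :=
        mul_le_mul_of_nonneg_left (wip_survProb_le hN hx S ht (by positivity)) (by positivity)
    _ = _ := by field_simp

lemma laplace_mean_windowProb {t w : ℝ} (hw : 0 < w) :
    ∫ s in Set.Ioi (0 : ℝ), Real.exp (-(w * s)) * mean (windowProb x S t s)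
      = (∑ i, survProb x S t i / (w + x i)) / (w * stieltjes x w) := by
  have : NeZero N := ⟨by omega⟩
  obtain ⟨hflow, h0⟩ := windowProb_isFlow hN hx S t
  rw [hflow.laplace_mean hx hw, h0]

/-- The probability to be at a site with rate at least `δ` is small at large times `s`. The Laplace
transform at `1 / s` bounds its average over `[s, 2 * s]`, and the Lipschitz bound allows to pass from
this average to the value at `s`. -/
lemma mean_occProb_le {δ s : ℝ} (hδ : 0 < δ) (hs : 0 < s) :
    mean (occProb x {i | δ ≤ x i} s)
      ≤ Real.exp 2 * (2 * stieltjes x δ / stieltjes x (1 / s)) +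
        √(2 * Real.exp 1 * (1 + 1 / (s * δ)) * (2 * stieltjes x δ / stieltjes x (1 / s))) := by
  classical
  have : NeZero N := ⟨by omega⟩
  set S : Set (Fin N) := {i | δ ≤ x i} with hS
  obtain ⟨hflow, h0⟩ := occProb_isFlow hN hx S
  have hZ := stieltjes_pos hx (w := 1 / s) (by positivity)
  have hZδ := stieltjes_pos hx hδ
  set r := 2 * stieltjes x δ / stieltjes x (1 / s) with hr
  have hr0 : 0 ≤ r := by positivity
  have hsum : ∑ i, (if i ∈ S then (1 : ℝ) else 0) / (1 / s + x i) ≤ 2 * stieltjes x δ := by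
    rw [stieltjes, Finset.mul_sum]
    refine Finset.sum_le_sum fun i _ => ?_
    have hxi := hx i
    split_ifs with h
    · have hle : δ ≤ x i := h
      rw [← div_eq_mul_inv, div_le_div_iff₀ (by positivity) (by positivity)]
      have : 0 < 1 / s := by positivity
      linarith
    · rw [zero_div]; positivity
  have hwip : wip x (occProb x S 0) (occProb x S 0)
      ≤ (1 + 1 / (s * δ)) * (2 * stieltjes x δ) := by
    refine le_trans ?_ (mul_le_mul_of_nonneg_left hsum (by positivity))
    rw [wip, h0, Finset.mul_sum]
    refine Finset.sum_le_sum fun i _ => ?_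
    have hxi := hx i
    by_cases h : i ∈ S
    · have hle : δ ≤ x i := h
      simp only [if_pos h]
      rw [mul_one, ← mul_div_assoc, mul_one, div_le_div_iff₀ hxi (by positivity)]
      have : 1 / s ≤ 1 / (s * δ) * x i := by
        rw [one_div_mul_eq_div, div_le_div_iff₀ hs (by positivity)]
        nlinarith
      nlinarith
    · simp [h]
  have hlip : ∀ v, s ≤ v → v ≤ 2 * s →
      mean (occProb x S s) - √(2 * Real.exp 1 * (1 + 1 / (s * δ)) * r) ≤ mean (occProb x S v) := by
    intro v hv hv2
    have h := hflow.abs_mean_sub_le hx hs hv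
    have h2 : √(2 / s ^ 2 * (Real.exp 1 / stieltjes x (1 / s)) *
        wip x (occProb x S 0) (occProb x S 0)) * (v - s)
        ≤ √(2 * Real.exp 1 * (1 + 1 / (s * δ)) * r) := by
      calc _ ≤ √(2 / s ^ 2 * (Real.exp 1 / stieltjes x (1 / s)) *
            ((1 + 1 / (s * δ)) * (2 * stieltjes x δ))) * s := by gcongr; linarith
        _ = √((2 * Real.exp 1 * (1 + 1 / (s * δ)) * r) / s ^ 2) * s := by
            congr 2
            rw [hr]
            field_simp
        _ = _ := by
            rw [Real.sqrt_div (by positivity), Real.sqrt_sq hs.le]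
            field_simp
    linarith [(abs_le.1 (h.trans h2)).1]
  set c := mean (occProb x S s) - √(2 * Real.exp 1 * (1 + 1 / (s * δ)) * r) with hc
  have hlap := hflow.laplace_mean hx (w := 1 / s) (by positivity)
  have hbd : ∀ v, |mean (occProb x S v)| ≤ 1 := fun v =>
    IsFlow.mean_bound fun i => abs_startProb_le_one _ _
  have hnn : ∀ v, 0 ≤ mean (occProb x S v) := fun v =>
    div_nonneg (Finset.sum_nonneg fun i _ => startProb_nonneg _ _) (Nat.cast_nonneg _)
  have hint : IntegrableOn (fun v => Real.exp (-(1 / s * v)) * mean (occProb x S v)) (Set.Ioi 0) :=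
    integrableOn_exp_mul_of_bounded (by positivity) (fun v _ => hbd v)
      ((hflow.mean_continuousOn.mono Set.Ioi_subset_Ici_self).aestronglyMeasurable
        measurableSet_Ioi)
  rcases le_or_gt c 0 with hc0 | hc0
  · have : 0 ≤ Real.exp 2 * r := by positivity
    linarith
  have hlow : s * (Real.exp (-2) * c)
      ≤ ∫ v in Set.Ioi (0 : ℝ), Real.exp (-(1 / s * v)) * mean (occProb x S v) := by
    calc s * (Real.exp (-2) * c) = ∫ _ in Set.Ioc s (2 * s), Real.exp (-2) * c := by
          simp only [integral_const, MeasurableSet.univ, measureReal_restrict_apply, Set.univ_inter,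
            Real.volume_real_Ioc, smul_eq_mul]
          rw [max_eq_left (by linarith)]
          ring
      _ ≤ ∫ v in Set.Ioc s (2 * s), Real.exp (-(1 / s * v)) * mean (occProb x S v) := by
          refine setIntegral_mono_on (integrable_const _)
            (hint.mono_set fun v hv => hs.trans hv.1) measurableSet_Ioc fun v hv => ?_
          refine mul_le_mul ?_ (hlip v hv.1.le hv.2) hc0.le (Real.exp_nonneg _)
          refine Real.exp_le_exp.2 (neg_le_neg ?_)
          rw [one_div, inv_mul_le_iff₀ hs]
          linarith [hv.2]
      _ ≤ _ := by
          refine setIntegral_mono_set hint ?_ (Eventually.of_forall fun v hv => hs.trans hv.1)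
          exact Eventually.of_forall fun v => mul_nonneg (Real.exp_nonneg _) (hnn v)
  rw [hlap, h0] at hlow
  have h3 : s * (Real.exp (-2) * c) ≤ s * r := by
    refine hlow.trans ((div_le_div_of_nonneg_right hsum (by positivity)).trans_eq ?_)
    rw [hr]; field_simp
  have h4 := le_of_mul_le_mul_left h3 hs
  rw [Real.exp_neg, inv_mul_le_iff₀ (Real.exp_pos 2)] at h4
  linarith

/-- The Laplace transform in `t` of the probability that all jumps up to time `t` lead to `S`. The
number `H` is the average over all sites of this transform restricted to `S`. The correction `x i / N`
for `i ∉ S` comes from the void jumps of `gen x`, which would lead back to `i`. -/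
lemma laplace_survProb {w : ℝ} (hw : 0 < w) :
    ∃ H : ℝ, H * ((N : ℝ) - Nat.card S + w * ∑ i, S.indicator (fun i => (w + x i)⁻¹) i)
        = ∑ i, S.indicator (fun i => (w + x i)⁻¹) i ∧
      (∀ i ∈ S, ∫ t in Set.Ioi (0 : ℝ), Real.exp (-(w * t)) * survProb x S t i
        = (1 + x i * H) / (w + x i)) ∧
      (∀ i ∉ S, ∫ t in Set.Ioi (0 : ℝ), Real.exp (-(w * t)) * survProb x S t i
        = (1 + x i * H) / (w + x i - x i / N)) := by
  classical
  have hN' : (2 : ℝ) ≤ N := by exact_mod_cast hN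
  set Y : Fin N → ℝ := fun i => ∫ t in Set.Ioi (0 : ℝ), Real.exp (-(w * t)) * survProb x S t i
    with hY
  have hint : ∀ i, IntegrableOn (fun t => Real.exp (-(w * t)) * survProb x S t i) (Set.Ioi 0) :=
    fun i => integrableOn_exp_mul_of_bounded hw (fun t _ => abs_startProb_le_one _ _)
      (measurable_survProb S i).aestronglyMeasurable
  set H : ℝ := (∑ i, if i ∈ S then Y i else 0) / N with hH
  have hmain : ∀ i, w * Y i = 1 + gen x (fun j => if j ∈ S then Y j else 0) i
      + (scale x i)⁻¹ * ((if i ∈ S then Y i else 0) - Y i) := by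
    intro i
    have hode := survProb_ode hN hx S i
    have hterm : ∀ j t, |if j ∈ S then survProb x S t j else 0| ≤ 1 := fun j t => by
      split_ifs
      exacts [abs_startProb_le_one _ _, by simp]
    have hmeas : ∀ j, Measurable fun t => if j ∈ S then survProb x S t j else 0 := fun j => by
      split_ifs
      exacts [measurable_survProb S j, measurable_const]
    have h := mul_laplace_eq_add_laplace_deriv (C := 1) (C' := (scale x i)⁻¹ * (1 + 1)) hw hode.2.1
      hode.2.2 (fun t _ => abs_startProb_le_one _ _) (fun t _ => by
        rw [abs_mul, abs_of_pos (inv_pos.2 (scale_pos hN hx i))]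
        refine mul_le_mul_of_nonneg_left ((abs_sub _ _).trans (add_le_add ?_ ?_))
          (inv_pos.2 (scale_pos hN hx i)).le
        · exact sum_jumpProb_mul_le fun j => hterm j t
        · exact abs_startProb_le_one _ _)
      (((Finset.measurable_fun_sum _ fun j _ => (hmeas j).const_mul _).sub
        (measurable_survProb S i)).const_mul _).aestronglyMeasurable
    rw [hode.1] at h
    have hint' : ∀ j, IntegrableOn (fun t => Real.exp (-(w * t)) *
        (if j ∈ S then survProb x S t j else 0)) (Set.Ioi 0) := fun j =>
      integrableOn_exp_mul_of_bounded hw (fun t _ => hterm j t) (hmeas j).aestronglyMeasurable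
    have hval : ∀ j, ∫ t in Set.Ioi (0 : ℝ), Real.exp (-(w * t)) *
        (if j ∈ S then survProb x S t j else 0) = if j ∈ S then Y j else 0 := by
      intro j
      split_ifs <;> simp [hY]
    have h2 : ∫ t in Set.Ioi (0 : ℝ), Real.exp (-(w * t)) * ((scale x i)⁻¹ *
        (∑ j, jumpProb N i j * (if j ∈ S then survProb x S t j else 0) - survProb x S t i))
        = (scale x i)⁻¹ * (∑ j, jumpProb N i j * (if j ∈ S then Y j else 0) - Y i) := by
      have e : ∀ t, Real.exp (-(w * t)) * ((scale x i)⁻¹ *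
          (∑ j, jumpProb N i j * (if j ∈ S then survProb x S t j else 0) - survProb x S t i))
          = (scale x i)⁻¹ * (∑ j, jumpProb N i j * (Real.exp (-(w * t)) *
            (if j ∈ S then survProb x S t j else 0)) - Real.exp (-(w * t)) * survProb x S t i) := by
        intro t
        rw [mul_left_comm, mul_sub, Finset.mul_sum]
        simp only [mul_left_comm]
      simp_rw [e]
      rw [integral_const_mul, integral_sub (integrable_finsetSum _ fun j _ => (hint' j).const_mul _)
        (hint i), integral_finsetSum _ fun j _ => (hint' j).const_mul _]
      simp only [integral_const_mul, hval]
      rfl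
    rw [h2] at h
    rw [h, ← gen_eq hN hx]
    ring
  have hgen : ∀ i, gen x (fun j => if j ∈ S then Y j else 0) i
      = x i * (H - if i ∈ S then Y i else 0) := by
    intro i
    simp only [gen, mean, Fintype.card_fin, hH]
  have hin : ∀ i ∈ S, Y i = (1 + x i * H) / (w + x i) := by
    intro i hi
    have h := hmain i
    rw [hgen, if_pos hi, sub_self, mul_zero, add_zero] at h
    rw [eq_div_iff (add_pos hw (hx i)).ne']
    linarith
  have hout : ∀ i ∉ S, Y i = (1 + x i * H) / (w + x i - x i / N) := by
    intro i hi
    have h := hmain i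
    rw [hgen, if_neg hi, sub_zero, zero_sub, scale_inv] at h
    have hxi := hx i
    have hpos : 0 < w + x i - x i / N := by
      have : x i / N ≤ x i := div_le_self hxi.le (by linarith)
      linarith
    rw [eq_div_iff hpos.ne']
    have e : x i * (((N : ℝ) - 1) / N) = x i - x i / N := by
      field_simp
    rw [e] at h
    linarith
  refine ⟨H, ?_, hin, hout⟩
  have h1 : (N : ℝ) * H = ∑ i, if i ∈ S then (1 + x i * H) / (w + x i) else 0 := by
    rw [hH, mul_div_cancel₀ _ (by linarith : (N : ℝ) ≠ 0)]
    refine Finset.sum_congr rfl fun i _ => ?_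
    split_ifs with hi
    · exact hin i hi
    · rfl
  have h2 : ∀ i, (if i ∈ S then (1 + x i * H) / (w + x i) else 0)
      = (1 - w * H) * S.indicator (fun i => (w + x i)⁻¹) i + H * S.indicator (fun _ => 1) i := by
    intro i
    have : w + x i ≠ 0 := (add_pos hw (hx i)).ne'
    by_cases hi : i ∈ S
    · simp only [hi, if_true, Set.indicator_of_mem]
      field_simp
      ring
    · simp [hi]
  have h3 : ∑ i, S.indicator (fun _ => (1 : ℝ)) i = Nat.card S := by
    rw [Finset.sum_indicator_eq_sum_filter, Nat.card_eq_fintype_card, Fintype.card_subtype]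
    simp
  simp only [h2, Finset.sum_add_distrib, ← Finset.mul_sum, h3] at h1
  linarith

end Bounds

section Correlation

variable (hN : 2 ≤ N) (hx : ∀ i, 0 < x i)
include hN hx

lemma shallowJumpProb_eq_mean (hinj : Function.Injective x) (δ t : ℝ) {tw : ℝ} (htw : 0 ≤ tw) :
    shallowJumpProb x δ t tw = mean (windowProb x {i | δ ≤ x i} t tw) := by
  have : NeZero N := ⟨by omega⟩
  refine (walkLaw_real_congr hN (B' := window x {i | δ ≤ x i} tw (tw + t))
    fun p hp => shallow_iff_mem_window hN hx hinj hp htw).trans ?_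
  exact walkLaw_real_eq_mean
    (measurableSet_window x _ measurable_const measurable_const measurable_id)

lemma stayProb_eq_mean (t : ℝ) {tw : ℝ} (htw : 0 ≤ tw) :
    stayProb x t tw = mean (windowProb x ∅ t tw) := by
  have : NeZero N := ⟨by omega⟩
  refine (walkLaw_real_congr hN (B' := window x ∅ tw (tw + t))
    fun p hp => stay_iff_mem_window hN hx hp htw).trans ?_
  exact walkLaw_real_eq_mean
    (measurableSet_window x _ measurable_const measurable_const measurable_id)

/-- If a jump occurs in `(tw, tw + t]` and all of them lead to sites in `S`, then the walk is in `S`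
at time `tw + t`. -/
lemma abs_shallowJumpProb_sub_stayProb_le (hinj : Function.Injective x) (δ : ℝ) {t tw : ℝ}
    (htw : 0 ≤ tw) (ht : 0 ≤ t) :
    |shallowJumpProb x δ t tw - stayProb x t tw|
      ≤ mean (occProb x {i | δ ≤ x i} (tw + t)) := by
  have : NeZero N := ⟨by omega⟩
  rw [shallowJumpProb_eq_mean hN hx hinj δ t htw, stayProb_eq_mean hN hx t htw]
  have hle : ∀ i, windowProb x ∅ t tw i ≤ windowProb x {i | δ ≤ x i} t tw i := fun i =>
    measureReal_mono fun z hz => window_empty_subset _ _ _ hz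
  have hle2 : ∀ i, windowProb x {i | δ ≤ x i} t tw i - windowProb x ∅ t tw i
      ≤ occProb x {i | δ ≤ x i} (tw + t) i := by
    intro i
    rw [sub_le_iff_le_add]
    refine le_trans ?_ (measureReal_union_le _ _)
    have h : ∀ᵐ z ∂(stepsLaw N), ((i, z) : Sample N) ∈ window x {i | δ ≤ x i} tw (tw + t) →
        z ∈ {z | ((i, z) : Sample N) ∈ occupied x {i | δ ≤ x i} (tw + t)} ∪
          {z | ((i, z) : Sample N) ∈ window x ∅ tw (tw + t)} := by
      filter_upwards [ae_isGeneric hN] with z hz h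
      by_cases h' : ((i, z) : Sample N) ∈ window x ∅ tw (tw + t)
      · exact Or.inr h'
      · exact Or.inl (mem_occupied_of_mem_window hN hx (by exact hz) htw ht h h')
    exact ENNReal.toReal_mono (measure_ne_top _ _) (measure_mono_ae h)
  have hmono : ∀ f g : Fin N → ℝ, (∀ i, f i ≤ g i) → mean f ≤ mean g := fun f g hfg =>
    div_le_div_of_nonneg_right (Finset.sum_le_sum fun i _ => hfg i) (Nat.cast_nonneg _)
  have hsub : mean (windowProb x {i | δ ≤ x i} t tw) - mean (windowProb x ∅ t tw)
      = mean fun i => windowProb x {i | δ ≤ x i} t tw i - windowProb x ∅ t tw i := by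
    simp only [mean, Finset.sum_sub_distrib, sub_div]
  rw [abs_of_nonneg (sub_nonneg.2 (hmono _ _ hle)), hsub]
  exact hmono _ _ hle2

end Correlation

end TrapModel

/-! ### The limit of infinitely many sites -/

namespace TrapModel

/-- The rates of the first `N` sites. -/
def firstRates (x : ℕ → ℝ) (N : ℕ) (i : Fin N) : ℝ := x i

/-- The Stieltjes transform `∑ 1 / (w + x i)` of a sequence of rates. -/
noncomputable def stieltjesSeq (x : ℕ → ℝ) (w : ℝ) : ℝ := ∑' i, (w + x i)⁻¹

section

variable {x : ℕ → ℝ} (hx : ∀ i, 0 < x i) (hs : Summable fun i => (x i)⁻¹)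
include hx hs

lemma summable_inv_add {w : ℝ} (hw : 0 < w) : Summable fun i => (w + x i)⁻¹ :=
  Summable.of_nonneg_of_le (fun i => (inv_pos.2 (add_pos hw (hx i))).le)
    (fun i => inv_anti₀ (hx i) (by linarith)) hs

lemma stieltjesSeq_pos {w : ℝ} (hw : 0 < w) : 0 < stieltjesSeq x w :=
  (summable_inv_add hx hs hw).tsum_pos (fun i => (inv_pos.2 (add_pos hw (hx i))).le) 0
    (inv_pos.2 (add_pos hw (hx 0)))

lemma tendsto_stieltjes {w : ℝ} (hw : 0 < w) :
    Tendsto (fun N => stieltjes (firstRates x N) w) atTop (𝓝 (stieltjesSeq x w)) := by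
  have h := (summable_inv_add hx hs hw).hasSum.tendsto_sum_nat
  refine h.congr fun N => ?_
  rw [stieltjes, ← Fin.sum_univ_eq_sum_range (fun i => (w + x i)⁻¹) N]
  rfl

omit hx hs in
lemma tendsto_sum_fin_of_dominated {f : (N : ℕ) → Fin N → ℝ} {g b : ℕ → ℝ} (hb : Summable b)
    (hle : ∀ᶠ N in atTop, ∀ i : Fin N, |f N i| ≤ b i) (hb0 : ∀ i, 0 ≤ b i)
    (hlim : ∀ i, Tendsto (fun N => if h : i < N then f N ⟨i, h⟩ else 0) atTop (𝓝 (g i))) :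
    Tendsto (fun N => ∑ i, f N i) atTop (𝓝 (∑' i, g i)) := by
  have h := tendsto_tsum_of_dominated_convergence (𝓕 := atTop)
    (f := fun N i => if h : i < N then f N ⟨i, h⟩ else 0) hb hlim (by
      filter_upwards [hle] with N hN i
      split_ifs with h
      · exact hN ⟨i, h⟩
      · simpa using hb0 i)
  refine h.congr fun N => ?_
  rw [tsum_eq_sum (s := Finset.range N) fun i hi => dif_neg (by simpa using hi),
    Finset.sum_range]
  exact Finset.sum_congr rfl fun i _ => dif_pos i.2

/-- The limit of the correlation functions as the number of sites tends to infinity. -/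
lemma exists_tendsto_mean_windowProb (S : (N : ℕ) → Set (Fin N)) {t : ℝ} (ht : 0 ≤ t) {h : ℕ → ℝ}
    (hlim : ∀ i, Tendsto (fun N => if hi : i < N then
      survProb (firstRates x N) (S N) t ⟨i, hi⟩ else 0) atTop (𝓝 (h i))) :
    ∃ L : ℝ → ℝ,
      (∀ s, 0 < s → Tendsto (fun N => mean (windowProb (firstRates x N) (S N) t s)) atTop
        (𝓝 (L s))) ∧
      (∀ s, 0 < s → |L s| ≤ 1) ∧
      AEStronglyMeasurable L (volume.restrict (Set.Ioi 0)) ∧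
      (∀ s v, 0 < s → s ≤ v → |L v - L s| ≤ √(2 / s ^ 2 * Real.exp 1 * (1 + t / s)) * (v - s)) ∧
      (∀ w, 0 < w → ∫ s in Set.Ioi (0 : ℝ), Real.exp (-(w * s)) * L s
        = (∑' i, h i / (w + x i)) / (w * stieltjesSeq x w)) := by
  have hbd : ∀ N s, |mean (windowProb (firstRates x N) (S N) t s)| ≤ 1 := by
    intro N s
    rcases Nat.eq_zero_or_pos N with rfl | hN
    · simp [mean]
    · have : NeZero N := ⟨hN.ne'⟩
      exact IsFlow.mean_bound fun i => abs_startProb_le_one _ _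
  have hm : ∀ N, Measurable fun s => mean (windowProb (firstRates x N) (S N) t s) := fun N =>
    (Finset.measurable_fun_sum _ fun i _ => measurable_windowProb (S N) t i).div_const _
  have hlap : ∀ w, 0 < w → Tendsto (fun N => ∫ s in Set.Ioi (0 : ℝ), Real.exp (-(w * s)) *
      mean (windowProb (firstRates x N) (S N) t s)) atTop
      (𝓝 ((∑' i, h i / (w + x i)) / (w * stieltjesSeq x w))) := by
    intro w hw
    have h1 : Tendsto (fun N => ∑ i, survProb (firstRates x N) (S N) t i / (w + firstRates x N i))
        atTop (𝓝 (∑' i, h i / (w + x i))) := by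
      refine tendsto_sum_fin_of_dominated (summable_inv_add hx hs hw)
        (Eventually.of_forall fun N i => ?_) (fun i => (inv_pos.2 (add_pos hw (hx i))).le)
        fun i => ?_
      · have hpos := add_pos hw (hx i)
        rw [abs_div, div_eq_mul_inv, firstRates, abs_of_pos hpos]
        exact mul_le_of_le_one_left (inv_pos.2 hpos).le (abs_startProb_le_one _ _)
      · refine ((hlim i).div_const (w + x i)).congr fun N => ?_
        split_ifs
        · rfl
        · simp
    have h2 := h1.div ((tendsto_stieltjes hx hs hw).const_mul w)
      (mul_pos hw (stieltjesSeq_pos hx hs hw)).ne'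
    refine h2.congr' ?_
    filter_upwards [eventually_ge_atTop 2] with N hN
    exact (laplace_mean_windowProb (x := firstRates x N) hN (fun i => hx i) (S N) hw).symm
  have hex : ∀ s, 0 < s → ∃ l, Tendsto (fun N => mean (windowProb (firstRates x N) (S N) t s))
      atTop (𝓝 l) := by
    intro s hs0
    refine exists_tendsto_of_laplace (C := 1) (c := 1) one_pos
      (F := fun N s => mean (windowProb (firstRates x N) (S N) t s)) (fun N v _ => hbd N v)
      (fun N => (hm N).aestronglyMeasurable) (fun m => ⟨_, hlap (1 + m) (by positivity)⟩) hs0 ?_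
    intro η hη
    set K := √(2 / s ^ 2 * Real.exp 1 * (1 + t / s)) with hK
    have hK0 : 0 ≤ K := Real.sqrt_nonneg _
    refine ⟨η / (K + 1), by positivity, ?_⟩
    filter_upwards [eventually_ge_atTop 2] with N hN v hv
    refine (abs_mean_windowProb_sub_le (x := firstRates x N) hN (fun i => hx i) (S N) ht hs0
      hv.1).trans ?_
    have h1 : v - s ≤ η / (K + 1) := by linarith [hv.2]
    calc K * (v - s) ≤ K * (η / (K + 1)) := by gcongr
      _ = η * (K / (K + 1)) := by ring
      _ ≤ η * 1 := by
        gcongr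
        rw [div_le_one (by positivity)]
        linarith
      _ = η := mul_one η
  choose! L hL using hex
  have hmeas : AEStronglyMeasurable L (volume.restrict (Set.Ioi 0)) := by
    refine aestronglyMeasurable_of_tendsto_ae atTop
      (f := fun N s => mean (windowProb (firstRates x N) (S N) t s))
      (fun N => (hm N).aestronglyMeasurable) ?_
    filter_upwards [ae_restrict_mem measurableSet_Ioi] with s hs0
    exact hL s hs0
  refine ⟨L, hL, fun s hs0 => ?_, hmeas, fun s v hs0 hv => ?_, fun w hw => ?_⟩
  · exact le_of_tendsto (hL s hs0).abs (Eventually.of_forall fun N => hbd N s)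
  · refine le_of_tendsto ((hL v (hs0.trans_le hv)).sub (hL s hs0)).abs ?_
    filter_upwards [eventually_ge_atTop 2] with N hN
    exact abs_mean_windowProb_sub_le (x := firstRates x N) hN (fun i => hx i) (S N) ht hs0 hv
  · refine tendsto_nhds_unique ?_ (hlap w hw)
    refine tendsto_integral_of_dominated_convergence (fun s => Real.exp (-(w * s))) (fun N => ?_)
      (integrableOn_exp_neg_mul hw) (fun N => ?_) ?_
    · exact (Measurable.mul (by fun_prop) (hm N)).aestronglyMeasurable
    · refine Eventually.of_forall fun s => ?_
      rw [norm_mul, Real.norm_of_nonneg (Real.exp_nonneg _)]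
      exact mul_le_of_le_one_right (Real.exp_nonneg _) (hbd N s)
    · filter_upwards [ae_restrict_mem measurableSet_Ioi] with s hs0
      exact (hL s hs0).const_mul _

/-- In the limit of infinitely many sites, the probability `h t i` that all jumps of the walk from `i`
up to time `t` lead to sites with rate at least `δ`. The number `H` is the Laplace transform of the
probability that a uniformly chosen site has rate at least `δ` and that, from there, all jumps up to
time `t` lead to such sites. -/
lemma exists_tendsto_survProb {δ : ℝ} (hfin : {i | ¬ δ ≤ x i}.Finite) :
    ∃ h : ℝ → ℕ → ℝ,
      (∀ t, 0 < t → ∀ i, Tendsto (fun N => if hi : i < N then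
        survProb (firstRates x N) {i | δ ≤ firstRates x N i} t ⟨i, hi⟩ else 0) atTop
          (𝓝 (h t i))) ∧
      (∀ t, 0 < t → ∀ i, |h t i| ≤ 1) ∧
      (∀ i, AEStronglyMeasurable (fun t => h t i) (volume.restrict (Set.Ioi 0))) ∧
      (∀ i s t, 0 < s → s ≤ t → |h t i - h s i| ≤ min 1 (x i * (t - s))) ∧
      (∀ w, 0 < w → ∀ H, H = (∑' i, {i | δ ≤ x i}.indicator (fun i => (w + x i)⁻¹) i) /
          (hfin.toFinset.card + w * ∑' i, {i | δ ≤ x i}.indicator (fun i => (w + x i)⁻¹) i) →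
        ∀ i, ∫ t in Set.Ioi (0 : ℝ), Real.exp (-(w * t)) * h t i = (1 + x i * H) / (w + x i)) := by
  classical
  set A : Set ℕ := {i | δ ≤ x i} with hA
  set SN : (N : ℕ) → Set (Fin N) := fun N => {i | δ ≤ firstRates x N i} with hSN
  set F : ℕ → ℕ → ℝ → ℝ := fun i N t =>
    if hi : i < N then survProb (firstRates x N) (SN N) t ⟨i, hi⟩ else 0 with hF
  have hF0 : ∀ i N t, 0 ≤ F i N t := fun i N t => by
    simp only [hF]; split_ifs
    exacts [startProb_nonneg _ _, le_rfl]
  have hF1 : ∀ i N t, F i N t ≤ 1 := fun i N t => by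
    simp only [hF]; split_ifs
    exacts [startProb_le_one _ _, zero_le_one]
  have hFb : ∀ i N t, |F i N t| ≤ 1 := fun i N t => by
    rw [abs_of_nonneg (hF0 i N t)]; exact hF1 i N t
  have hFm : ∀ i N, Measurable (F i N) := fun i N => by
    simp only [hF]; split_ifs
    exacts [measurable_survProb _ _, measurable_const]
  have hFlip : ∀ i N, 2 ≤ N → ∀ s t, 0 ≤ s → s ≤ t → |F i N t - F i N s| ≤ x i * (t - s) := by
    intro i N hN s t hs0 hst
    simp only [hF]
    split_ifs with hi
    · exact abs_survProb_sub_le (x := firstRates x N) hN (fun i => hx i) _ hs0 hst ⟨i, hi⟩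
    · simpa using mul_nonneg (hx i).le (sub_nonneg.2 hst)
  have hlap : ∀ w, 0 < w → ∀ i, Tendsto (fun N => ∫ t in Set.Ioi (0 : ℝ), Real.exp (-(w * t)) *
      F i N t) atTop (𝓝 ((1 + x i * ((∑' i, A.indicator (fun i => (w + x i)⁻¹) i) /
          (hfin.toFinset.card + w * ∑' i, A.indicator (fun i => (w + x i)⁻¹) i))) / (w + x i))) := by
    intro w hw i
    set ZS := ∑' i, A.indicator (fun i => (w + x i)⁻¹) i with hZS
    have hnn : ∀ i, 0 ≤ A.indicator (fun i => (w + x i)⁻¹) i := fun i =>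
      Set.indicator_nonneg (fun i _ => (inv_pos.2 (add_pos hw (hx i))).le) i
    have hsumS : Summable (A.indicator fun i => (w + x i)⁻¹) :=
      (summable_inv_add hx hs hw).indicator A
    have hZSt : Tendsto (fun N => ∑ i, (SN N).indicator (fun i => (w + firstRates x N i)⁻¹) i) atTop
        (𝓝 ZS) := by
      refine hsumS.hasSum.tendsto_sum_nat.congr fun N => ?_
      rw [← Fin.sum_univ_eq_sum_range (A.indicator fun i => (w + x i)⁻¹) N]
      rfl
    have hcard : Tendsto (fun N : ℕ => (N : ℝ) - Nat.card (SN N)) atTop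
        (𝓝 (hfin.toFinset.card : ℝ)) := by
      obtain ⟨m, hm⟩ := hfin.bddAbove
      refine tendsto_const_nhds.congr' ?_
      filter_upwards [eventually_gt_atTop m] with N hN
      have h1 : (Finset.univ.filter fun i : Fin N => ¬ i ∈ SN N).card = hfin.toFinset.card := by
        refine Finset.card_bij (fun i _ => (i : ℕ)) ?_ (fun i _ j _ h => Fin.ext h) ?_
        · intro i hi
          simpa [hSN, firstRates] using hi
        · intro j hj
          have hj' : ¬ δ ≤ x j := by simpa using hj
          have hjN : j < N := (hm hj').trans_lt hN
          exact ⟨⟨j, hjN⟩, by simpa [hSN, firstRates] using hj', rfl⟩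
      have h2 : Nat.card (SN N) = (Finset.univ.filter fun i : Fin N => i ∈ SN N).card := by
        rw [Nat.card_eq_fintype_card, Fintype.card_subtype]
      have h3 := Finset.card_filter_add_card_filter_not (s := (Finset.univ : Finset (Fin N)))
        (fun i => i ∈ SN N)
      rw [Finset.card_univ, Fintype.card_fin, h1, ← h2] at h3
      have h4 : ((Nat.card (SN N) : ℝ)) + (hfin.toFinset.card : ℝ) = N := by exact_mod_cast h3
      linarith
    have hZS0 : 0 ≤ ZS := tsum_nonneg hnn
    have hden : 0 < (hfin.toFinset.card : ℝ) + w * ZS := by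
      by_cases h0 : 0 ∈ A
      · have : 0 < ZS := hsumS.tsum_pos hnn 0 (by
          rw [Set.indicator_of_mem h0]; exact inv_pos.2 (add_pos hw (hx 0)))
        positivity
      · have : 0 < hfin.toFinset.card := Finset.card_pos.2 ⟨0, by simpa [hA] using h0⟩
        positivity
    have hdent := hcard.add (hZSt.const_mul w)
    have hHt := hZSt.div hdent hden.ne'
    have hlap' := fun N (hN : 2 ≤ N) =>
      laplace_survProb (x := firstRates x N) hN (fun i => hx i) (SN N) hw
    have hxi := hx i
    by_cases hi : i ∈ A
    · have ht := ((hHt.const_mul (x i)).const_add 1).div_const (w + x i)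
      refine ht.congr' ?_
      filter_upwards [eventually_ge_atTop 2, eventually_gt_atTop i,
        hdent.eventually_ne hden.ne'] with N hN hiN hne
      obtain ⟨H, hH, hin, -⟩ := hlap' N hN
      simp only [hF, dif_pos hiN]
      rw [hin ⟨i, hiN⟩ hi, eq_div_of_mul_eq hne hH]
      rfl
    · have hN0 : Tendsto (fun N : ℕ => w + x i - x i / (N : ℝ)) atTop (𝓝 (w + x i - 0)) :=
        tendsto_const_nhds.sub (tendsto_const_div_atTop_nhds_zero_nat _)
      rw [sub_zero] at hN0
      have ht := ((hHt.const_mul (x i)).const_add 1).div hN0 (by positivity)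
      refine ht.congr' ?_
      filter_upwards [eventually_ge_atTop 2, eventually_gt_atTop i,
        hdent.eventually_ne hden.ne'] with N hN hiN hne
      obtain ⟨H, hH, -, hout⟩ := hlap' N hN
      simp only [hF, dif_pos hiN]
      rw [hout ⟨i, hiN⟩ hi, eq_div_of_mul_eq hne hH]
      rfl
  have hex : ∀ t, 0 < t → ∀ i, ∃ l, Tendsto (fun N => F i N t) atTop (𝓝 l) := by
    intro t ht i
    refine exists_tendsto_of_laplace (C := 1) (c := 1) one_pos (F := F i) (fun N v _ => hFb i N v)
      (fun N => (hFm i N).aestronglyMeasurable)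
      (fun m => ⟨_, hlap (1 + m) (by positivity) i⟩) ht ?_
    intro η hη
    refine ⟨η / x i, div_pos hη (hx i), ?_⟩
    filter_upwards [eventually_ge_atTop 2] with N hN v hv
    refine (hFlip i N hN t v ht.le hv.1).trans ?_
    have h1 : v - t ≤ η / x i := by linarith [hv.2]
    rwa [le_div_iff₀' (hx i)] at h1
  choose! h hh using hex
  refine ⟨h, hh, fun t ht i => ?_, fun i => ?_, fun i s t hs0 hst => ?_, ?_⟩
  · exact le_of_tendsto (hh t ht i).abs (Eventually.of_forall fun N => hFb i N t)
  · refine aestronglyMeasurable_of_tendsto_ae atTop (f := fun N t => F i N t)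
      (fun N => (hFm i N).aestronglyMeasurable) ?_
    filter_upwards [ae_restrict_mem measurableSet_Ioi] with t ht
    exact hh t ht i
  · refine le_of_tendsto ((hh t (hs0.trans_le hst) i).sub (hh s hs0 i)).abs ?_
    filter_upwards [eventually_ge_atTop 2] with N hN
    refine le_min ?_ (hFlip i N hN s t hs0.le hst)
    rw [abs_le]
    constructor <;> linarith [hF0 i N t, hF1 i N t, hF0 i N s, hF1 i N s]
  · rintro w hw H rfl i
    refine tendsto_nhds_unique ?_ (hlap w hw i)
    refine tendsto_integral_of_dominated_convergence (fun s => Real.exp (-(w * s))) (fun N => ?_)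
      (integrableOn_exp_neg_mul hw) (fun N => ?_) ?_
    · exact (Measurable.mul (by fun_prop) (hFm i N)).aestronglyMeasurable
    · refine Eventually.of_forall fun s => ?_
      rw [norm_mul, Real.norm_of_nonneg (Real.exp_nonneg _)]
      exact mul_le_of_le_one_right (Real.exp_nonneg _) (hFb i N s)
    · filter_upwards [ae_restrict_mem measurableSet_Ioi] with s hs0
      exact (hh s hs0 i).const_mul _

omit hs in
/-- In the limit of infinitely many sites, the probability not to jump up to time `t`. -/
lemma tendsto_survProb_empty {t : ℝ} (ht : 0 ≤ t) (i : ℕ) :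
    Tendsto (fun N => if hi : i < N then survProb (firstRates x N) ∅ t ⟨i, hi⟩ else 0) atTop
      (𝓝 (Real.exp (-(x i * t)))) := by
  have h0 : Tendsto (fun N : ℕ => ((N : ℝ) - 1) / N) atTop (𝓝 1) := by
    have h1 : Tendsto (fun N : ℕ => 1 - 1 / (N : ℝ)) atTop (𝓝 (1 - 0)) :=
      tendsto_const_nhds.sub (tendsto_const_div_atTop_nhds_zero_nat 1)
    rw [sub_zero] at h1
    refine h1.congr' ?_
    filter_upwards [eventually_gt_atTop 0] with N hN
    have : (N : ℝ) ≠ 0 := by exact_mod_cast hN.ne'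
    field_simp
  have h1 := (Real.continuous_exp.tendsto _).comp (((h0.const_mul (x i)).mul_const t).neg)
  rw [mul_one] at h1
  refine h1.congr' ?_
  filter_upwards [eventually_gt_atTop i, eventually_ge_atTop 2] with N hi hN
  rw [dif_pos hi, survProb_empty (x := firstRates x N) hN (fun i => hx i) ht]
  rfl

end

end TrapModel

/-! ### Scaling limits for regularly growing rates -/

namespace TrapModel

/-- A strictly increasing sequence of positive numbers whose counting function is asymptotic to
`a ^ α`. Finiteness is a separate field because `Set.ncard` vanishes on infinite sets. -/
structure IsRegular (α : ℝ) (c : ℕ → ℝ) : Prop where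
  pos : ∀ i, 0 < c i
  strictMono : StrictMono c
  finite : ∀ a, {i | c i < a}.Finite
  tendsto : Tendsto (fun a : ℝ => ({i | c i < a}.ncard : ℝ) / a ^ α) atTop (𝓝 1)

namespace IsRegular

variable {α : ℝ} {c : ℕ → ℝ}

/-- The asymptotics of the counting function give a bound for all `a`, since it vanishes for
`a ≤ c 0`. -/
lemma exists_card_le (hα : 0 < α) (h : IsRegular α c) :
    ∃ C, 0 < C ∧ ∀ a, 0 < a → ({i | c i < a}.ncard : ℝ) ≤ C * a ^ α := by
  obtain ⟨A, hA⟩ := eventually_atTop.1 (h.tendsto.eventually_le_const (u := 2) (by norm_num))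
  set B := max A 1 with hB
  have hB0 : 0 < B := lt_max_of_lt_right one_pos
  have hc0 := h.pos 0
  refine ⟨2 + {i | c i < B}.ncard / c 0 ^ α, by positivity, fun a ha => ?_⟩
  have hterm : 0 ≤ ({i | c i < B}.ncard : ℝ) / c 0 ^ α := by positivity
  have hpow : 0 < a ^ α := Real.rpow_pos_of_pos ha α
  rcases le_or_gt B a with hBa | hBa
  · have := hA a ((le_max_left _ _).trans hBa)
    rw [div_le_iff₀ hpow] at this
    nlinarith
  · rcases le_or_gt a (c 0) with h0 | h0
    · have : {i | c i < a} = ∅ := by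
        ext i
        simpa using h0.trans (h.strictMono.monotone (Nat.zero_le i))
      rw [this]
      simp only [Set.ncard_empty, Nat.cast_zero]
      positivity
    · have h1 : ({i | c i < a}.ncard : ℝ) ≤ {i | c i < B}.ncard := by
        exact_mod_cast Set.ncard_le_ncard (fun i (hi : c i < a) => hi.trans hBa) (h.finite B)
      have h2 : 1 ≤ a ^ α / c 0 ^ α := by
        rw [one_le_div (by positivity)]
        exact Real.rpow_le_rpow hc0.le h0.le hα.le
      calc ({i | c i < a}.ncard : ℝ) ≤ {i | c i < B}.ncard * 1 := by rwa [mul_one]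
        _ ≤ {i | c i < B}.ncard * (a ^ α / c 0 ^ α) := by gcongr
        _ ≤ _ := by
          have : 0 ≤ 2 * a ^ α := by positivity
          have e : ({i | c i < B}.ncard : ℝ) * (a ^ α / c 0 ^ α)
            = {i | c i < B}.ncard / c 0 ^ α * a ^ α := by ring
          rw [e, add_mul]
          linarith

lemma summable_inv (hα : 0 < α) (hα1 : α < 1) (h : IsRegular α c) :
    Summable fun i => (c i)⁻¹ := by
  obtain ⟨C, hC, hcard⟩ := h.exists_card_le hα
  have hlow : ∀ i : ℕ, ((i : ℝ) + 1) ≤ C * (2 * c i) ^ α := by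
    intro i
    have hci := h.pos i
    refine le_trans ?_ (hcard (2 * c i) (by positivity))
    have h1 : (Set.Iic i).ncard ≤ {j | c j < 2 * c i}.ncard :=
      Set.ncard_le_ncard (fun j hj => (h.strictMono.monotone hj).trans_lt (by linarith))
        (h.finite _)
    have h2 : (Set.Iic i).ncard = i + 1 := by
      rw [← Finset.coe_Iic, Set.ncard_coe_finset, Nat.card_Iic]
    rw [h2] at h1
    exact_mod_cast h1
  have hs : Summable fun i : ℕ => ((i : ℝ) + 1) ^ (-(1 / α)) := by
    have := (summable_nat_add_iff 1).2 ((Real.summable_nat_rpow (p := -(1 / α))).2 (by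
      rw [neg_lt_neg_iff, one_lt_div hα]; exact hα1))
    simpa using this
  refine Summable.of_nonneg_of_le (fun i => (inv_pos.2 (h.pos i)).le) (fun i => ?_)
    (hs.mul_left (2 * C ^ (1 / α)))
  have hci := h.pos i
  have h1 := Real.rpow_le_rpow (by positivity) (hlow i) (z := 1 / α) (by positivity)
  rw [Real.mul_rpow hC.le (by positivity), ← Real.rpow_mul (by positivity),
    mul_one_div_cancel hα.ne', Real.rpow_one] at h1
  rw [Real.rpow_neg (by positivity), ← div_eq_mul_inv, ← one_div,
    div_le_div_iff₀ hci (by positivity)]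
  linarith

/-- Layer cake formula for the sums over the points `τ * c i` of the function `∫ a in Ioi y, g a`. -/
lemma tsum_eq_integral (hα : 0 < α) (h : IsRegular α c) {g f : ℝ → ℝ} (hg : Measurable g)
    (hg0 : ∀ a, 0 ≤ g a) (hgi : IntegrableOn (fun a => g a * a ^ α) (Set.Ioi 0))
    (hf : ∀ y, 0 < y → f y = ∫ a in Set.Ioi y, g a) {τ : ℝ} (hτ : 0 < τ) :
    HasSum (fun i => f (τ * c i))
      (∫ a in Set.Ioi (0 : ℝ), g a * {i | c i < a / τ}.ncard) := by
  obtain ⟨C, hC, hcard⟩ := h.exists_card_le hα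
  have hτc : ∀ i, 0 < τ * c i := fun i => mul_pos hτ (h.pos i)
  have hgI : ∀ y, 0 < y → IntegrableOn g (Set.Ioi y) := by
    intro y hy
    refine Integrable.mono' ((hgi.mono_set (Set.Ioi_subset_Ioi hy.le)).mul_const (y ^ α)⁻¹)
      hg.aestronglyMeasurable ?_
    filter_upwards [ae_restrict_mem measurableSet_Ioi] with a ha
    have hya : y < a := ha
    rw [Real.norm_of_nonneg (hg0 a), mul_assoc]
    refine le_mul_of_one_le_right (hg0 a) ?_
    rw [← div_eq_mul_inv, one_le_div (by positivity)]
    exact Real.rpow_le_rpow hy.le hya.le hα.le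
  set F : ℕ → ℝ → ℝ := fun i => (Set.Ioi (τ * c i)).indicator g with hF
  have hF0 : ∀ i a, 0 ≤ F i a := fun i a => Set.indicator_nonneg (fun a _ => hg0 a) a
  have hFi : ∀ i, IntegrableOn (F i) (Set.Ioi 0) := fun i =>
    ((integrable_indicator_iff measurableSet_Ioi).2 (hgI _ (hτc i))).integrableOn
  have hFint : ∀ i, ∫ a in Set.Ioi (0 : ℝ), F i a = f (τ * c i) := by
    intro i
    rw [hF, setIntegral_indicator measurableSet_Ioi,
      Set.inter_eq_right.2 (Set.Ioi_subset_Ioi (hτc i).le), hf _ (hτc i)]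
  have hFsum : ∀ a, HasSum (fun i => F i a) (g a * {i | c i < a / τ}.ncard) := by
    intro a
    have hfin := h.finite (a / τ)
    have hmem : ∀ i, i ∈ hfin.toFinset ↔ a ∈ Set.Ioi (τ * c i) := fun i => by
      rw [Set.Finite.mem_toFinset, Set.mem_ofPred_eq, Set.mem_Ioi, lt_div_iff₀' hτ]
    have h1 : HasSum (fun i => F i a) (∑ i ∈ hfin.toFinset, F i a) :=
      hasSum_sum_of_ne_finset_zero fun i hi => Set.indicator_of_notMem (mt (hmem i).2 hi) g
    have h2 : ∑ i ∈ hfin.toFinset, F i a = g a * {i | c i < a / τ}.ncard := by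
      rw [Set.ncard_eq_toFinset_card _ hfin, mul_comm, ← nsmul_eq_mul, ← Finset.sum_const]
      exact Finset.sum_congr rfl fun i hi => Set.indicator_of_mem ((hmem i).1 hi) g
    rwa [h2] at h1
  have hsumm : Summable fun i => ∫ a in Set.Ioi (0 : ℝ), ‖F i a‖ := by
    refine summable_of_sum_le (c := ∫ a in Set.Ioi (0 : ℝ), g a * a ^ α * (C * (τ ^ α)⁻¹))
      (fun i => integral_nonneg fun a => norm_nonneg _) fun u => ?_
    rw [← integral_finsetSum _ fun i _ => (hFi i).norm]
    refine setIntegral_mono_on (integrable_finsetSum _ fun i _ => (hFi i).norm)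
      (hgi.mul_const _) measurableSet_Ioi fun a ha => ?_
    have ha0 : 0 < a := ha
    simp only [Real.norm_of_nonneg (hF0 _ _)]
    refine (sum_le_hasSum u (fun i _ => hF0 i a) (hFsum a)).trans ?_
    rw [mul_assoc]
    refine mul_le_mul_of_nonneg_left ((hcard (a / τ) (by positivity)).trans_eq ?_) (hg0 a)
    rw [Real.div_rpow ha0.le hτ.le]
    ring
  have key := hasSum_integral_of_summable_integral_norm (μ := volume.restrict (Set.Ioi (0 : ℝ)))
    hFi hsumm
  simp only [hFint, fun a => (hFsum a).tsum_eq] at key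
  exact key

lemma rpow_mul_card_le {C : ℝ}
    (hC : ∀ a, 0 < a → ({i | c i < a}.ncard : ℝ) ≤ C * a ^ α) {τ a : ℝ} (hτ : 0 < τ) (ha : 0 < a) :
    τ ^ α * ({i | c i < a / τ}.ncard : ℝ) ≤ C * a ^ α := by
  have h1 := hC (a / τ) (by positivity)
  rw [Real.div_rpow ha.le hτ.le] at h1
  have h2 : 0 < τ ^ α := Real.rpow_pos_of_pos hτ α
  calc _ ≤ τ ^ α * (C * (a ^ α / τ ^ α)) := by gcongr
    _ = _ := by field_simp

lemma tendsto_rpow_mul_card (h : IsRegular α c) {a : ℝ} (ha : 0 < a) :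
    Tendsto (fun τ : ℝ => τ ^ α * ({i | c i < a / τ}.ncard : ℝ)) (𝓝[>] 0) (𝓝 (a ^ α)) := by
  have h0 : Tendsto (fun τ : ℝ => a / τ) (𝓝[>] 0) atTop :=
    (tendsto_inv_nhdsGT_zero (𝕜 := ℝ)).const_mul_atTop ha
  have h1 := (h.tendsto.comp h0).const_mul (a ^ α)
  rw [mul_one] at h1
  refine h1.congr' ?_
  filter_upwards [self_mem_nhdsWithin] with τ hτ
  have hτ0 : 0 < τ := hτ
  simp only [Function.comp]
  rw [Real.div_rpow ha.le hτ0.le]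
  have := Real.rpow_pos_of_pos hτ0 α
  have := Real.rpow_pos_of_pos ha α
  generalize ({i | c i < a / τ}.ncard : ℝ) = n
  field_simp

/-- Scaling limit of the sums over the points `τ * c i`. -/
lemma tendsto_rpow_mul_tsum (hα : 0 < α) (h : IsRegular α c) {g f : ℝ → ℝ} (hg : Measurable g)
    (hg0 : ∀ a, 0 ≤ g a) (hgi : IntegrableOn (fun a => g a * a ^ α) (Set.Ioi 0))
    (hf : ∀ y, 0 < y → f y = ∫ a in Set.Ioi y, g a) :
    Tendsto (fun τ : ℝ => τ ^ α * ∑' i, f (τ * c i)) (𝓝[>] 0)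
      (𝓝 (∫ a in Set.Ioi (0 : ℝ), g a * a ^ α)) := by
  obtain ⟨C, hC, hcard⟩ := h.exists_card_le hα
  have hmono : ∀ τ : ℝ, 0 < τ → Measurable fun a : ℝ => ({i | c i < a / τ}.ncard : ℝ) := by
    intro τ hτ
    refine Monotone.measurable fun a b hab => ?_
    have : ∀ i, c i < a / τ → c i < b / τ := fun i hi => hi.trans_le (by gcongr)
    exact_mod_cast Set.ncard_le_ncard this (h.finite _)
  have key : Tendsto (fun τ : ℝ => ∫ a in Set.Ioi (0 : ℝ),
      g a * (τ ^ α * {i | c i < a / τ}.ncard)) (𝓝[>] 0)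
      (𝓝 (∫ a in Set.Ioi (0 : ℝ), g a * a ^ α)) := by
    refine tendsto_integral_filter_of_dominated_convergence (fun a => g a * a ^ α * C) ?_ ?_
      (hgi.mul_const C) ?_
    · filter_upwards [self_mem_nhdsWithin] with τ hτ
      exact (hg.mul ((hmono τ hτ).const_mul _)).aestronglyMeasurable
    · filter_upwards [self_mem_nhdsWithin] with τ hτ
      filter_upwards [ae_restrict_mem measurableSet_Ioi] with a ha
      have hτ0 : 0 < τ := hτ
      rw [Real.norm_of_nonneg (mul_nonneg (hg0 a) (by positivity)), mul_assoc, mul_comm _ C]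
      exact mul_le_mul_of_nonneg_left (rpow_mul_card_le hcard hτ ha) (hg0 a)
    · filter_upwards [ae_restrict_mem measurableSet_Ioi] with a ha
      exact (h.tendsto_rpow_mul_card ha).const_mul _
  refine key.congr' ?_
  filter_upwards [self_mem_nhdsWithin] with τ hτ
  rw [(h.tsum_eq_integral hα hg hg0 hgi hf hτ).tsum_eq, ← integral_const_mul]
  congr 1
  funext a
  ring

lemma integral_rpow_mul_exp (hα : 0 < α) {r : ℝ} (hr : 0 < r) :
    IntegrableOn (fun a => r * Real.exp (-(r * a)) * a ^ α) (Set.Ioi 0) ∧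
      ∫ a in Set.Ioi (0 : ℝ), r * Real.exp (-(r * a)) * a ^ α = Real.Gamma (α + 1) * r ^ (-α) := by
  have h1 := Real.integral_rpow_mul_exp_neg_mul_Ioi (a := α + 1) (by linarith) hr
  have e : ∀ a : ℝ, r * Real.exp (-(r * a)) * a ^ α
      = r * (a ^ (α + 1 - 1) * Real.exp (-(r * a))) := fun a => by
    rw [add_sub_cancel_right]; ring
  simp_rw [e]
  rw [integral_const_mul, h1]
  refine ⟨Integrable.const_mul ?_ _, ?_⟩
  · have h2 := integrableOn_rpow_mul_exp_neg_mul_rpow (p := 1) (s := α) (b := r) (by linarith)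
      one_pos hr
    simpa [neg_mul, IntegrableOn] using h2
  · rw [one_div, Real.inv_rpow hr.le, Real.rpow_neg hr.le, Real.rpow_add hr, Real.rpow_one]
    have := Real.rpow_pos_of_pos hr α
    field_simp

lemma exp_eq_integral {r : ℝ} (hr : 0 < r) (y : ℝ) :
    Real.exp (-(r * y)) = ∫ a in Set.Ioi y, r * Real.exp (-(r * a)) := by
  have := integral_exp_mul_Ioi (a := -r) (by linarith) y
  simp only [neg_mul] at this
  rw [integral_const_mul, this]
  field_simp

/-- The scaling limit of `∑ i, exp (-(x i * r))` for `x i = τ * c i`. -/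
lemma tendsto_rpow_mul_tsum_exp (hα : 0 < α) (h : IsRegular α c) {r : ℝ} (hr : 0 < r) :
    Tendsto (fun τ : ℝ => τ ^ α * ∑' i, Real.exp (-(r * (τ * c i)))) (𝓝[>] 0)
      (𝓝 (Real.Gamma (α + 1) * r ^ (-α))) := by
  rw [← (integral_rpow_mul_exp hα hr).2]
  exact h.tendsto_rpow_mul_tsum hα (f := fun y => Real.exp (-(r * y)))
    (g := fun a => r * Real.exp (-(r * a))) (by fun_prop)
    (fun a => by positivity) (integral_rpow_mul_exp hα hr).1 fun y _ => exp_eq_integral hr y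

lemma exists_tsum_exp_le (hα : 0 < α) (h : IsRegular α c) :
    ∃ C, 0 < C ∧ ∀ τ r, 0 < τ → 0 < r → Summable (fun i => Real.exp (-(r * (τ * c i)))) ∧
      τ ^ α * ∑' i, Real.exp (-(r * (τ * c i))) ≤ C * r ^ (-α) := by
  obtain ⟨C, hC, hcard⟩ := h.exists_card_le hα
  refine ⟨C * Real.Gamma (α + 1), mul_pos hC (Real.Gamma_pos_of_pos (by linarith)),
    fun τ r hτ hr => ?_⟩
  have h1 := h.tsum_eq_integral hα (f := fun y => Real.exp (-(r * y)))
    (g := fun a => r * Real.exp (-(r * a))) (by fun_prop)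
    (fun a => by positivity) (integral_rpow_mul_exp hα hr).1 (fun y _ => exp_eq_integral hr y) hτ
  refine ⟨h1.summable, ?_⟩
  rw [h1.tsum_eq, mul_assoc, ← (integral_rpow_mul_exp hα hr).2, ← integral_const_mul,
    ← integral_const_mul]
  refine integral_mono_of_nonneg (Eventually.of_forall fun a => by positivity)
    ((integral_rpow_mul_exp hα hr).1.const_mul C) ?_
  filter_upwards [ae_restrict_mem measurableSet_Ioi] with a ha
  have h2 := rpow_mul_card_le hcard hτ ha
  have h3 : 0 ≤ r * Real.exp (-(r * a)) := by positivity
  calc _ = r * Real.exp (-(r * a)) * (τ ^ α * {i | c i < a / τ}.ncard) := by ring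
    _ ≤ r * Real.exp (-(r * a)) * (C * a ^ α) := by gcongr
    _ = _ := by ring

lemma integrableOn_exp_mul_rpow_neg (hα1 : α < 1) {w : ℝ} (hw : 0 < w) :
    IntegrableOn (fun r => Real.exp (-(w * r)) * r ^ (-α)) (Set.Ioi 0) := by
  have h2 := integrableOn_rpow_mul_exp_neg_mul_rpow (p := 1) (s := -α) (b := w) (by linarith)
    one_pos hw
  simpa [neg_mul, mul_comm] using h2

/-- The scaling limit of `∑ i, exp (-(x i * t)) / (w + x i)` for `x i = τ * c i`. -/
lemma tendsto_rpow_mul_tsum_exp_div (hα : 0 < α) (hα1 : α < 1) (h : IsRegular α c) {t w : ℝ}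
    (ht : 0 ≤ t) (hw : 0 < w) :
    Tendsto (fun τ : ℝ => τ ^ α * ∑' i, Real.exp (-(τ * c i * t)) / (w + τ * c i)) (𝓝[>] 0)
      (𝓝 (Real.Gamma (α + 1) * ∫ r in Set.Ioi (0 : ℝ), Real.exp (-(w * r)) * (t + r) ^ (-α))) := by
  obtain ⟨C, hC, hle⟩ := h.exists_tsum_exp_le hα
  have hdom := integrableOn_exp_mul_rpow_neg hα1 hw
  have hbound : ∀ τ r, 0 < τ → 0 < r →
      τ ^ α * ∑' i, Real.exp (-((t + r) * (τ * c i))) ≤ C * r ^ (-α) := by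
    intro τ r hτ hr
    refine (hle τ (t + r) hτ (by linarith)).2.trans ?_
    refine mul_le_mul_of_nonneg_left ?_ hC.le
    exact Real.rpow_le_rpow_of_nonpos hr (by linarith) (by linarith)
  have hmeas : ∀ τ, 0 < τ → AEStronglyMeasurable
      (fun r => ∑' i, Real.exp (-((t + r) * (τ * c i)))) (volume.restrict (Set.Ioi 0)) := by
    intro τ hτ
    refine aestronglyMeasurable_of_tendsto_ae atTop
      (f := fun n r => ∑ i ∈ Finset.range n, Real.exp (-((t + r) * (τ * c i)))) (fun n => ?_) ?_
    · exact Continuous.aestronglyMeasurable (by fun_prop)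
    · filter_upwards [ae_restrict_mem measurableSet_Ioi] with r hr
      have hr0 : 0 < r := hr
      exact (hle τ (t + r) hτ (by linarith)).1.hasSum.tendsto_sum_nat
  have hlap : ∀ τ, 0 < τ → ∑' i, Real.exp (-(τ * c i * t)) / (w + τ * c i)
      = ∫ r in Set.Ioi (0 : ℝ), Real.exp (-(w * r)) * ∑' i, Real.exp (-((t + r) * (τ * c i))) := by
    intro τ hτ
    have hx : ∀ i, 0 < τ * c i := fun i => mul_pos hτ (h.pos i)
    have hsi : Summable fun i => (τ * c i)⁻¹ := by
      simp_rw [mul_inv]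
      exact (h.summable_inv hα hα1).mul_left _
    set F : ℕ → ℝ → ℝ := fun i r => Real.exp (-(τ * c i * t)) * Real.exp (-((w + τ * c i) * r))
      with hF
    have hFi : ∀ i, IntegrableOn (F i) (Set.Ioi 0) := fun i =>
      (integrableOn_exp_neg_mul (add_pos hw (hx i))).const_mul _
    have hFint : ∀ i, ∫ r in Set.Ioi (0 : ℝ), F i r
        = Real.exp (-(τ * c i * t)) / (w + τ * c i) := fun i => by
      rw [hF, integral_const_mul, integral_exp_neg_mul (add_pos hw (hx i)), div_eq_mul_inv]
    have key := (hasSum_integral_of_summable_integral_norm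
      (μ := volume.restrict (Set.Ioi (0 : ℝ))) hFi (by
        have : ∀ i r, ‖F i r‖ = F i r := fun i r => Real.norm_of_nonneg (by positivity)
        simp only [this, hFint]
        refine Summable.of_nonneg_of_le (fun i => ?_) (fun i => ?_) (summable_inv_add hx hsi hw)
        · have := hx i
          positivity
        · rw [div_eq_mul_inv]
          refine mul_le_of_le_one_left (inv_pos.2 (add_pos hw (hx i))).le ?_
          exact Real.exp_le_one_iff.2 (neg_nonpos.2 (mul_nonneg (hx i).le ht)))).tsum_eq
    simp only [hFint] at key
    rw [key]
    refine integral_congr_ae (Eventually.of_forall fun r => ?_)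
    simp only [hF]
    rw [← tsum_mul_left]
    congr 1
    funext i
    rw [← Real.exp_add, ← Real.exp_add]
    ring_nf
  rw [← integral_const_mul]
  have key : Tendsto (fun τ : ℝ => ∫ r in Set.Ioi (0 : ℝ), Real.exp (-(w * r)) *
      (τ ^ α * ∑' i, Real.exp (-((t + r) * (τ * c i))))) (𝓝[>] 0)
      (𝓝 (∫ r in Set.Ioi (0 : ℝ), Real.Gamma (α + 1) *
        (Real.exp (-(w * r)) * (t + r) ^ (-α)))) := by
    refine tendsto_integral_filter_of_dominated_convergence
      (fun r => C * (Real.exp (-(w * r)) * r ^ (-α))) ?_ ?_ (hdom.const_mul C) ?_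
    · filter_upwards [self_mem_nhdsWithin] with τ hτ
      exact AEStronglyMeasurable.mul (Continuous.aestronglyMeasurable (by fun_prop))
        ((hmeas τ hτ).const_mul _)
    · filter_upwards [self_mem_nhdsWithin] with τ hτ
      filter_upwards [ae_restrict_mem measurableSet_Ioi] with r hr
      have hτ0 : 0 < τ := hτ
      have hnn : 0 ≤ ∑' i, Real.exp (-((t + r) * (τ * c i))) :=
        tsum_nonneg fun i => Real.exp_nonneg _
      rw [Real.norm_of_nonneg (by positivity)]
      calc _ ≤ Real.exp (-(w * r)) * (C * r ^ (-α)) :=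
            mul_le_mul_of_nonneg_left (hbound τ r hτ hr) (Real.exp_nonneg _)
        _ = _ := by ring
    · filter_upwards [ae_restrict_mem measurableSet_Ioi] with r hr
      have hr0 : 0 < r := hr
      have h1 := (h.tendsto_rpow_mul_tsum_exp hα (r := t + r) (by linarith)).const_mul
        (Real.exp (-(w * r)))
      rwa [mul_left_comm] at h1
  refine key.congr' ?_
  filter_upwards [self_mem_nhdsWithin] with τ hτ
  rw [hlap τ hτ, ← integral_const_mul]
  congr 1
  funext r
  ring

/-- The constant in the asymptotics of the Stieltjes transform. -/
lemma tendsto_rpow_mul_stieltjesSeq (hα : 0 < α) (hα1 : α < 1) (h : IsRegular α c) {w : ℝ}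
    (hw : 0 < w) :
    Tendsto (fun τ : ℝ => τ ^ α * stieltjesSeq (fun i => τ * c i) w) (𝓝[>] 0)
      (𝓝 (Real.Gamma (α + 1) * (Real.Gamma (1 - α) * w ^ (α - 1)))) := by
  have h1 := h.tendsto_rpow_mul_tsum_exp_div hα hα1 (t := 0) le_rfl hw
  have h2 : ∫ r in Set.Ioi (0 : ℝ), Real.exp (-(w * r)) * (0 + r) ^ (-α)
      = Real.Gamma (1 - α) * w ^ (α - 1) := by
    have h3 := Real.integral_rpow_mul_exp_neg_mul_Ioi (a := 1 - α) (by linarith) hw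
    rw [show (1 : ℝ) - α - 1 = -α by ring, one_div, Real.inv_rpow hw.le,
      ← Real.rpow_neg hw.le, neg_sub] at h3
    rw [mul_comm, ← h3]
    refine integral_congr_ae (Eventually.of_forall fun r => ?_)
    simp only [zero_add]
    ring
  rw [h2] at h1
  simpa [stieltjesSeq] using h1

/-- Scaling limit of the Stieltjes transform restricted to the rates below `δ`. -/
lemma exists_tendsto_rpow_mul_deep (hα : 0 < α) (h : IsRegular α c) {w δ : ℝ} (hw : 0 < w)
    (hδ : 0 < δ) :
    ∃ l, Tendsto (fun τ : ℝ => τ ^ α *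
      ∑' i, {i | ¬ δ ≤ τ * c i}.indicator (fun i => (w + τ * c i)⁻¹) i) (𝓝[>] 0) (𝓝 l) := by
  -- The function `1 / (w + y)` jumps at `δ`. So the layer cake formula is applied to the continuous
  -- function `1 / (w + y) - 1 / (w + δ)` on `y < δ`, and the remainder is a counting function.
  set g : ℝ → ℝ := (Set.Iio δ).indicator fun a => ((w + a) ^ 2)⁻¹ with hg
  set f : ℝ → ℝ := fun y => if y < δ then (w + y)⁻¹ - (w + δ)⁻¹ else 0 with hf
  have hgm : Measurable g := Measurable.indicator (by fun_prop) measurableSet_Iio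
  have hg0 : ∀ a, 0 ≤ g a := fun a => Set.indicator_nonneg (fun a _ => by positivity) a
  have hgi : IntegrableOn (fun a => g a * a ^ α) (Set.Ioi 0) := by
    have : IntegrableOn (fun _ => (w ^ 2)⁻¹ * δ ^ α) (Set.Ioo 0 δ) := integrable_const _
    refine Integrable.mono' (((integrable_indicator_iff measurableSet_Ioo).2 this).integrableOn)
      (by fun_prop) ?_
    filter_upwards [ae_restrict_mem measurableSet_Ioi] with a ha
    have ha0 : 0 < a := ha
    rw [Real.norm_of_nonneg (mul_nonneg (hg0 a) (by positivity))]
    by_cases had : a < δ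
    · rw [Set.indicator_of_mem (show a ∈ Set.Ioo 0 δ from ⟨ha0, had⟩), hg,
        Set.indicator_of_mem (show a ∈ Set.Iio δ from had)]
      gcongr
      linarith
    · rw [hg, Set.indicator_of_notMem (show a ∉ Set.Iio δ from had), zero_mul]
      exact Set.indicator_nonneg (fun a _ => by positivity) a
  have hfg : ∀ y, 0 < y → f y = ∫ a in Set.Ioi y, g a := by
    intro y hy
    rw [hg, setIntegral_indicator measurableSet_Iio, Set.Ioi_inter_Iio]
    change (if y < δ then (w + y)⁻¹ - (w + δ)⁻¹ else 0) = _
    split_ifs with hyd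
    · have hd : ∀ a ∈ Set.uIcc y δ, HasDerivAt (fun a => -(w + a)⁻¹) ((w + a) ^ 2)⁻¹ a := by
        intro a ha
        rw [Set.uIcc_of_le hyd.le] at ha
        have hne : w + a ≠ 0 := by linarith [ha.1]
        convert! (((hasDerivAt_id a).const_add w).inv hne).neg using 1
        simp [div_eq_mul_inv]
      have h1 := intervalIntegral.integral_eq_sub_of_hasDerivAt hd (by
        refine ContinuousOn.intervalIntegrable fun a ha => ?_
        rw [Set.uIcc_of_le hyd.le] at ha
        have hne : (w + a) ^ 2 ≠ 0 := by
          have : 0 < w + a := by linarith [ha.1]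
          positivity
        exact ContinuousAt.continuousWithinAt (by fun_prop (disch := exact hne)))
      rw [intervalIntegral.integral_of_le hyd.le, integral_Ioc_eq_integral_Ioo] at h1
      rw [h1]
      ring
    · rw [Set.Ioo_eq_empty hyd]
      simp
  have h1 := h.tendsto_rpow_mul_tsum hα hgm hg0 hgi hfg
  have h2 := (h.tendsto_rpow_mul_card hδ).mul_const (w + δ)⁻¹
  refine ⟨_, (h1.add h2).congr' ?_⟩
  filter_upwards [self_mem_nhdsWithin] with τ hτ
  have hτ0 : 0 < τ := hτ
  have hfin : {i | ¬ δ ≤ τ * c i}.Finite := by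
    refine (h.finite (δ / τ)).subset fun i hi => ?_
    have : τ * c i < δ := not_le.1 hi
    simpa [lt_div_iff₀' hτ0] using this
  have hset : {i | c i < δ / τ} = {i | ¬ δ ≤ τ * c i} := by
    ext i
    simp [lt_div_iff₀' hτ0]
  have hmem : ∀ i, i ∈ hfin.toFinset ↔ τ * c i < δ := fun i => by simp
  rw [tsum_eq_sum (s := hfin.toFinset) fun i hi => if_neg (mt (hmem i).2 hi),
    tsum_eq_sum (s := hfin.toFinset) fun i hi => Set.indicator_of_notMem (by simpa using hi) _,
    hset, Set.ncard_eq_toFinset_card _ hfin, mul_assoc, ← mul_add, ← nsmul_eq_mul,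
    ← Finset.sum_const, ← Finset.sum_add_distrib]
  congr 1
  refine Finset.sum_congr rfl fun i hi => ?_
  rw [Set.indicator_of_mem (by simpa using hi)]
  simp only [if_pos ((hmem i).1 hi)]
  ring

end IsRegular

end TrapModel

/-! ### Regular growth of the Poisson landscape -/

namespace TrapModel

/-- The variance of the Poisson distribution. -/
lemma hasSum_sq_sub_poisson (r : NNReal) :
    HasSum (fun k : ℕ => Real.exp (-r) * (r : ℝ) ^ k / (k.factorial : ℝ) * ((k : ℝ) - r) ^ 2) r := by
  set p : ℕ → ℝ := fun k => Real.exp (-r) * (r : ℝ) ^ k / (k.factorial : ℝ) with hp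
  have h0 : HasSum p 1 := hasSum_one_poissonMeasure r
  have hstep : ∀ k : ℕ, ((k : ℝ) + 1) * p (k + 1) = r * p k := fun k => by
    have : (k.factorial : ℝ) ≠ 0 := by positivity
    simp only [hp, Nat.factorial_succ, Nat.cast_mul, Nat.cast_add, Nat.cast_one, pow_succ]
    field_simp
  have h1 : HasSum (fun k : ℕ => (k : ℝ) * p k) r := by
    rw [← hasSum_nat_add_iff' 1]
    simpa [hstep] using h0.mul_left (r : ℝ)
  have h2 : HasSum (fun k : ℕ => (k : ℝ) ^ 2 * p k) (r ^ 2 + r) := by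
    rw [← hasSum_nat_add_iff' 1]
    have e : ∀ k : ℕ, ((k : ℝ) + 1) ^ 2 * p (k + 1) = r * (k * p k) + r * p k := fun k => by
      rw [sq, mul_assoc, hstep]; ring
    have h3 := (h1.mul_left (r : ℝ)).add (h0.mul_left (r : ℝ))
    simpa [e, ← sq] using h3
  have h3 := (h2.sub (h1.mul_left (2 * r : ℝ))).add (h0.mul_left ((r : ℝ) ^ 2))
  have e1 : (r : ℝ) ^ 2 + r - 2 * r * r + r ^ 2 * 1 = r := by ring
  rw [e1] at h3
  refine h3.congr_fun fun k => ?_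
  ring

/-- Chebyshev's inequality for the Poisson distribution. -/
lemma poissonMeasure_abs_sub_ge_le (r : NNReal) {a : ℝ} (ha : 0 < a) :
    poissonMeasure r {k : ℕ | a ≤ |(k : ℝ) - r|} ≤ ENNReal.ofReal (r / a ^ 2) := by
  have hint : Integrable (fun k : ℕ => ((k : ℝ) - r) ^ 2) (poissonMeasure r) := by
    rw [integrable_poissonMeasure_iff]
    refine (hasSum_sq_sub_poisson r).summable.congr fun k => ?_
    rw [Real.norm_of_nonneg (sq_nonneg _)]
  have hval : ∫ k, ((k : ℝ) - r) ^ 2 ∂poissonMeasure r = r := by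
    rw [integral_poissonMeasure' hint]
    exact (hasSum_sq_sub_poisson r).tsum_eq
  have h1 := mul_meas_ge_le_integral_of_nonneg (Eventually.of_forall fun k => sq_nonneg _) hint
    (a ^ 2)
  rw [hval, mul_comm, ← le_div_iff₀ (by positivity)] at h1
  rw [← ofReal_measureReal]
  refine ENNReal.ofReal_le_ofReal (le_trans (measureReal_mono fun k hk => ?_) h1)
  have hk' : a ≤ |(k : ℝ) - r| := hk
  change a ^ 2 ≤ ((k : ℝ) - r) ^ 2
  rw [← sq_abs ((k : ℝ) - r)]
  gcongr

lemma landscapeIntensity_Ioi {α : ℝ} (hα : 0 < α) (y : ℝ) :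
    landscapeIntensity α (Set.Ioi y) = ENNReal.ofReal (Real.exp (-(α * y))) := by
  rw [landscapeIntensity, withDensity_apply _ measurableSet_Ioi, IsRegular.exp_eq_integral hα y,
    ofReal_integral_eq_lintegral_ofReal]
  · have := integrableOn_exp_mul_Ioi (a := -α) (by linarith) y
    simpa [neg_mul, IntegrableOn] using this.const_mul α
  · exact Eventually.of_forall fun a => by positivity

lemma sum_dirac_apply (e : ℕ → ℝ) {B : Set ℝ} (hB : MeasurableSet B) :
    (Measure.sum fun i => Measure.dirac (e i)) B = ({i | e i ∈ B}.encard : ENNReal) := by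
  rw [← Measure.count_apply (MeasurableSet.of_discrete), Measure.count,
    Measure.sum_apply _ hB, Measure.sum_apply _ MeasurableSet.of_discrete]
  refine tsum_congr fun i => ?_
  rw [Measure.dirac_apply' _ hB, Measure.dirac_apply' _ MeasurableSet.of_discrete]
  rfl

/-- A monotone function that is asymptotic to `n ^ 4` along the integers is so along the reals. -/
lemma tendsto_div_pow_of_monotone {f : ℝ → ℝ} (hf : Monotone f) (hf0 : ∀ s, 0 ≤ f s)
    (h : Tendsto (fun n : ℕ => f n / (n : ℝ) ^ 4) atTop (𝓝 1)) :
    Tendsto (fun s : ℝ => f s / s ^ 4) atTop (𝓝 1) := by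
  have hq : Tendsto (fun n : ℕ => (n : ℝ) / ((n : ℝ) + 1)) atTop (𝓝 1) :=
    tendsto_natCast_div_add_atTop (1 : ℝ)
  have hlow : Tendsto (fun n : ℕ => f n / ((n : ℝ) + 1) ^ 4) atTop (𝓝 1) := by
    have h1 := h.mul (hq.pow 4)
    rw [one_pow, mul_one] at h1
    refine h1.congr' ?_
    filter_upwards [eventually_gt_atTop 0] with n hn
    have hn0 : (0 : ℝ) < n := by exact_mod_cast hn
    field_simp
  have hup : Tendsto (fun n : ℕ => f (n + 1) / (n : ℝ) ^ 4) atTop (𝓝 1) := by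
    have h0 := h.comp (tendsto_add_atTop_nat 1)
    have h1 := h0.div (hq.pow 4) (by norm_num)
    rw [one_pow, div_one] at h1
    refine h1.congr' ?_
    filter_upwards [eventually_gt_atTop 0] with n hn
    have hn0 : (0 : ℝ) < n := by exact_mod_cast hn
    change f ((n + 1 : ℕ) : ℝ) / ((n + 1 : ℕ) : ℝ) ^ 4 / ((n : ℝ) / ((n : ℝ) + 1)) ^ 4 = _
    rw [Nat.cast_add, Nat.cast_one]
    field_simp
  have hfl : Tendsto (fun s : ℝ => ⌊s⌋₊) atTop atTop := tendsto_nat_floor_atTop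
  refine tendsto_of_tendsto_of_tendsto_of_le_of_le' (hlow.comp hfl) (hup.comp hfl) ?_ ?_
  · filter_upwards [eventually_ge_atTop 1] with s hs
    have h1 := Nat.floor_le (zero_le_one.trans hs)
    have h2 := Nat.lt_floor_add_one s
    simp only [Function.comp]
    gcongr
    · exact hf0 s
    · exact hf h1
  · filter_upwards [eventually_ge_atTop 1] with s hs
    have h1 := Nat.floor_le (zero_le_one.trans hs)
    have h2 := Nat.lt_floor_add_one s
    have h3 : (0 : ℝ) < ⌊s⌋₊ := by exact_mod_cast Nat.floor_pos.2 hs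
    simp only [Function.comp]
    gcongr
    · exact hf0 _
    · exact hf h2.le

/-- Almost surely, the inverse Gibbs weights of the energy landscape have a regularly growing
counting function. -/
theorem IsEnergyLandscape.ae_isRegular {Ω : Type*} [MeasurableSpace Ω] {P : Measure Ω} {α : ℝ}
    (hα : 0 < α) {E : ℕ → Ω → ℝ} (hE : IsEnergyLandscape α E P) :
    ∀ᵐ ω ∂P, IsRegular α fun i => Real.exp (-(E i ω)) := by
  set Ξ : Ω → Measure ℝ := fun ω => Measure.sum fun i => Measure.dirac (E i ω) with hΞ
  -- The thresholds are such that the expected number of points above them is `(n + 1) ^ 4`, and a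
  -- deviation of order `(n + 1) ^ 3` has a summable probability.
  set a : ℕ → ℝ := fun n => (n : ℝ) ^ (4 / α) with ha
  have ha0 : ∀ n, 0 < a (n + 1) := fun n => Real.rpow_pos_of_pos (by positivity) _
  set S : ℕ → Set ENNReal := fun n =>
    (fun k : ℕ => (k : ENNReal)) '' {k : ℕ | ((n : ℝ) + 1) ^ 3 ≤ |(k : ℝ) - ((n : ℝ) + 1) ^ 4|}ᶜ
    with hS
  have hSm : ∀ n, MeasurableSet (S n) := fun n => ((Set.to_countable _).image _).measurableSet
  have hprob : ∀ n, P {ω | Ξ ω (Set.Ioi (-Real.log (a (n + 1)))) ∉ S n}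
      ≤ ENNReal.ofReal (1 / ((n : ℝ) + 1) ^ 2) := by
    intro n
    have hν : landscapeIntensity α (Set.Ioi (-Real.log (a (n + 1))))
        = ENNReal.ofReal (((n : ℝ) + 1) ^ 4) := by
      rw [landscapeIntensity_Ioi hα, mul_neg, neg_neg, mul_comm, ← Real.rpow_def_of_pos (ha0 n)]
      simp only [ha]
      rw [← Real.rpow_mul (by positivity), div_mul_cancel₀ _ hα.ne']
      norm_cast
    have hlaw := hE.poisson.law (Set.Ioi (-Real.log (a (n + 1)))) measurableSet_Ioi
      (by rw [hν]; exact ENNReal.ofReal_ne_top)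
    have hm : Measurable fun ω => Ξ ω (Set.Ioi (-Real.log (a (n + 1)))) :=
      (Measure.measurable_coe measurableSet_Ioi).comp hE.poisson.measurable
    have h1 := congrArg (fun μ => μ (S n)ᶜ) hlaw
    rw [Measure.map_apply hm (hSm n).compl, Measure.map_apply (by fun_prop) (hSm n).compl, hν] at h1
    refine h1.le.trans ?_
    have hr : ((ENNReal.ofReal (((n : ℝ) + 1) ^ 4)).toNNReal : ℝ) = ((n : ℝ) + 1) ^ 4 :=
      ENNReal.toReal_ofReal (by positivity)
    have h2 := poissonMeasure_abs_sub_ge_le (ENNReal.ofReal (((n : ℝ) + 1) ^ 4)).toNNReal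
      (a := ((n : ℝ) + 1) ^ 3) (by positivity)
    rw [hr] at h2
    refine (measure_mono fun k hk => ?_).trans (h2.trans_eq ?_)
    · by_contra hk'
      exact hk ⟨k, hk', rfl⟩
    · congr 1
      field_simp
  have hbc := ae_eventually_notMem (μ := P)
    (s := fun n => {ω | Ξ ω (Set.Ioi (-Real.log (a (n + 1)))) ∉ S n}) (by
      refine ne_top_of_le_ne_top ?_ (ENNReal.tsum_le_tsum hprob)
      have hs : Summable fun n : ℕ => 1 / ((n : ℝ) + 1) ^ 2 := by
        have := (summable_nat_add_iff 1).2 (Real.summable_one_div_nat_pow.2 one_lt_two)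
        simpa using this
      rw [← ENNReal.ofReal_tsum_of_nonneg (fun n => by positivity) hs]
      exact ENNReal.ofReal_ne_top)
  filter_upwards [hbc, hE.decreasing] with ω hω hdec
  have hset : ∀ b, 0 < b → {i | E i ω ∈ Set.Ioi (-Real.log b)}
      = {i | Real.exp (-(E i ω)) < b} := by
    intro b hb
    ext i
    simp only [Set.mem_Ioi, Set.mem_ofPred_eq]
    rw [neg_lt, Real.lt_log_iff_exp_lt hb]
  obtain ⟨n₀, hn₀⟩ := eventually_atTop.1 hω
  have hcount : ∀ n, n₀ ≤ n → {i | Real.exp (-(E i ω)) < a (n + 1)}.Finite ∧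
      |({i | Real.exp (-(E i ω)) < a (n + 1)}.ncard : ℝ) - ((n : ℝ) + 1) ^ 4| ≤ ((n : ℝ) + 1) ^ 3 := by
    intro n hn
    have h1 := hn₀ n hn
    simp only [not_not, hΞ] at h1
    rw [sum_dirac_apply _ measurableSet_Ioi, hset _ (ha0 n)] at h1
    obtain ⟨k, hk, hke⟩ := h1
    have hke' : {i | Real.exp (-(E i ω)) < a (n + 1)}.encard = (k : ℕ∞) := by
      have : ((k : ℕ∞) : ENNReal) = _ := (ENat.toENNReal_coe k).trans hke
      exact (ENat.toENNReal_inj.1 this).symm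
    refine ⟨Set.finite_of_encard_eq_coe hke', ?_⟩
    rw [Set.ncard, hke', ENat.toNat_natCast]
    exact le_of_lt (not_le.1 fun h => hk h)
  have hatop : Tendsto (fun n : ℕ => a (n + 1)) atTop atTop :=
    ((tendsto_rpow_atTop (by positivity : 0 < 4 / α)).comp tendsto_natCast_atTop_atTop).comp
      (tendsto_add_atTop_nat 1)
  have hfin : ∀ b, {i | Real.exp (-(E i ω)) < b}.Finite := by
    intro b
    obtain ⟨n, hn, hbn⟩ := ((eventually_ge_atTop n₀).and (hatop.eventually_ge_atTop b)).exists
    exact (hcount n hn).1.subset fun i hi => lt_of_lt_of_le hi hbn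
  refine ⟨fun i => Real.exp_pos _, fun i j hij => Real.exp_lt_exp.2 (neg_lt_neg (hdec hij)),
    hfin, ?_⟩
  set K : ℝ → ℝ := fun b => ({i | Real.exp (-(E i ω)) < b}.ncard : ℝ) with hK
  have hKm : Monotone K := fun b b' hbb => by
    simp only [hK]
    exact_mod_cast Set.ncard_le_ncard (fun i hi => lt_of_lt_of_le hi hbb) (hfin b')
  have hKt : Tendsto (fun s : ℝ => K ((max s 0) ^ (4 / α)) / s ^ 4) atTop (𝓝 1) := by
    refine tendsto_div_pow_of_monotone (f := fun s => K ((max s 0) ^ (4 / α)))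
      (fun s s' hss => hKm (Real.rpow_le_rpow (le_max_right _ _) (max_le_max_right 0 hss)
        (by positivity))) (fun s => Nat.cast_nonneg _) ?_
    rw [← tendsto_add_atTop_iff_nat 1, ← tendsto_sub_nhds_zero_iff]
    refine squeeze_zero_norm' (a := fun n : ℕ => 1 / ((n : ℝ) + 1)) ?_
      tendsto_one_div_add_atTop_nhds_zero_nat
    filter_upwards [eventually_ge_atTop n₀] with n hn
    have h1 := (hcount n hn).2
    have hn0 : (0 : ℝ) < (n : ℝ) + 1 := by positivity
    have e1 : K (max ((n + 1 : ℕ) : ℝ) 0 ^ (4 / α))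
        = ({i | Real.exp (-(E i ω)) < a (n + 1)}.ncard : ℝ) := by
      rw [max_eq_left (by positivity)]
    rw [e1, Nat.cast_add, Nat.cast_one, div_sub_one (by positivity), norm_div, Real.norm_eq_abs,
      Real.norm_of_nonneg (by positivity : (0 : ℝ) ≤ ((n : ℝ) + 1) ^ 4),
      div_le_div_iff₀ (by positivity) hn0]
    calc _ ≤ ((n : ℝ) + 1) ^ 3 * ((n : ℝ) + 1) := by gcongr
      _ = _ := by ring
  refine (hKt.comp (tendsto_rpow_atTop (by positivity : 0 < α / 4))).congr' ?_
  filter_upwards [eventually_gt_atTop 0] with b hb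
  simp only [Function.comp]
  rw [max_eq_left (by positivity), ← Real.rpow_mul hb.le, ← Real.rpow_natCast,
    ← Real.rpow_mul hb.le, show α / 4 * (4 / α) = 1 by field_simp, Real.rpow_one,
    show α / 4 * ((4 : ℕ) : ℝ) = α by push_cast; ring]

end TrapModel

/-! ### The ageing function -/

namespace TrapModel

section Ageing

variable {α : ℝ}

lemma intervalIntegrable_ageing (hα : 0 < α) (hα1 : α < 1) :
    IntervalIntegrable (fun u : ℝ => u ^ (-α) * (1 - u) ^ (α - 1)) volume 0 1 := by
  have h := (Complex.betaIntegral_convergent (u := ((1 - α : ℝ) : ℂ)) (v := (α : ℂ))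
    (by simpa using hα1) (by simpa using hα)).norm
  refine h.congr_uIoo fun u hu => ?_
  rw [Set.uIoo_of_le zero_le_one] at hu
  have h1 : (1 : ℂ) - (u : ℂ) = ((1 - u : ℝ) : ℂ) := by push_cast; rfl
  simp only [norm_mul]
  rw [h1, Complex.norm_cpow_eq_rpow_re_of_pos hu.1,
    Complex.norm_cpow_eq_rpow_re_of_pos (by linarith [hu.2])]
  simp

lemma continuousOn_ageing (hα : 0 < α) (hα1 : α < 1) {t : ℝ} (ht : 0 < t) :
    ContinuousOn (fun s => ageing α (t / s)) (Set.Ioi 0) := by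
  have h1 : ContinuousOn (fun b : ℝ => ∫ u in b..1, u ^ (-α) * (1 - u) ^ (α - 1)) (Set.Icc 0 1) := by
    have := intervalIntegral.continuousOn_primitive_interval_left (μ := volume) (a := 0) (b := 1)
      (f := fun u : ℝ => u ^ (-α) * (1 - u) ^ (α - 1)) (by
        rw [Set.uIcc_of_le zero_le_one, integrableOn_Icc_iff_integrableOn_Ioc]
        exact (intervalIntegrable_iff_integrableOn_Ioc_of_le zero_le_one).1
          (intervalIntegrable_ageing hα hα1))
    rwa [Set.uIcc_of_le zero_le_one] at this
  have h2 : ContinuousOn (fun s : ℝ => t / s / (1 + t / s)) (Set.Ioi 0) := by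
    intro s hs
    have hs0 : (0 : ℝ) < s := hs
    refine ContinuousAt.continuousWithinAt ?_
    have h3 : ContinuousAt (fun s : ℝ => t / s) s := continuousAt_const.div continuousAt_id hs0.ne'
    exact h3.div (continuousAt_const.add h3) (by positivity)
  refine (h1.comp h2 fun s hs => ?_).const_mul _
  have hs0 : (0 : ℝ) < s := hs
  refine ⟨by positivity, ?_⟩
  rw [div_le_one (by positivity)]
  linarith

lemma abs_ageing_le (hα : 0 < α) (hα1 : α < 1) {θ : ℝ} (hθ : 0 < θ) : |ageing α θ| ≤
    |Real.sin (Real.pi * α) / Real.pi| * ∫ u in (0 : ℝ)..1, u ^ (-α) * (1 - u) ^ (α - 1) := by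
  have h0 : 0 < θ / (1 + θ) := by positivity
  have h1 : θ / (1 + θ) ≤ 1 := by
    rw [div_le_one (by positivity)]
    linarith
  have hnn : ∀ u ∈ Set.Icc (0 : ℝ) 1, 0 ≤ u ^ (-α) * (1 - u) ^ (α - 1) := fun u hu =>
    mul_nonneg (Real.rpow_nonneg hu.1 _) (Real.rpow_nonneg (by linarith [hu.2]) _)
  have hii := intervalIntegrable_ageing hα hα1
  rw [ageing, abs_mul, abs_of_nonneg (intervalIntegral.integral_nonneg h1 fun u hu =>
    hnn u ⟨h0.le.trans hu.1, hu.2⟩)]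
  refine mul_le_mul_of_nonneg_left ?_ (abs_nonneg _)
  rw [intervalIntegral.integral_of_le h1, intervalIntegral.integral_of_le zero_le_one]
  refine setIntegral_mono_set ((intervalIntegrable_iff_integrableOn_Ioc_of_le zero_le_one).1 hii) ?_
    (Set.Ioc_subset_Ioc_left h0.le).eventuallyLE
  filter_upwards [ae_restrict_mem measurableSet_Ioc] with u hu
  exact hnn u ⟨hu.1.le, hu.2⟩

/-- The ageing function as a convolution of power functions. -/
lemma ageing_eq_convolution {t s : ℝ} (ht : 0 < t) (hs : 0 < s) :
    ageing α (t / s) = Real.sin (Real.pi * α) / Real.pi *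
      ∫ v in (0 : ℝ)..s, v ^ (α - 1) * (t + (s - v)) ^ (-α) := by
  have hts : 0 < t + s := by linarith
  have e1 : t / s / (1 + t / s) = 1 - s / (t + s) := by
    field_simp
    ring
  rw [ageing, e1]
  congr 1
  have h1 := intervalIntegral.integral_comp_sub_div
    (f := fun u : ℝ => u ^ (-α) * (1 - u) ^ (α - 1)) (a := 0) (b := s) hts.ne' 1
  rw [zero_div, sub_zero, smul_eq_mul] at h1
  rw [← mul_right_inj' hts.ne', ← h1, ← intervalIntegral.integral_const_mul]
  refine intervalIntegral.integral_congr fun v hv => ?_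
  rw [Set.uIcc_of_le hs.le] at hv
  have hv0 : 0 ≤ v := hv.1
  have hv1 : 0 < t + (s - v) := by linarith [hv.2]
  have e2 : 1 - v / (t + s) = (t + (s - v)) / (t + s) := by
    field_simp
    ring
  have e3 : (t + s) ^ (-α) * (t + s) ^ (α - 1) = (t + s)⁻¹ := by
    rw [← Real.rpow_add hts, show -α + (α - 1) = -1 by ring, Real.rpow_neg_one]
  rw [e2, show 1 - (t + (s - v)) / (t + s) = v / (t + s) by field_simp; ring,
    Real.div_rpow hv1.le hts.le, Real.div_rpow hv0 hts.le, div_mul_div_comm, e3]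
  field_simp

lemma sin_div_pi_eq (α : ℝ) :
    Real.sin (Real.pi * α) / Real.pi = (Real.Gamma α * Real.Gamma (1 - α))⁻¹ := by
  rw [Real.Gamma_mul_Gamma_one_sub, inv_div]

/-- The Laplace transform in the waiting time of the ageing function. -/
lemma laplace_ageing (hα : 0 < α) (hα1 : α < 1) {t w : ℝ} (ht : 0 < t) (hw : 0 < w) :
    ∫ s in Set.Ioi (0 : ℝ), Real.exp (-(w * s)) * ageing α (t / s)
      = (Real.Gamma (α + 1) * ∫ r in Set.Ioi (0 : ℝ), Real.exp (-(w * r)) * (t + r) ^ (-α)) /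
        (w * (Real.Gamma (α + 1) * (Real.Gamma (1 - α) * w ^ (α - 1)))) := by
  have hΓ := Real.Gamma_pos_of_pos hα
  have hΓ1 := Real.Gamma_pos_of_pos (show 0 < 1 - α by linarith)
  have hΓ2 := Real.Gamma_pos_of_pos (show 0 < α + 1 by linarith)
  have hf : IntegrableOn (fun v => Real.exp (-(w * v)) * v ^ (α - 1)) (Set.Ioi 0) := by
    have := IsRegular.integrableOn_exp_mul_rpow_neg (α := 1 - α) (by linarith) hw
    simpa [neg_sub] using this
  have hfv : ∫ v in Set.Ioi (0 : ℝ), Real.exp (-(w * v)) * v ^ (α - 1)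
      = Real.Gamma α * w ^ (-α) := by
    have h3 := Real.integral_rpow_mul_exp_neg_mul_Ioi hα hw
    rw [one_div, Real.inv_rpow hw.le, ← Real.rpow_neg hw.le] at h3
    rw [mul_comm, ← h3]
    exact integral_congr_ae (Eventually.of_forall fun r => mul_comm _ _)
  have hg : IntegrableOn (fun r => Real.exp (-(w * r)) * (t + r) ^ (-α)) (Set.Ioi 0) := by
    refine Integrable.mono' (IsRegular.integrableOn_exp_mul_rpow_neg hα1 hw)
      (Measurable.aestronglyMeasurable (by fun_prop)) ?_
    filter_upwards [ae_restrict_mem measurableSet_Ioi] with r hr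
    have hr0 : 0 < r := hr
    rw [Real.norm_of_nonneg (by positivity)]
    refine mul_le_mul_of_nonneg_left ?_ (Real.exp_nonneg _)
    exact Real.rpow_le_rpow_of_nonpos hr0 (by linarith) (by linarith)
  have hconv := integral_posConvolution hf hg (ContinuousLinearMap.mul ℝ ℝ)
  simp only [ContinuousLinearMap.mul_apply'] at hconv
  have e1 : ∫ s in Set.Ioi (0 : ℝ), Real.exp (-(w * s)) * ageing α (t / s)
      = (Real.Gamma α * Real.Gamma (1 - α))⁻¹ * ∫ s in Set.Ioi (0 : ℝ), ∫ v in (0 : ℝ)..s,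
        Real.exp (-(w * v)) * v ^ (α - 1) * (Real.exp (-(w * (s - v))) * (t + (s - v)) ^ (-α)) := by
    rw [← integral_const_mul]
    refine setIntegral_congr_fun measurableSet_Ioi fun s hs => ?_
    rw [ageing_eq_convolution ht hs, sin_div_pi_eq, mul_left_comm,
      ← intervalIntegral.integral_const_mul]
    congr 2
    funext v
    have : Real.exp (-(w * s)) = Real.exp (-(w * v)) * Real.exp (-(w * (s - v))) := by
      rw [← Real.exp_add]; ring_nf
    rw [this]
    ring
  have hpow := Real.rpow_pos_of_pos hw α
  rw [e1, hconv, hfv, Real.rpow_neg hw.le, Real.rpow_sub hw, Real.rpow_one]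
  field_simp

end Ageing

end TrapModel

/-! ### The limit of a vanishing time unit -/

namespace TrapModel

section Resolvent

variable {x : ℕ → ℝ} (hx : ∀ i, 0 < x i) (hs : Summable fun i => (x i)⁻¹)
include hx hs

lemma hasSum_inv_mul_inv {w l : ℝ} (hw : 0 < w) (hl : 0 < l) (hne : l ≠ w) :
    HasSum (fun i => 1 / (l + x i) / (w + x i)) ((stieltjesSeq x w - stieltjesSeq x l) / (l - w)) := by
  have h1 := ((summable_inv_add hx hs hw).hasSum.sub (summable_inv_add hx hs hl).hasSum).div_const
    (l - w)
  refine h1.congr_fun fun i => ?_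
  have := hx i
  have h2 : w + x i ≠ 0 := by positivity
  have h3 : l + x i ≠ 0 := by positivity
  have h4 : l - w ≠ 0 := sub_ne_zero.2 hne
  field_simp
  ring

lemma hasSum_div_mul_inv {w l : ℝ} (hw : 0 < w) (hl : 0 < l) (hne : l ≠ w) :
    HasSum (fun i => x i / (l + x i) / (w + x i))
      ((l * stieltjesSeq x l - w * stieltjesSeq x w) / (l - w)) := by
  have h1 := (((summable_inv_add hx hs hl).hasSum.mul_left l).sub
    ((summable_inv_add hx hs hw).hasSum.mul_left w)).div_const (l - w)
  refine h1.congr_fun fun i => ?_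
  have := hx i
  have h2 : w + x i ≠ 0 := by positivity
  have h3 : l + x i ≠ 0 := by positivity
  have h4 : l - w ≠ 0 := sub_ne_zero.2 hne
  field_simp
  ring

lemma hasSum_resolvent {w l : ℝ} (hw : 0 < w) (hl : 0 < l) (hne : l ≠ w) (H : ℝ) :
    HasSum (fun i => (1 + x i * H) / (l + x i) / (w + x i))
      ((stieltjesSeq x w - stieltjesSeq x l +
        H * (l * stieltjesSeq x l - w * stieltjesSeq x w)) / (l - w)) := by
  have h1 := (hasSum_inv_mul_inv hx hs hw hl hne).add
    ((hasSum_div_mul_inv hx hs hw hl hne).mul_left H)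
  rw [← mul_div_assoc, ← add_div] at h1
  refine h1.congr_fun fun i => ?_
  ring

lemma summable_div_of_bounded {h : ℕ → ℝ} (hh : ∀ i, |h i| ≤ 1) {w : ℝ} (hw : 0 < w) :
    Summable fun i => h i / (w + x i) := by
  refine Summable.of_norm_bounded (g := fun i => (w + x i)⁻¹) (summable_inv_add hx hs hw)
    fun i => ?_
  have := hx i
  rw [norm_div, Real.norm_eq_abs, Real.norm_of_nonneg (by positivity : 0 ≤ w + x i), div_eq_mul_inv]
  exact mul_le_of_le_one_left (by positivity) (hh i)

omit hs in
lemma abs_tsum_div_le {h b : ℕ → ℝ} (hh : ∀ i, |h i| ≤ b i) {w : ℝ} (hw : 0 < w)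
    (hb : Summable fun i => b i / (w + x i)) :
    |∑' i, h i / (w + x i)| ≤ ∑' i, b i / (w + x i) := by
  rw [← Real.norm_eq_abs]
  refine tsum_of_norm_bounded hb.hasSum fun i => ?_
  have := hx i
  rw [norm_div, Real.norm_eq_abs, Real.norm_of_nonneg (by positivity : 0 ≤ w + x i)]
  gcongr
  exact hh i

lemma aestronglyMeasurable_tsum_div {h : ℝ → ℕ → ℝ} (hh : ∀ t, 0 < t → ∀ i, |h t i| ≤ 1)
    (hm : ∀ i, AEStronglyMeasurable (fun t => h t i) (volume.restrict (Set.Ioi 0)))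
    {w : ℝ} (hw : 0 < w) :
    AEStronglyMeasurable (fun t => ∑' i, h t i / (w + x i)) (volume.restrict (Set.Ioi 0)) := by
  refine aestronglyMeasurable_of_tendsto_ae atTop
    (f := fun n t => ∑ i ∈ Finset.range n, h t i / (w + x i)) (fun n => ?_) ?_
  · refine Finset.aestronglyMeasurable_fun_sum _ fun i _ => ?_
    simp only [div_eq_mul_inv]
    exact (hm i).mul_const _
  · filter_upwards [ae_restrict_mem measurableSet_Ioi] with t ht
    exact (summable_div_of_bounded hx hs (hh t ht) hw).hasSum.tendsto_sum_nat

lemma laplace_tsum_div {h : ℝ → ℕ → ℝ} (hh : ∀ t, 0 < t → ∀ i, |h t i| ≤ 1)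
    (hm : ∀ i, AEStronglyMeasurable (fun t => h t i) (volume.restrict (Set.Ioi 0)))
    {w l : ℝ} (hw : 0 < w) (hl : 0 < l) :
    ∫ t in Set.Ioi (0 : ℝ), Real.exp (-(l * t)) * ∑' i, h t i / (w + x i)
      = ∑' i, (∫ t in Set.Ioi (0 : ℝ), Real.exp (-(l * t)) * h t i) / (w + x i) := by
  have hint : ∀ i, IntegrableOn (fun t => Real.exp (-(l * t)) * (h t i / (w + x i))) (Set.Ioi 0) := by
    intro i
    have h1 := (integrableOn_exp_mul_of_bounded hl (fun t ht => hh t ht i) (hm i)).div_const (w + x i)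
    simpa only [mul_div_assoc, IntegrableOn] using h1
  have h2 := (hasSum_integral_of_summable_integral_norm (μ := volume.restrict (Set.Ioi (0 : ℝ))) hint
    (by
      refine Summable.of_nonneg_of_le (fun i => integral_nonneg fun t => norm_nonneg _) (fun i => ?_)
        ((summable_inv_add hx hs hw).mul_left l⁻¹)
      have hxi := hx i
      rw [← integral_exp_neg_mul hl, ← integral_mul_const]
      refine setIntegral_mono_on (hint i).norm ((integrableOn_exp_neg_mul hl).mul_const _)
        measurableSet_Ioi fun t ht => ?_
      rw [norm_mul, norm_div, Real.norm_of_nonneg (Real.exp_nonneg _),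
        Real.norm_of_nonneg (by positivity : 0 ≤ w + x i), Real.norm_eq_abs, div_eq_mul_inv]
      exact mul_le_mul_of_nonneg_left (mul_le_of_le_one_left (by positivity) (hh t ht i))
        (Real.exp_nonneg _))).tsum_eq
  simp only [← mul_div_assoc, integral_div] at h2
  rw [h2]
  refine integral_congr_ae (Eventually.of_forall fun t => ?_)
  simp only
  rw [← tsum_mul_left]
  simp only [mul_div_assoc]

end Resolvent

/-- With `k = 1 / e`, this bounds the modulus of continuity by a resolvent, whose sum over the sites is
a difference of Stieltjes transforms. -/
lemma min_one_mul_le {y e : ℝ} (hy : 0 < y) (he : 0 < e) :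
    min 1 (y * e) ≤ 2 * (y / (1 / e + y)) := by
  have h1 : y / (1 / e + y) = y * e / (1 + y * e) := by field_simp
  have h2 : 0 < y * e := by positivity
  rw [h1, ← mul_div_assoc, le_div_iff₀ (by positivity)]
  rcases le_total 1 (y * e) with h | h
  · rw [min_eq_left h]; linarith
  · rw [min_eq_right h]; nlinarith

namespace IsRegular

variable {α : ℝ} {c : ℕ → ℝ}

/-- The constant in the asymptotics of the Stieltjes transform of a regular sequence. -/
noncomputable def stieltjesLim (α w : ℝ) : ℝ :=
  Real.Gamma (α + 1) * (Real.Gamma (1 - α) * w ^ (α - 1))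

lemma stieltjesLim_pos (hα : 0 < α) (hα1 : α < 1) {w : ℝ} (hw : 0 < w) : 0 < stieltjesLim α w :=
  mul_pos (Real.Gamma_pos_of_pos (by linarith))
    (mul_pos (Real.Gamma_pos_of_pos (by linarith)) (Real.rpow_pos_of_pos hw _))

lemma summable_inv_const_mul (hα : 0 < α) (hα1 : α < 1) (h : IsRegular α c) (τ : ℝ) :
    Summable fun i => (τ * c i)⁻¹ := by
  simp_rw [mul_inv]
  exact (h.summable_inv hα hα1).mul_left _

lemma tendsto_exp_mul_stieltjesSeq (hα : 0 < α) (hα1 : α < 1) (h : IsRegular α c) {w : ℝ}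
    (hw : 0 < w) :
    Tendsto (fun E₀ : ℝ => Real.exp E₀ ^ α * stieltjesSeq (fun i => Real.exp E₀ * c i) w) atBot
      (𝓝 (stieltjesLim α w)) :=
  (h.tendsto_rpow_mul_stieltjesSeq hα hα1 hw).comp Real.tendsto_exp_atBot_nhdsGT

lemma tendsto_stieltjesSeq_div (hα : 0 < α) (hα1 : α < 1) (h : IsRegular α c) {w v : ℝ}
    (hw : 0 < w) (hv : 0 < v) :
    Tendsto (fun E₀ : ℝ => stieltjesSeq (fun i => Real.exp E₀ * c i) w /
      stieltjesSeq (fun i => Real.exp E₀ * c i) v) atBot (𝓝 ((w / v) ^ (α - 1))) := by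
  have h1 := (h.tendsto_exp_mul_stieltjesSeq hα hα1 hw).div
    (h.tendsto_exp_mul_stieltjesSeq hα hα1 hv) (stieltjesLim_pos hα hα1 hv).ne'
  have h2 : stieltjesLim α w / stieltjesLim α v = (w / v) ^ (α - 1) := by
    have hΓ1 := Real.Gamma_pos_of_pos (show 0 < 1 - α by linarith)
    have hΓ2 := Real.Gamma_pos_of_pos (show 0 < α + 1 by linarith)
    have := Real.rpow_pos_of_pos hv (α - 1)
    rw [stieltjesLim, stieltjesLim, Real.div_rpow hw.le hv.le]
    field_simp
  rw [h2] at h1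
  refine h1.congr fun E₀ => ?_
  exact mul_div_mul_left _ _ (Real.rpow_pos_of_pos (Real.exp_pos _) _).ne'

lemma finite_not_le (h : IsRegular α c) (δ E₀ : ℝ) : {i | ¬ δ ≤ Real.exp E₀ * c i}.Finite := by
  refine (h.finite (δ / Real.exp E₀)).subset fun i hi => ?_
  have : Real.exp E₀ * c i < δ := not_le.1 hi
  simpa [lt_div_iff₀' (Real.exp_pos E₀)] using this

/-- Scaling limit of the number `H` in `exists_tendsto_survProb`. -/
lemma exists_tendsto_hitting (hα : 0 < α) (hα1 : α < 1) (h : IsRegular α c) {δ l : ℝ} (hδ : 0 < δ)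
    (hl : 0 < l) :
    ∃ H, Tendsto (fun E₀ : ℝ =>
      (∑' i, {i | δ ≤ Real.exp E₀ * c i}.indicator (fun i => (l + Real.exp E₀ * c i)⁻¹) i) /
      ((h.finite_not_le δ E₀).toFinset.card +
        l * ∑' i, {i | δ ≤ Real.exp E₀ * c i}.indicator (fun i => (l + Real.exp E₀ * c i)⁻¹) i))
      atBot (𝓝 H) := by
  obtain ⟨d, hd⟩ := h.exists_tendsto_rpow_mul_deep hα hl hδ
  have hd' := hd.comp Real.tendsto_exp_atBot_nhdsGT
  have hcard := (h.tendsto_rpow_mul_card hδ).comp Real.tendsto_exp_atBot_nhdsGT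
  have hZ := h.tendsto_exp_mul_stieltjesSeq hα hα1 hl
  have hS : Tendsto (fun E₀ : ℝ => Real.exp E₀ ^ α *
      ∑' i, {i | δ ≤ Real.exp E₀ * c i}.indicator (fun i => (l + Real.exp E₀ * c i)⁻¹) i) atBot
      (𝓝 (stieltjesLim α l - d)) := by
    refine (hZ.sub hd').congr fun E₀ => ?_
    simp only [Function.comp]
    rw [← mul_sub]
    congr 1
    have hsum := summable_inv_add (fun i => mul_pos (Real.exp_pos E₀) (h.pos i))
      (h.summable_inv_const_mul hα hα1 (Real.exp E₀)) hl
    have h1 : ∀ i, (l + Real.exp E₀ * c i)⁻¹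
        = {i | δ ≤ Real.exp E₀ * c i}.indicator (fun i => (l + Real.exp E₀ * c i)⁻¹) i +
          {i | ¬ δ ≤ Real.exp E₀ * c i}.indicator (fun i => (l + Real.exp E₀ * c i)⁻¹) i := by
      intro i
      by_cases hi : δ ≤ Real.exp E₀ * c i
      · simp [Set.indicator, hi]
      · simp [Set.indicator, hi]
    rw [sub_eq_iff_eq_add, stieltjesSeq,
      ← Summable.tsum_add (hsum.indicator _) (hsum.indicator _)]
    exact tsum_congr h1
  have hnn : 0 ≤ stieltjesLim α l - d := by
    refine ge_of_tendsto' hS fun E₀ => mul_nonneg (Real.rpow_nonneg (Real.exp_nonneg _) _)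
      (tsum_nonneg fun i => Set.indicator_nonneg (fun i _ => ?_) i)
    have := h.pos i
    positivity
  have hpos : 0 < δ ^ α + l * (stieltjesLim α l - d) :=
    add_pos_of_pos_of_nonneg (Real.rpow_pos_of_pos hδ α) (mul_nonneg hl.le hnn)
  refine ⟨_, (hS.div (hcard.add (hS.const_mul l)) hpos.ne').congr fun E₀ => ?_⟩
  have hset : {i | c i < δ / Real.exp E₀} = {i | ¬ δ ≤ Real.exp E₀ * c i} := by
    ext i
    simp [lt_div_iff₀' (Real.exp_pos E₀)]
  simp only [Function.comp, Pi.div_apply, hset]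
  rw [Set.ncard_eq_toFinset_card _ (h.finite_not_le δ E₀), mul_left_comm, ← mul_add]
  exact mul_div_mul_left _ _ (Real.rpow_pos_of_pos (Real.exp_pos _) _).ne'

end IsRegular

end TrapModel

namespace TrapModel

namespace IsRegular

variable {α : ℝ} {c : ℕ → ℝ}

/-- As the time unit vanishes, the Laplace transform in the waiting time of the infinite volume
correlation function converges: its own Laplace transform in `t` is explicit and converges, and it
is asymptotically equicontinuous in `t`. -/
lemma exists_tendsto_tsum_survProb (hα : 0 < α) (hα1 : α < 1) (h : IsRegular α c) {δ : ℝ}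
    (hδ : 0 < δ) {g : ℝ → ℝ → ℕ → ℝ} (hg1 : ∀ E₀ t, 0 < t → ∀ i, |g E₀ t i| ≤ 1)
    (hgm : ∀ E₀ i, AEStronglyMeasurable (fun t => g E₀ t i) (volume.restrict (Set.Ioi 0)))
    (hgc : ∀ E₀ i s t, 0 < s → s ≤ t →
      |g E₀ t i - g E₀ s i| ≤ min 1 (Real.exp E₀ * c i * (t - s)))
    (hgL : ∀ E₀ w, 0 < w → ∀ H,
      H = (∑' i, {i | δ ≤ Real.exp E₀ * c i}.indicator (fun i => (w + Real.exp E₀ * c i)⁻¹) i) /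
          ((h.finite_not_le δ E₀).toFinset.card + w *
            ∑' i, {i | δ ≤ Real.exp E₀ * c i}.indicator (fun i => (w + Real.exp E₀ * c i)⁻¹) i) →
        ∀ i, ∫ t in Set.Ioi (0 : ℝ), Real.exp (-(w * t)) * g E₀ t i
          = (1 + Real.exp E₀ * c i * H) / (w + Real.exp E₀ * c i))
    {w t : ℝ} (hw : 0 < w) (ht : 0 < t) :
    ∃ y, Tendsto (fun E₀ => (∑' i, g E₀ t i / (w + Real.exp E₀ * c i)) /
      (w * stieltjesSeq (fun i => Real.exp E₀ * c i) w)) atBot (𝓝 y) := by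
  have hx : ∀ E₀ i, 0 < Real.exp E₀ * c i := fun E₀ i => mul_pos (Real.exp_pos _) (h.pos i)
  have hs : ∀ E₀, Summable fun i => (Real.exp E₀ * c i)⁻¹ := fun E₀ =>
    h.summable_inv_const_mul hα hα1 _
  have hZ : ∀ E₀ v, 0 < v → 0 < stieltjesSeq (fun i => Real.exp E₀ * c i) v := fun E₀ v hv =>
    stieltjesSeq_pos (hx E₀) (hs E₀) hv
  have hratio : ∀ v, 0 < v → Tendsto (fun E₀ => stieltjesSeq (fun i => Real.exp E₀ * c i) v /
      stieltjesSeq (fun i => Real.exp E₀ * c i) w) atBot (𝓝 ((v / w) ^ (α - 1))) := fun v hv =>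
    h.tendsto_stieltjesSeq_div hα hα1 hv hw
  refine exists_tendsto_of_laplace (c := w + 1) (C := 1 / w)
    (F := fun E₀ t => (∑' i, g E₀ t i / (w + Real.exp E₀ * c i)) /
      (w * stieltjesSeq (fun i => Real.exp E₀ * c i) w)) (by positivity) ?_ ?_ ?_ ht ?_
  · intro E₀ s hs0
    have h1 := abs_tsum_div_le (hx E₀) (hg1 E₀ s hs0) (b := fun _ => 1) hw
      (by simpa using summable_inv_add (hx E₀) (hs E₀) hw)
    have h2 := hZ E₀ w hw
    rw [abs_div, abs_of_pos (mul_pos hw h2), div_le_div_iff₀ (mul_pos hw h2) hw, one_mul, mul_comm]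
    refine mul_le_mul_of_nonneg_left (h1.trans_eq ?_) hw.le
    simp only [one_div, stieltjesSeq]
  · intro E₀
    simp only [div_eq_mul_inv _ (w * _)]
    exact (aestronglyMeasurable_tsum_div (hx E₀) (hs E₀) (hg1 E₀) (hgm E₀) hw).mul_const _
  · intro m
    -- The resolvent formula needs `w + 1 + m ≠ w`, which is why the progression starts at `w + 1`.
    have hl : 0 < w + 1 + m := by positivity
    have hne : w + 1 + m ≠ w := by
      have : (0 : ℝ) ≤ m := Nat.cast_nonneg m
      exact ne_of_gt (by linarith)
    set l := w + 1 + m with hl_def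
    obtain ⟨H, hH⟩ := h.exists_tendsto_hitting hα hα1 hδ hl
    have h1 := hratio l hl
    have h2 := ((h1.const_sub 1).add (hH.mul ((h1.const_mul l).sub_const w))).div_const
      ((l - w) * w)
    refine ⟨_, h2.congr fun E₀ => ?_⟩
    have hZw := hZ E₀ w hw
    simp only [← mul_div_assoc]
    rw [integral_div, laplace_tsum_div (hx E₀) (hs E₀) (hg1 E₀) (hgm E₀) hw hl]
    simp only [hgL E₀ l hl _ rfl]
    rw [(hasSum_resolvent (hx E₀) (hs E₀) hw hl hne _).tsum_eq]
    have hlw : l - w ≠ 0 := sub_ne_zero.2 hne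
    field_simp
  · intro η hη
    -- The modulus of continuity with step `1 / k` has the limit `2 * ((k / w) ^ α - 1) / (k - w)`.
    have hlim : ∀ k, w < k → Tendsto (fun E₀ => 2 * ((k * stieltjesSeq (fun i => Real.exp E₀ * c i) k
        - w * stieltjesSeq (fun i => Real.exp E₀ * c i) w) / (k - w)) /
          (w * stieltjesSeq (fun i => Real.exp E₀ * c i) w)) atBot
        (𝓝 (2 * ((k * (k / w) ^ (α - 1) - w) / (k - w) / w))) := by
      intro k hk
      have h1 := (((((hratio k (hw.trans hk)).const_mul k).sub_const w).div_const
        (k - w)).div_const w).const_mul 2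
      refine h1.congr fun E₀ => ?_
      have hZw := hZ E₀ w hw
      have hkw : k - w ≠ 0 := sub_ne_zero.2 hk.ne'
      field_simp
    have hsmall : Tendsto (fun k : ℝ => 4 / w * (k / w) ^ (α - 1)) atTop (𝓝 0) := by
      have h1 : Tendsto (fun k : ℝ => k / w) atTop atTop := tendsto_id.atTop_div_const hw
      have h2 := (tendsto_rpow_neg_atTop (show 0 < 1 - α by linarith)).comp h1
      have h3 := h2.const_mul (4 / w)
      rw [mul_zero] at h3
      refine h3.congr fun k => ?_
      simp only [Function.comp, neg_sub]
    obtain ⟨k, hk1, hk2⟩ := ((hsmall.eventually_lt_const hη).and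
      (eventually_ge_atTop (2 * w))).exists
    have hkw : w < k := by linarith
    have hk0 : 0 < k := hw.trans hkw
    have hval : 2 * ((k * (k / w) ^ (α - 1) - w) / (k - w) / w) < η := by
      refine lt_of_le_of_lt ?_ hk1
      have hp : 0 < (k / w) ^ (α - 1) := Real.rpow_pos_of_pos (by positivity) _
      have h1 : (k * (k / w) ^ (α - 1) - w) / (k - w) ≤ 2 * (k / w) ^ (α - 1) := by
        rw [div_le_iff₀ (by linarith)]
        nlinarith
      calc _ ≤ 2 * (2 * (k / w) ^ (α - 1) / w) := by gcongr
        _ = _ := by ring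
    refine ⟨1 / k, by positivity, ?_⟩
    filter_upwards [(hlim k hkw).eventually_le_const hval] with E₀ hE₀ v hv
    refine le_trans ?_ hE₀
    have hZw := hZ E₀ w hw
    have hv0 : 0 < v := ht.trans_le hv.1
    have hsum := fun s hs0 => summable_div_of_bounded (hx E₀) (hs E₀) (hg1 E₀ s hs0) hw
    have hb := ((hasSum_div_mul_inv (hx E₀) (hs E₀) hw hk0 hkw.ne').mul_left 2)
    simp only [← mul_div_assoc] at hb
    have hle : ∀ i, |g E₀ v i - g E₀ t i|
        ≤ 2 * (Real.exp E₀ * c i) / (k + Real.exp E₀ * c i) := by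
      intro i
      refine (hgc E₀ i t v ht hv.1).trans ?_
      have h2 := min_one_mul_le (hx E₀ i) (show 0 < 1 / k by positivity)
      rw [one_div_one_div] at h2
      rw [mul_div_assoc]
      refine le_trans (min_le_min_left _ ?_) h2
      have : v - t ≤ 1 / k := by linarith [hv.2]
      exact mul_le_mul_of_nonneg_left this (hx E₀ i).le
    have h3 := abs_tsum_div_le (hx E₀) hle hw hb.summable
    rw [hb.tsum_eq] at h3
    rw [← sub_div, ← Summable.tsum_sub (hsum v hv0) (hsum t ht), abs_div,
      abs_of_pos (mul_pos hw hZw)]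
    simp only [← sub_div]
    rw [← mul_div_assoc]
    gcongr

/-- The bound on the difference of the two correlation functions in the double limit. -/
noncomputable def errorBound (α δ s : ℝ) : ℝ :=
  Real.exp 2 * (2 * (δ * s) ^ (α - 1)) +
    √(2 * Real.exp 1 * (1 + 1 / (s * δ)) * (2 * (δ * s) ^ (α - 1)))

lemma errorBound_le_of_le (hα1 : α < 1) {δ s v : ℝ} (hδ : 0 < δ) (hs : 0 < s) (hsv : s ≤ v) :
    errorBound α δ v ≤ errorBound α δ s := by
  have h1 : (δ * v) ^ (α - 1) ≤ (δ * s) ^ (α - 1) :=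
    Real.rpow_le_rpow_of_nonpos (by positivity) (by gcongr) (by linarith)
  unfold errorBound
  have : 0 < v := hs.trans_le hsv
  gcongr

lemma tendsto_errorBound (hα1 : α < 1) {δ : ℝ} (hδ : 0 < δ) :
    Tendsto (errorBound α δ) atTop (𝓝 0) := by
  have h1 : Tendsto (fun s : ℝ => δ * s) atTop atTop := tendsto_id.const_mul_atTop hδ
  have h2 : Tendsto (fun s : ℝ => 2 * (δ * s) ^ (α - 1)) atTop (𝓝 0) := by
    have h3 := ((tendsto_rpow_neg_atTop (show 0 < 1 - α by linarith)).comp h1).const_mul 2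
    simpa [Function.comp_def] using h3
  have h3 : Tendsto (fun s : ℝ => 1 + 1 / (s * δ)) atTop (𝓝 (1 + 0)) := by
    refine Tendsto.const_add 1 ?_
    simpa [mul_comm, Function.comp_def] using tendsto_inv_atTop_zero.comp h1
  have h4 := (h2.const_mul (Real.exp 2)).add
    (Real.continuous_sqrt.tendsto _ |>.comp ((h3.const_mul (2 * Real.exp 1)).mul h2))
  simp only [mul_zero, Real.sqrt_zero, add_zero] at h4
  exact h4

/-- The limits of the two correlation functions in infinite volume, and then for a vanishing time
unit. -/
theorem exists_limits (hα : 0 < α) (hα1 : α < 1) (h : IsRegular α c) {δ : ℝ} (hδ : 0 < δ)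
    {t s : ℝ} (ht : 0 < t) (hs : 0 < s) :
    ∃ (L₁ L : ℝ → ℝ) (M : ℝ),
      (∀ E₀, Tendsto (fun N => shallowJumpProb (firstRates (fun i => Real.exp E₀ * c i) N) δ t s)
        atTop (𝓝 (L₁ E₀))) ∧
      (∀ E₀, Tendsto (fun N => stayProb (firstRates (fun i => Real.exp E₀ * c i) N) t s)
        atTop (𝓝 (L E₀))) ∧
      Tendsto L₁ atBot (𝓝 M) ∧ Tendsto L atBot (𝓝 (ageing α (t / s))) ∧
      |M - ageing α (t / s)| ≤ errorBound α δ (s + t) := by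
  have hx : ∀ E₀ i, 0 < Real.exp E₀ * c i := fun E₀ i => mul_pos (Real.exp_pos _) (h.pos i)
  have hsum : ∀ E₀, Summable fun i => (Real.exp E₀ * c i)⁻¹ := fun E₀ =>
    h.summable_inv_const_mul hα hα1 _
  have hinj : ∀ E₀ N, Function.Injective (firstRates (fun i => Real.exp E₀ * c i) N) := by
    intro E₀ N i j hij
    exact Fin.ext (h.strictMono.injective (mul_left_cancel₀ (Real.exp_pos E₀).ne' hij))
  have hxN : ∀ E₀ N i, 0 < firstRates (fun i => Real.exp E₀ * c i) N i := fun E₀ N i => hx E₀ i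
  -- Functions with the universal modulus of continuity are equicontinuous.
  have hequi : ∀ F : ℝ → ℝ → ℝ, (∀ E₀ s v, 0 < s → s ≤ v →
      |F E₀ v - F E₀ s| ≤ √(2 / s ^ 2 * Real.exp 1 * (1 + t / s)) * (v - s)) →
      ∀ η > 0, ∃ ε > 0, ∀ᶠ E₀ in (atBot : Filter ℝ), ∀ v ∈ Set.Icc s (s + ε),
        |F E₀ v - F E₀ s| ≤ η := by
    intro F hF η hη
    set K := √(2 / s ^ 2 * Real.exp 1 * (1 + t / s)) with hK
    have hK0 : 0 ≤ K := Real.sqrt_nonneg _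
    refine ⟨η / (K + 1), by positivity, Eventually.of_forall fun E₀ v hv => ?_⟩
    refine (hF E₀ s v hs hv.1).trans ?_
    have h1 : v - s ≤ η / (K + 1) := by linarith [hv.2]
    calc K * (v - s) ≤ (K + 1) * (η / (K + 1)) := by
          refine mul_le_mul (by linarith) h1 (by linarith [hv.1]) (by linarith)
      _ = η := by field_simp
  -- The limits of infinitely many sites, for every value of the time unit.
  choose g hg hg1 hgm hgc hgL using fun E₀ =>
    exists_tendsto_survProb (hx E₀) (hsum E₀) (h.finite_not_le δ E₀)
  choose L₁ hL₁ hL₁b hL₁m hL₁c hL₁L using fun E₀ =>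
    exists_tendsto_mean_windowProb (hx E₀) (hsum E₀)
      (fun N => {i | δ ≤ firstRates (fun i => Real.exp E₀ * c i) N i}) ht.le (hg E₀ t ht)
  choose L hL hLb hLm hLc hLL using fun E₀ =>
    exists_tendsto_mean_windowProb (hx E₀) (hsum E₀) (fun N => ∅) ht.le
      (tendsto_survProb_empty (hx E₀) ht.le)
  obtain ⟨M, hM⟩ : ∃ M, Tendsto (fun E₀ => L₁ E₀ s) atBot (𝓝 M) := by
    refine exists_tendsto_of_laplace (c := 1) (C := 1) one_pos hL₁b hL₁m (fun m => ?_) hs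
      (hequi L₁ hL₁c)
    simp only [fun E₀ => hL₁L E₀ (1 + m) (by positivity)]
    exact h.exists_tendsto_tsum_survProb hα hα1 hδ hg1 hgm hgc hgL (by positivity) ht
  have hA : Tendsto (fun E₀ => L E₀ s) atBot (𝓝 (ageing α (t / s))) := by
    set C := |Real.sin (Real.pi * α) / Real.pi| *
      ∫ u in (0 : ℝ)..1, u ^ (-α) * (1 - u) ^ (α - 1) with hC
    have hcont := continuousOn_ageing hα hα1 ht
    refine tendsto_of_laplace (c := 1) (C := max 1 C) (G := fun s => ageing α (t / s)) one_pos
      (fun E₀ v hv => (hLb E₀ v hv).trans (le_max_left _ _))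
      (fun v hv => (abs_ageing_le hα hα1 (div_pos ht hv)).trans (le_max_right _ _)) hLm
      (hcont.aestronglyMeasurable measurableSet_Ioi) (fun m => ?_) hs (hequi L hLc)
      (((hcont s hs).continuousAt (Ioi_mem_nhds hs)).continuousWithinAt)
    have hw : (0 : ℝ) < 1 + m := by positivity
    simp only [fun E₀ => hLL E₀ (1 + m) hw]
    rw [laplace_ageing hα hα1 ht hw]
    have h1 := (h.tendsto_rpow_mul_tsum_exp_div hα hα1 ht.le hw).comp Real.tendsto_exp_atBot_nhdsGT
    have h2 := (h.tendsto_exp_mul_stieltjesSeq hα hα1 hw).const_mul (1 + m : ℝ)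
    have h3 := h1.div h2 (mul_pos hw (stieltjesLim_pos hα hα1 hw)).ne'
    refine h3.congr fun E₀ => ?_
    simp only [Pi.div_apply, Function.comp]
    rw [mul_left_comm]
    exact mul_div_mul_left _ _ (Real.rpow_pos_of_pos (Real.exp_pos _) _).ne'
  have hL₁' : ∀ E₀, Tendsto
      (fun N => shallowJumpProb (firstRates (fun i => Real.exp E₀ * c i) N) δ t s) atTop
      (𝓝 (L₁ E₀ s)) := fun E₀ => by
    refine (hL₁ E₀ s hs).congr' ?_
    filter_upwards [eventually_ge_atTop 2] with N hN
    exact (shallowJumpProb_eq_mean hN (hxN E₀ N) (hinj E₀ N) δ t hs.le).symm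
  have hL' : ∀ E₀, Tendsto
      (fun N => stayProb (firstRates (fun i => Real.exp E₀ * c i) N) t s) atTop
      (𝓝 (L E₀ s)) := fun E₀ => by
    refine (hL E₀ s hs).congr' ?_
    filter_upwards [eventually_ge_atTop 2] with N hN
    exact (stayProb_eq_mean hN (hxN E₀ N) t hs.le).symm
  refine ⟨fun E₀ => L₁ E₀ s, fun E₀ => L E₀ s, M, hL₁', hL', hM, hA, ?_⟩
  have hst : 0 < s + t := by positivity
  have hb : ∀ E₀, |L₁ E₀ s - L E₀ s| ≤
      Real.exp 2 * (2 * (stieltjesSeq (fun i => Real.exp E₀ * c i) δ /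
        stieltjesSeq (fun i => Real.exp E₀ * c i) (1 / (s + t)))) +
      √(2 * Real.exp 1 * (1 + 1 / ((s + t) * δ)) *
        (2 * (stieltjesSeq (fun i => Real.exp E₀ * c i) δ /
          stieltjesSeq (fun i => Real.exp E₀ * c i) (1 / (s + t))))) := by
    intro E₀
    have hr := ((tendsto_stieltjes (hx E₀) (hsum E₀) hδ).div
      (tendsto_stieltjes (hx E₀) (hsum E₀) (w := 1 / (s + t)) (by positivity))
      (stieltjesSeq_pos (hx E₀) (hsum E₀) (by positivity)).ne').const_mul 2
    have hr2 := (hr.const_mul (Real.exp 2)).add ((Real.continuous_sqrt.tendsto _).comp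
      (hr.const_mul (2 * Real.exp 1 * (1 + 1 / ((s + t) * δ)))))
    refine le_of_tendsto_of_tendsto ((hL₁' E₀).sub (hL' E₀)).abs hr2 ?_
    filter_upwards [eventually_ge_atTop 2] with N hN
    have h1 := (abs_shallowJumpProb_sub_stayProb_le hN (hxN E₀ N) (hinj E₀ N) δ hs.le ht.le).trans
      (mean_occProb_le hN (hxN E₀ N) hδ hst)
    simpa only [mul_div_assoc, Function.comp, Pi.div_apply] using h1
  have hr := (h.tendsto_stieltjesSeq_div hα hα1 hδ (v := 1 / (s + t)) (by positivity)).const_mul 2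
  have hr2 := (hr.const_mul (Real.exp 2)).add ((Real.continuous_sqrt.tendsto _).comp
    (hr.const_mul (2 * Real.exp 1 * (1 + 1 / ((s + t) * δ)))))
  have := le_of_tendsto_of_tendsto' (hM.sub hA).abs hr2 hb
  rwa [div_div_eq_mul_div, div_one] at this

end IsRegular

/-! ### Energy thresholds -/

section Cutoff

variable {e : ℕ → ℝ}

lemma tendsto_numSites (hanti : StrictAnti e) (hfin : ∀ a, {i | Real.exp (-(e i)) < a}.Finite) :
    Tendsto (numSites e) atBot atTop := by
  refine tendsto_atTop.2 fun n => ?_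
  filter_upwards [eventually_le_atBot (e n)] with E hE
  have hf : {i | E ≤ e i}.Finite := by
    refine (hfin (Real.exp (-E) + 1)).subset fun i (hi : E ≤ e i) => ?_
    have : Real.exp (-(e i)) ≤ Real.exp (-E) := Real.exp_le_exp.2 (neg_le_neg hi)
    exact this.trans_lt (lt_add_one _)
  have h1 : (Set.Iic n).ncard ≤ {i | E ≤ e i}.ncard :=
    Set.ncard_le_ncard (fun i hi => hE.trans (hanti.antitone hi)) hf
  rw [← Finset.coe_Iic, Set.ncard_coe_finset, Nat.card_Iic] at h1
  exact (Nat.le_succ n).trans h1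

/-- The limits of the two correlation functions for a landscape of regular growth. -/
theorem exists_limits_corr {α : ℝ} (hα : 0 < α) (hα1 : α < 1) (hanti : StrictAnti e)
    (h : IsRegular α fun i => Real.exp (-(e i))) {δ : ℝ} (hδ : 0 < δ)
    {t tw : ℝ} (ht : 0 < t) (htw : 0 < tw) :
    ∃ (L₁ L : ℝ → ℝ) (M : ℝ),
      (∀ E₀, Tendsto (fun E => corrOne e δ E E₀ t tw) atBot (𝓝 (L₁ E₀))) ∧
      (∀ E₀, Tendsto (fun E => corr e E E₀ t tw) atBot (𝓝 (L E₀))) ∧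
      Tendsto L₁ atBot (𝓝 M) ∧ Tendsto L atBot (𝓝 (ageing α (t / tw))) ∧
      |M - ageing α (t / tw)| ≤ IsRegular.errorBound α δ (tw + t) := by
  obtain ⟨L₁, L, M, h1, h2, h3⟩ := h.exists_limits hα hα1 hδ ht htw
  have hn := tendsto_numSites hanti h.finite
  exact ⟨L₁, L, M, fun E₀ => (h1 E₀).comp hn, fun E₀ => (h2 E₀).comp hn, h3⟩

end Cutoff

end TrapModel

theorem proposition5p1 {Ω : Type*} [MeasurableSpace Ω] (P : Measure Ω) [IsProbabilityMeasure P]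
    (α : ℝ) (hα₀ : 0 < α) (hα₁ : α < 1) (δ : ℝ) (hδ : 0 < δ)
    (E : ℕ → Ω → ℝ) (hE : TrapModel.IsEnergyLandscape α E P) :
    (∀ᵐ ω ∂P,
      Tendsto
        (fun tw : ℝ => ⨆ (t : ℝ) (_ : 0 < t),
          limsup (fun E₀ : ℝ =>
            limsup (fun Ecut : ℝ =>
              ENNReal.ofReal
                |TrapModel.corrOne (fun i => E i ω) δ Ecut E₀ t tw
                  - TrapModel.corr (fun i => E i ω) Ecut E₀ t tw|) atBot) atBot)
        atTop (𝓝 0)) ∧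
    (∀ᵐ ω ∂P, ∀ θ : ℝ, 0 < θ →
      ∃ (L : ℝ → ℝ → ℝ) (M : ℝ → ℝ),
        (∀ tw : ℝ, 0 < tw → ∀ E₀ : ℝ,
          Tendsto (fun Ecut : ℝ => TrapModel.corrOne (fun i => E i ω) δ Ecut E₀ (θ * tw) tw)
            atBot (𝓝 (L tw E₀))) ∧
        (∀ tw : ℝ, 0 < tw → Tendsto (L tw) atBot (𝓝 (M tw))) ∧
        Tendsto M atTop (𝓝 (TrapModel.ageing α θ))) := by
  refine ⟨?_, ?_⟩
  · filter_upwards [hE.ae_isRegular hα₀, hE.decreasing] with ω hreg hanti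
    have hψ := (ENNReal.continuous_ofReal.tendsto _).comp
      (TrapModel.IsRegular.tendsto_errorBound hα₁ hδ)
    rw [ENNReal.ofReal_zero] at hψ
    refine tendsto_of_tendsto_of_tendsto_of_le_of_le' tendsto_const_nhds hψ
      (Eventually.of_forall fun _ => zero_le) ?_
    filter_upwards [eventually_gt_atTop 0] with tw htw
    refine iSup₂_le fun t ht => ?_
    obtain ⟨L₁, L, M, h1, h2, h3, h4, h5⟩ :=
      TrapModel.exists_limits_corr hα₀ hα₁ hanti hreg hδ ht htw
    have hin : ∀ E₀ : ℝ, limsup (fun Ecut : ℝ =>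
        ENNReal.ofReal |TrapModel.corrOne (fun i => E i ω) δ Ecut E₀ t tw
          - TrapModel.corr (fun i => E i ω) Ecut E₀ t tw|) atBot
        = ENNReal.ofReal |L₁ E₀ - L E₀| := fun E₀ =>
      ((ENNReal.continuous_ofReal.tendsto _).comp ((h1 E₀).sub (h2 E₀)).abs).limsup_eq
    simp only [hin]
    have hout := ((ENNReal.continuous_ofReal.tendsto _).comp (h3.sub h4).abs).limsup_eq
    refine hout.le.trans (ENNReal.ofReal_le_ofReal (h5.trans ?_))
    exact TrapModel.IsRegular.errorBound_le_of_le hα₁ hδ htw (by linarith)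
  · filter_upwards [hE.ae_isRegular hα₀, hE.decreasing] with ω hreg hanti θ hθ
    choose! L₁ L M h1 h2 h3 h4 h5 using fun (tw : ℝ) (htw : 0 < tw) =>
      TrapModel.exists_limits_corr hα₀ hα₁ hanti hreg hδ (mul_pos hθ htw) htw
    refine ⟨L₁, M, h1, h3, ?_⟩
    rw [← tendsto_sub_nhds_zero_iff]
    refine squeeze_zero_norm' ?_ (TrapModel.IsRegular.tendsto_errorBound hα₁ hδ)
    filter_upwards [eventually_gt_atTop 0] with tw htw
    have h6 := h5 tw htw
    rw [mul_div_cancel_right₀ _ htw.ne'] at h6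
    refine h6.trans (TrapModel.IsRegular.errorBound_le_of_le hα₁ hδ htw ?_)
    have := mul_pos hθ htw
    linarith
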